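/- Let $d\ge 2$ and let $\sigma_d(t)=dt$ on $\mathbb S=\mathbb R/\mathbb Z$, identified with the unit circle. A chord is the segment joining two (possibly equal) points of $\mathbb S$; its image $\sigma_d(\ell)$ is the chord joining the images of its endpoints. Two distinct chords are linked if they meet in the open unit disk. A geolamination is a collection of pairwise unlinked chords whose union is closed and which contains all points of $\mathbb S$ as degenerate chords; it is $\sigma_d$-invariant if it contains, with each $\ell$, the image $\sigma_d(\ell)$, some $\ell'$ with $\sigma_d(\ell')=\ell$ and, when $\sigma_d(\ell)$ is non-degenerate, $d$ pairwise disjoint chords $\ell_1=\ell,\dots,\ell_d$ with $\sigma_d(\ell_i)=\sigma_d(\ell)$. The map $\sigma_d$ is order preserving on $X\subset\mathbb S$ if it is one-to-one on $X$ and preserves the positive circular order of triples of points of $X$. The accordion $A_{\ell_2}(\ell_1)$ consists of $\ell_1$ and of all $\sigma_d^n(\ell_2)$, $n\ge 0$, that are linked with $\ell_1$. The chord $\ell_1$ has order preserving accordions with respect to $\ell_2$ if $A_{\ell_2}(\ell_1)\ne\{\ell_1\}$ and, for every $k\ge 0$, $\sigma_d$ is order preserving on the set of endpoints of the chords of $A_{\ell_2}(\sigma_d^k(\ell_1))$;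 if this holds also with $\ell_1,\ell_2$ exchanged, then $\ell_1,\ell_2$ have mutually order preserving accordions. Let $\mathcal L_1,\mathcal L_2$ be $\sigma_d$-invariant geolaminations and let $\ell_a\in\mathcal L_1$, $\ell_x\in\mathcal L_2$ be linked chords with mutually order preserving accordions. Let $B$ be the convex hull of $\ell_a\cup\ell_x$, and let $\sigma_d^i(B)$ denote the convex hull of the $\sigma_d^i$-images of the vertices of $B$. Then (1) or (2) holds. (1) All forward images $\sigma_d^i(B)$, $i\ge 0$, are pairwise disjoint. (2) There exists $r\ge 0$ such that: (a) for $0\le i<r$ the interior of $\sigma_d^i(B)$ is disjoint from every $\sigma_d^j(B)$, $j\neq i$; (b) if $X=\bigcup_{i\ge r}\sigma_d^i(B)$, $Q$ is a connected component of $X$ and $Q'=Q\cap\mathbb S$, then $Q'$ is finite, $\sigma_d|_{Q'}$ is order preserving, there is a least $n\ge 1$ with $\sigma_d^n(Q')=Q'$, and the first return map $\sigma_d^n|_{Q'}$ can be the identity only if $Q$ is a quadrilateral that is one of the polygons $\sigma_d^i(B)$, $i\ge r$ (namely $\sigma_d^r(B)$ itself if $Q$ contains it); moreover, the vertices of $\sigma_d^r(B)$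 are periodic of the same period and belong to two, three, or four distinct periodic orbits; (c) $\ell_a$ and $\ell_x$ are (pre)periodic, and all their endpoints have the same eventual period. -/

import Mathlib

noncomputable section

namespace CircleLam

/-- The circle `ℝ/ℤ`. -/
abbrev S1 : Type := UnitAddCircle

/-- The embedding `t ↦ exp (2πit)` of `ℝ/ℤ` onto the unit circle in the plane. -/
def toPlane (t : S1) : ℂ := (AddCircle.toCircle t : ℂ)

/-- The map `σ_d : t ↦ d t` of the circle. -/
def sigma (d : ℕ) (t : S1) : S1 := d • t

/-- The convex hull in the closed unit disk of a set of points of the circle. -/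
def ch (A : Set S1) : Set ℂ := convexHull ℝ (toPlane '' A)

/-- `Q ∩ 𝕊`: the points of the circle that lie in a subset `Q` of the plane. -/
def basis (Q : Set ℂ) : Set S1 := {t | toPlane t ∈ Q}

/-- A (possibly degenerate) chord is given by the unordered pair of its endpoints. -/
abbrev Chord : Type := Sym2 S1

namespace Chord

/-- The set of endpoints of a chord. -/
def ends (l : Chord) : Set S1 := {t | t ∈ l}

/-- The chord as a closed segment in the plane. -/
def carrier (l : Chord) : Set ℂ := ch (ends l)

/-- The image `σ_d(ℓ)`; it may be degenerate. -/
def image (d : ℕ) (l : Chord) : Chord := Sym2.map (sigma d) l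

/-- Two distinct chords are linked if they intersect in the open unit disk. -/
def Linked (l l' : Chord) : Prop :=
  l ≠ l' ∧ (carrier l ∩ carrier l' ∩ Metric.ball (0 : ℂ) 1).Nonempty

end Chord

/-- A geolamination: a collection of chords which are pairwise disjoint in the open disk, whose
union is closed, and which contains all points of the circle (as degenerate chords). -/
structure IsGeolamination (L : Set Chord) : Prop where
  unlinked : ∀ l ∈ L, ∀ l' ∈ L, ¬ Chord.Linked l l'
  closed : IsClosed (⋃ l ∈ L, Chord.carrier l)
  points : ∀ t : S1, s(t, t) ∈ L

/-- A (sibling) `σ_d`-invariant geolamination. -/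
structure IsInvariantGeolamination (d : ℕ) (L : Set Chord) : Prop extends IsGeolamination L where
  forward : ∀ l ∈ L, Chord.image d l ∈ L
  backward : ∀ l ∈ L, ∃ l' ∈ L, Chord.image d l' = l
  siblings : ∀ l ∈ L, ¬ (Chord.image d l).IsDiag →
    ∃ f : Fin d → Chord, (∃ i, f i = l) ∧ (∀ i, f i ∈ L) ∧
      (∀ i, Chord.image d (f i) = Chord.image d l) ∧
      ∀ i j, i ≠ j → Disjoint (Chord.carrier (f i)) (Chord.carrier (f j))

/-- `σ_d` is order preserving on `X`: it is one-to-one on `X` and preserves the positive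
circular order of triples of points of `X`. -/
def OrderPreservingOn (d : ℕ) (X : Set S1) : Prop :=
  Set.InjOn (sigma d) X ∧
    ∀ x ∈ X, ∀ y ∈ X, ∀ z ∈ X, sbtw x y z → sbtw (sigma d x) (sigma d y) (sigma d z)

/-- The accordion `A_{ℓ₂}(ℓ₁)`: the chords from the forward orbit of `ℓ₂` that are linked with
the axis `ℓ₁`, together with `ℓ₁`. -/
def accordion (d : ℕ) (l₂ l₁ : Chord) : Set Chord :=
  {l | l = l₁ ∨ ((∃ n : ℕ, l = (Chord.image d)^[n] l₂) ∧ Chord.Linked l l₁)}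

/-- The endpoints of the chords of the accordion `A_{ℓ₂}(ℓ₁)`. -/
def accordionEnds (d : ℕ) (l₂ l₁ : Chord) : Set S1 :=
  ⋃ l ∈ accordion d l₂ l₁, Chord.ends l

/-- `ℓ₁` has order preserving accordions with respect to `ℓ₂`. -/
def HasOrderPreservingAccordions (d : ℕ) (l₁ l₂ : Chord) : Prop :=
  accordion d l₂ l₁ ≠ {l₁} ∧
    ∀ k : ℕ, OrderPreservingOn d (accordionEnds d l₂ ((Chord.image d)^[k] l₁))

/-- `ℓ₁` and `ℓ₂` have mutually order preserving accordions. -/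
def MutuallyOrderPreservingAccordions (d : ℕ) (l₁ l₂ : Chord) : Prop :=
  HasOrderPreservingAccordions d l₁ l₂ ∧ HasOrderPreservingAccordions d l₂ l₁

/-- The images under `σ_d^i` of the endpoints of `ℓ₁` and `ℓ₂`. -/
def vertices (d : ℕ) (l₁ l₂ : Chord) (i : ℕ) : Set S1 :=
  (sigma d)^[i] '' (Chord.ends l₁ ∪ Chord.ends l₂)

/-- The forward image `σ_d^i(B)` of `B = ch(ℓ₁, ℓ₂)`, that is, the convex hull of the images of
the vertices. -/
def polygon (d : ℕ) (l₁ l₂ : Chord) (i : ℕ) : Set ℂ := ch (vertices d l₁ l₂ i)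

/-- The union of the polygons in the forward orbit of `σ_d^r(B)`. -/
def orbitUnion (d : ℕ) (l₁ l₂ : Chord) (r : ℕ) : Set ℂ :=
  ⋃ i : ℕ, ⋃ _ : r ≤ i, polygon d l₁ l₂ i

/-- `Q` is a connected component of `X`. -/
def IsComponent (Q X : Set ℂ) : Prop := ∃ z ∈ X, Q = connectedComponentIn X z

/-- The forward `σ_d`-orbit of a point. -/
def orbit (d : ℕ) (t : S1) : Set S1 := {s | ∃ n : ℕ, s = (sigma d)^[n] t}

/-- `t` is (pre)periodic and the points of the cycle it falls into have (exact) period `N`. -/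
def HasEventualPeriod (d N : ℕ) (t : S1) : Prop :=
  0 < N ∧ ∃ m : ℕ, Function.minimalPeriod (sigma d) ((sigma d)^[m] t) = N

/-- `n` is the period of `Q`: the least positive `n` for which `σ_d^n` maps `Q ∩ 𝕊` onto itself.
Then `σ_d^n` restricted to `Q ∩ 𝕊` is the first return map. -/
def IsReturnTime (d : ℕ) (Q : Set ℂ) (n : ℕ) : Prop :=
  IsLeast {n : ℕ | 0 < n ∧ (sigma d)^[n] '' basis Q = basis Q} n

end CircleLam

end

/-!
Write `aᵢ = σ^i(a)` and so on, let `ab` and `xy` be the two given chords, and let the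
quadrilateral at time `i` have the vertices `aᵢ`, `bᵢ`, `xᵢ`, `yᵢ`. All arguments use only the
circular order of these points (`Sys`), two facts about each lamination (`Lam`): its leaves do not
cross, and leaves with a common endpoint keep their order under `σ`, which follows from the
existence of siblings by counting preimages (`IsInvariantGeolamination.sbtw_sigma`), and the fact
that order preserving accordions make crossings persist (`Sys.cross_add`).

Since `σ` is expanding, an orbit that is monotone on the circle, or that accumulates at finitely
many points, is finite (`exists_repeat_of_accumulate`). Hence an image of `ab` is crossed by at
most one image of `xy` in each direction (`Sys.eq_of_same_side`).

Suppose that two of the quadrilaterals meet. Then some vertex is preperiodic. If no two of the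
quadrilaterals cross, a shared vertex yields an uncrossed path, which accumulates at no more than
two points (`Sys.pre_of_touch`). If `ab` crosses a later image of `xy`, the chords form a chain
that turns to one side and winds around the circle less than once, so that an endpoint moves
monotonically (`Sys.pre_of_cross`). By monotonicity at a fixed endpoint all vertices are then
preperiodic (`Sys.exists_fixed_of_pre_vertex`). Let `r` be the first time at which they are
periodic. Crossings pull periodicity back, so that the quadrilaterals before time `r` do not cross
any other (`Sys.fixed_of_cross_later`), and their interiors are disjoint from the others since
uncrossed quadrilaterals are separated by a line (`Sys.exists_gap`).

From time `r` on, the components of the union of the quadrilaterals correspond to the classes of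
the relation generated by `Meet`. That `σ` preserves the order of the vertices of a class is
reduced to the statement that each vertex of the class keeps its side of each chord of the class;
this spreads along crossings and shared vertices (`Sys.good_of_reach`). The delicate case, a
vertex shared by images of both chords, is `Sys.flower`. It relies on the fact that the four
vertices do not lie in a single orbit (`Sys.not_single_orbit`), which also gives the bound on the
number of orbits. Finally, all vertices have the same period `N`, so that a first return map that
is the identity has return time `N`, and a class that returns only at time `N` contains a single
quadrilateral (`Sys.verts_eq_of_isReturnTime`).
-/

noncomputable section

namespace CircleLam

/-! ### Coordinates on the circle -/

/-- The coordinate in `[0, 1)` of a point of the circle measured from the base point `c`. -/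
def pos (c t : S1) : ℝ := (AddCircle.equivIco 1 0 (t - c) : ℝ)

theorem pos_nonneg (c t : S1) : 0 ≤ pos c t := (AddCircle.equivIco 1 0 (t - c)).2.1

theorem pos_lt_one (c t : S1) : pos c t < 1 :=
  (AddCircle.equivIco 1 0 (t - c)).2.2.trans_eq (zero_add 1)

theorem coe_pos (c t : S1) : ((pos c t : ℝ) : S1) = t - c :=
  AddCircle.coe_equivIco (a := (0 : ℝ)) (p := 1) (y := t - c)

theorem pos_coe_add {c : S1} {r : ℝ} (h0 : 0 ≤ r) (h1 : r < 1) : pos c (c + (r : S1)) = r := by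
  unfold pos
  rw [add_sub_cancel_left, AddCircle.equivIco_coe_of_mem]
  exact ⟨h0, by simpa using h1⟩

theorem pos_inj {c s t : S1} : pos c s = pos c t ↔ s = t := by
  constructor
  · intro h
    have := coe_pos c s
    rw [h, coe_pos c t] at this
    exact (sub_left_injective this).symm
  · rintro rfl; rfl

@[simp] theorem pos_self (c : S1) : pos c c = 0 := by
  have := pos_coe_add (c := c) (r := 0) le_rfl one_pos
  simpa using this

/-- Cyclic order of three real numbers. -/
def Cyc (u v w : ℝ) : Prop := (u < v ∧ v < w) ∨ (v < w ∧ w < u) ∨ (w < u ∧ u < v)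

theorem btw_iff (c : S1) {p q r : S1} :
    btw p q r ↔ ¬ Cyc (pos c r) (pos c q) (pos c p) := by
  have key : ∀ u v w : ℝ, 0 ≤ u → u < 1 → 0 ≤ v → v < 1 → 0 ≤ w → w < 1 →
      (btw ((u : ℝ) : S1) (v : S1) (w : S1) ↔ ¬ Cyc w v u) := by
    intro u v w hu hu' hv hv' hw hw'
    have h := QuotientAddGroup.btw_coe_iff' (p := (1 : ℝ)) (x₁ := u) (x₂ := v) (x₃ := w)
    refine h.trans ?_
    have h1 : toIcoMod (one_pos : (0:ℝ) < 1) 0 (v - u) = if u ≤ v then v - u else v - u + 1 := by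
      split_ifs with hh
      · rw [toIcoMod_eq_iff]
        exact ⟨⟨by linarith, by linarith⟩, 0, by simp⟩
      · rw [toIcoMod_eq_iff]
        exact ⟨⟨by linarith, by linarith⟩, -1, by simp⟩
    have h2 : toIocMod (one_pos : (0:ℝ) < 1) 0 (w - u) = if u < w then w - u else w - u + 1 := by
      split_ifs with hh
      · rw [toIocMod_eq_iff]
        exact ⟨⟨by linarith, by linarith⟩, 0, by simp⟩
      · rw [toIocMod_eq_iff]
        exact ⟨⟨by linarith, by linarith⟩, -1, by simp⟩
    rw [h1, h2]
    unfold Cyc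
    split_ifs with h3 h4 h4 <;> constructor <;> intro h5 <;> grind
  have tr : btw p q r ↔ btw (p - c) (q - c) (r - c) := by
    have : ∀ p q r : S1, btw p q r ↔
      ((QuotientAddGroup.equivIcoMod (p := (1:ℝ)) one_pos 0 (q - p) : Set.Ico (0:ℝ) (0+1)) : ℝ) ≤
        (QuotientAddGroup.equivIocMod (p := (1:ℝ)) one_pos 0 (r - p) : Set.Ioc (0:ℝ) (0+1)) :=
      fun _ _ _ => Iff.rfl
    rw [this, this]
    simp
  rw [tr, ← coe_pos, ← coe_pos, ← coe_pos]
  exact key _ _ _ (pos_nonneg _ _) (pos_lt_one _ _) (pos_nonneg _ _) (pos_lt_one _ _)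
    (pos_nonneg _ _) (pos_lt_one _ _)

/-- The circular order is the cyclic order of the coordinates, whatever the base point. -/
theorem sbtw_iff (c : S1) {p q r : S1} :
    sbtw p q r ↔ Cyc (pos c p) (pos c q) (pos c r) := by
  rw [sbtw_iff_not_btw, btw_iff c, not_not]

/-- The chords `pq` and `rs` have distinct endpoints, and those of either separate those of the
other. -/
def Cross (p q r s : S1) : Prop := (sbtw p r q ∧ sbtw q s p) ∨ (sbtw p s q ∧ sbtw q r p)

/-! ### Expansion: orbits with finitely many accumulation points are finite -/

theorem sigma_iterate (d n : ℕ) (t : S1) : (sigma d)^[n] t = d ^ n • t := by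
  induction n with
  | zero => simp
  | succ n ih => rw [Function.iterate_succ_apply', ih, sigma, smul_smul, pow_succ']

theorem norm_nsmul_of_le {D : ℕ} (hD : 0 < D) {t : S1} (h : ‖t‖ ≤ 1 / (2 * D)) :
    ‖D • t‖ = D * ‖t‖ := by
  obtain ⟨x, rfl, hx⟩ : ∃ x : ℝ, (x : S1) = t ∧ ‖t‖ = |x| := by
    induction t using QuotientAddGroup.induction_on with
    | H x =>
      refine ⟨x - round x, ?_, ?_⟩
      · rw [AddCircle.coe_sub, sub_eq_self]
        exact (AddCircle.coe_eq_zero_iff (1 : ℝ)).2 ⟨round x, by simp⟩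
      · exact UnitAddCircle.norm_eq
  rw [hx]
  rw [hx] at h
  have hD' : (0 : ℝ) < D := by exact_mod_cast hD
  have h2 : |(D : ℝ) * x| ≤ 1 / 2 := by
    rw [abs_mul, abs_of_pos hD']
    calc (D : ℝ) * |x| ≤ D * (1 / (2 * D)) := by gcongr
      _ = 1 / 2 := by field_simp
  have h3 : D • (x : S1) = (((D : ℝ) * x : ℝ) : S1) := by
    rw [← AddCircle.coe_nsmul, nsmul_eq_mul]
  rw [h3, (AddCircle.norm_coe_eq_abs_iff (p := (1 : ℝ)) one_ne_zero).2 (by simpa using h2), abs_mul,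
    abs_of_pos hD']

/-- An orbit of the expanding map `σ_d^h` that accumulates only at finitely many points is
finite: near its accumulation points the orbit shadows another orbit, from which it would be
repelled. -/
theorem exists_repeat_of_accumulate {d h : ℕ} (hd : 2 ≤ d) (hh : 0 < h) (t : S1) {W : Set S1}
    (hW : W.Finite)
    (acc : ∀ ε > 0, ∃ K, ∀ k ≥ K, ∃ w ∈ W, dist ((sigma d)^[k * h] t) w < ε) :
    ∃ i j, i < j ∧ (sigma d)^[i * h] t = (sigma d)^[j * h] t := by
  set D := d ^ h with hD
  have hD2 : 2 ≤ D := hd.trans (Nat.le_self_pow hh.ne' d)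
  have hDr : (2 : ℝ) ≤ D := by exact_mod_cast hD2
  set T : ℕ → S1 := fun k => (sigma d)^[k * h] t with hT
  have hstep : ∀ k, T (k + 1) = D • T k := by
    intro k
    simp only [hT]
    rw [add_mul, one_mul, add_comm, Function.iterate_add_apply, sigma_iterate d h]
  -- close to a point of `W`, the image of a point of `W` is that point
  obtain ⟨δ, hδ, hsep⟩ : ∃ δ > 0, ∀ w ∈ W, ∀ w' ∈ W, dist (D • w) w' < δ → D • w = w' := by
    set S : Set (S1 × S1) := {p ∈ W ×ˢ W | D • p.1 ≠ p.2}
    have hS : S.Finite := (hW.prod hW).subset (Set.sep_subset _ _)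
    rcases S.eq_empty_or_nonempty with hE | hne
    · refine ⟨1, one_pos, fun w hw w' hw' _ => ?_⟩
      by_contra hcon
      have : (w, w') ∈ S := ⟨⟨hw, hw'⟩, hcon⟩
      simp [hE] at this
    · obtain ⟨p, hp, hmin⟩ := hS.exists_minimalFor (fun p => dist (D • p.1) p.2) S hne
      refine ⟨dist (D • p.1) p.2, dist_pos.2 hp.2, fun w hw w' hw' hlt => ?_⟩
      by_contra hcon
      have := hmin (j := (w, w')) ⟨⟨hw, hw'⟩, hcon⟩ hlt.le
      exact absurd this (not_le.2 hlt)
  set ε : ℝ := min (1 / (2 * D)) (δ / (D + 1)) with hε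
  have hεpos : 0 < ε := by positivity
  obtain ⟨K, hK⟩ := acc ε hεpos
  choose w hwW hwd using fun n => hK (K + n) (Nat.le_add_right _ _)
  -- the accumulation points shadowing the orbit form an orbit themselves
  have hw1 : ∀ n, D • w n = w (n + 1) := by
    intro n
    refine hsep _ (hwW _) _ (hwW _) ?_
    have h1 : dist (D • w n) (D • T (K + n)) ≤ D * dist (w n) (T (K + n)) := by
      rw [dist_eq_norm, dist_eq_norm, ← smul_sub]
      exact norm_nsmul_le
    have h2 := hwd n
    have h3 := hwd (n + 1)
    change dist (T (K + n)) _ < _ at h2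
    change dist (T (K + n + 1)) _ < _ at h3
    rw [hstep] at h3
    have h4 := dist_triangle (D • w n) (D • T (K + n)) (w (n + 1))
    have h5 : ε ≤ δ / (D + 1) := min_le_right _ _
    rw [le_div_iff₀ (by positivity)] at h5
    rw [dist_comm] at h2
    nlinarith
  have hgrow : ∀ n m, ‖T (K + n + m) - w (n + m)‖ = (D : ℝ) ^ m * ‖T (K + n) - w n‖ := by
    intro n m
    induction m with
    | zero => simp
    | succ m ih =>
      rw [← add_assoc, ← add_assoc, hstep, ← hw1, ← smul_sub,
        norm_nsmul_of_le (by omega), ih, pow_succ]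
      · ring
      · have := (hwd (n + m)).le.trans (min_le_left _ _)
        rw [dist_eq_norm] at this
        rwa [add_assoc]
  -- a positive distance would grow beyond `ε`
  have heq : ∀ n, T (K + n) = w n := by
    intro n
    by_contra hne
    have hpos : 0 < ‖T (K + n) - w n‖ := norm_pos_iff.2 (sub_ne_zero.2 hne)
    obtain ⟨m, hm⟩ := pow_unbounded_of_one_lt (ε / ‖T (K + n) - w n‖) (by linarith : (1:ℝ) < D)
    rw [div_lt_iff₀ hpos, ← hgrow] at hm
    have := hwd (n + m)
    rw [dist_eq_norm] at this
    rw [add_assoc] at hm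
    exact absurd this (not_lt.2 hm.le)
  have := hW.to_subtype
  obtain ⟨i, j, hij, he⟩ := Finite.exists_ne_map_eq_of_infinite (fun n => (⟨w n, hwW n⟩ : W))
  have he' : w i = w j := congrArg Subtype.val he
  rw [← heq, ← heq] at he'
  rcases lt_or_gt_of_ne hij with h | h
  · exact ⟨K + i, K + j, by omega, he'⟩
  · exact ⟨K + j, K + i, by omega, he'.symm⟩

theorem dist_add_coe_le {c t : S1} {r : ℝ} : dist t (c + (r : S1)) ≤ |pos c t - r| := by
  have : t - (c + (r : S1)) = ((pos c t - r : ℝ) : S1) := by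
    rw [AddCircle.coe_sub, coe_pos]; abel
  rw [dist_eq_norm, this, UnitAddCircle.norm_eq]
  simpa using round_le (pos c t - r) 0

/-- An orbit of `σ_d^h` that moves monotonically along the circle cut at a point is finite. -/
theorem exists_repeat_of_monotone {d h : ℕ} (hd : 2 ≤ d) (hh : 0 < h) (t c : S1)
    (hmono : Monotone (fun k => pos c ((sigma d)^[k * h] t)) ∨
      Antitone (fun k => pos c ((sigma d)^[k * h] t))) :
    ∃ i j, i < j ∧ (sigma d)^[i * h] t = (sigma d)^[j * h] t := by
  obtain ⟨L, hL⟩ : ∃ L, Filter.Tendsto (fun k => pos c ((sigma d)^[k * h] t)) Filter.atTop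
      (nhds L) := by
    rcases hmono with hm | hm
    · exact ⟨_, tendsto_atTop_ciSup hm ⟨1, by rintro _ ⟨k, rfl⟩; exact (pos_lt_one _ _).le⟩⟩
    · exact ⟨_, tendsto_atTop_ciInf hm ⟨0, by rintro _ ⟨k, rfl⟩; exact pos_nonneg _ _⟩⟩
  refine exists_repeat_of_accumulate hd hh t (W := {c + (L : S1)}) (Set.finite_singleton _) ?_
  intro ε hε
  obtain ⟨K, hK⟩ := Metric.tendsto_atTop.1 hL ε hε
  exact ⟨K, fun k hk => ⟨_, rfl, lt_of_le_of_lt dist_add_coe_le (hK k hk)⟩⟩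

/-- A bounded sequence of reals, each term of which bounds all later terms from one side,
accumulates at no more than two points. -/
theorem exists_two_limits {φ : ℕ → ℝ} (h0 : ∀ k, 0 ≤ φ k) (h1 : ∀ k, φ k ≤ 1)
    (hs : ∀ k, (∀ j > k, φ k < φ j) ∨ (∀ j > k, φ j < φ k)) :
    ∃ u v : ℝ, ∀ ε > 0, ∃ K, ∀ k ≥ K, |φ k - u| < ε ∨ |φ k - v| < ε := by
  set A : Set ℕ := {k | ∀ j > k, φ k < φ j}
  set B : Set ℕ := {k | ∀ j > k, φ j < φ k}
  have hA : BddAbove (φ '' A) := ⟨1, by rintro _ ⟨k, -, rfl⟩; exact h1 k⟩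
  have hB : BddBelow (φ '' B) := ⟨0, by rintro _ ⟨k, -, rfl⟩; exact h0 k⟩
  refine ⟨sSup (φ '' A), sInf (φ '' B), fun ε hε => ?_⟩
  obtain ⟨K₁, hK₁⟩ : ∃ K, ∀ k ≥ K, k ∈ A → |φ k - sSup (φ '' A)| < ε := by
    rcases A.eq_empty_or_nonempty with hE | hne
    · exact ⟨0, fun k _ hk => by simp [hE] at hk⟩
    · obtain ⟨_, ⟨k₀, hk₀, rfl⟩, hlt⟩ := exists_lt_of_lt_csSup (hne.image φ)
        (sub_lt_self (sSup (φ '' A)) hε)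
      refine ⟨k₀ + 1, fun k hk hkA => ?_⟩
      have h2 := hk₀ k (by omega)
      have h3 := le_csSup hA ⟨k, hkA, rfl⟩
      rw [abs_lt]; constructor <;> linarith
  obtain ⟨K₂, hK₂⟩ : ∃ K, ∀ k ≥ K, k ∈ B → |φ k - sInf (φ '' B)| < ε := by
    rcases B.eq_empty_or_nonempty with hE | hne
    · exact ⟨0, fun k _ hk => by simp [hE] at hk⟩
    · obtain ⟨_, ⟨k₀, hk₀, rfl⟩, hlt⟩ := exists_lt_of_csInf_lt (hne.image φ)
        (lt_add_of_pos_right (sInf (φ '' B)) hε)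
      refine ⟨k₀ + 1, fun k hk hkB => ?_⟩
      have h2 := hk₀ k (by omega)
      have h3 := csInf_le hB ⟨k, hkB, rfl⟩
      rw [abs_lt]; constructor <;> linarith
  refine ⟨max K₁ K₂, fun k hk => ?_⟩
  rcases hs k with h | h
  · exact Or.inl (hK₁ k (le_of_max_le_left hk) h)
  · exact Or.inr (hK₂ k (le_of_max_le_right hk) h)

/-- In an infinite path of pairwise uncrossed chords with distinct vertices, cut the circle at the
first vertex: each vertex then has all later vertices on one side. -/
theorem path_one_side {s : ℕ → S1} (hinj : Function.Injective s)
    (hs : ∀ i j, ¬ Cross (s i) (s (i + 1)) (s j) (s (j + 1))) (k : ℕ) :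
    (∀ j > k, pos (s 0) (s k) < pos (s 0) (s j)) ∨
      (∀ j > k, pos (s 0) (s j) < pos (s 0) (s k)) := by
  have hne : ∀ i j, i ≠ j → pos (s 0) (s i) ≠ pos (s 0) (s j) := fun i j hij h =>
    hij (hinj (pos_inj.1 h))
  induction k with
  | zero =>
    left
    intro j hj
    have := hne 0 j (by omega)
    rw [pos_self] at this ⊢
    exact lt_of_le_of_ne (pos_nonneg _ _) this
  | succ k ih =>
    have key : ∀ j, j > k + 1 → (pos (s 0) (s (k + 1)) < pos (s 0) (s j) ↔
        pos (s 0) (s (k + 1)) < pos (s 0) (s (j + 1))) := by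
      intro j hj
      have hc := hs k j
      have h1 := hne (k + 1) j (by omega)
      have h2 := hne (k + 1) (j + 1) (by omega)
      have h3 : (pos (s 0) (s k) < pos (s 0) (s (k + 1)) ∧ pos (s 0) (s k) < pos (s 0) (s j) ∧
          pos (s 0) (s k) < pos (s 0) (s (j + 1))) ∨ (pos (s 0) (s (k + 1)) < pos (s 0) (s k) ∧
          pos (s 0) (s j) < pos (s 0) (s k) ∧ pos (s 0) (s (j + 1)) < pos (s 0) (s k)) := by
        rcases ih with ih | ih
        · exact Or.inl ⟨ih _ (by omega), ih _ (by omega), ih _ (by omega)⟩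
        · exact Or.inr ⟨ih _ (by omega), ih _ (by omega), ih _ (by omega)⟩
      simp only [Cross, sbtw_iff (s 0), Cyc] at hc
      grind -ring
    have key2 : ∀ n, (pos (s 0) (s (k + 1)) < pos (s 0) (s (k + 2)) ↔
        pos (s 0) (s (k + 1)) < pos (s 0) (s (k + 2 + n))) := by
      intro n
      induction n with
      | zero => rfl
      | succ n ih2 => rw [ih2]; exact key _ (by omega)
    rcases lt_or_gt_of_ne (hne (k + 1) (k + 2) (by omega)) with h | h
    · left
      intro j hj
      have := (key2 (j - (k + 2))).1 h
      rwa [show k + 2 + (j - (k + 2)) = j by omega] at this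
    · right
      intro j hj
      have := mt (key2 (j - (k + 2))).2 (not_lt.2 h.le)
      rw [show k + 2 + (j - (k + 2)) = j by omega] at this
      exact lt_of_le_of_ne (not_lt.1 this) (hne _ _ (by omega))

/-- If the chords joining consecutive points of a `σ_d^h`-orbit are pairwise uncrossed, the orbit
is finite. -/
theorem exists_repeat_of_path {d h : ℕ} (hd : 2 ≤ d) (hh : 0 < h) (t : S1)
    (hs : ∀ i j, ¬ Cross ((sigma d)^[i * h] t) ((sigma d)^[(i + 1) * h] t)
      ((sigma d)^[j * h] t) ((sigma d)^[(j + 1) * h] t)) :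
    ∃ i j, i < j ∧ (sigma d)^[i * h] t = (sigma d)^[j * h] t := by
  by_contra hcon
  have hinj : Function.Injective (fun k => (sigma d)^[k * h] t) := by
    intro i j hij
    by_contra hne
    rcases lt_or_gt_of_ne hne with hl | hl
    · exact hcon ⟨i, j, hl, hij⟩
    · exact hcon ⟨j, i, hl, hij.symm⟩
  set s : ℕ → S1 := fun k => (sigma d)^[k * h] t with hsdef
  obtain ⟨u, v, huv⟩ := exists_two_limits (φ := fun k => pos (s 0) (s k)) (fun _ => pos_nonneg _ _)
    (fun _ => (pos_lt_one _ _).le) (path_one_side hinj hs)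
  refine hcon (exists_repeat_of_accumulate hd hh t (W := {s 0 + (u : S1), s 0 + (v : S1)})
    (by simp) fun ε hε => ?_)
  obtain ⟨K, hK⟩ := huv ε hε
  refine ⟨K, fun k hk => ?_⟩
  rcases hK k hk with h1 | h1
  · exact ⟨_, Or.inl rfl, lt_of_le_of_lt dist_add_coe_le h1⟩
  · exact ⟨_, Or.inr rfl, lt_of_le_of_lt dist_add_coe_le h1⟩

/-! ### Crossing chords -/

theorem Cross.symm {p q r s : S1} (h : Cross p q r s) : Cross r s p q := by
  simp only [Cross, sbtw_iff p, Cyc] at *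
  grind -ring

theorem Cross.flip_left {p q r s : S1} (h : Cross p q r s) : Cross q p r s := by
  simp only [Cross, sbtw_iff p, Cyc] at *
  grind -ring

theorem Cross.flip_right {p q r s : S1} (h : Cross p q r s) : Cross p q s r := Or.symm h

theorem cross_flip_left {p q r s : S1} : Cross q p r s ↔ Cross p q r s :=
  ⟨Cross.flip_left, Cross.flip_left⟩

theorem cross_flip_right {p q r s : S1} : Cross p q s r ↔ Cross p q r s :=
  ⟨Cross.flip_right, Cross.flip_right⟩

theorem Cross.ne {p q r s : S1} (h : Cross p q r s) :
    p ≠ q ∧ p ≠ r ∧ p ≠ s ∧ q ≠ r ∧ q ≠ s ∧ r ≠ s := by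
  simp only [Cross, sbtw_iff p, Cyc, ne_eq, ← pos_inj (c := p)] at *
  grind -ring

theorem sbtw_ne {p q r : S1} (h : sbtw p q r) : p ≠ q ∧ q ≠ r ∧ p ≠ r := by
  simp only [sbtw_iff p, Cyc, ne_eq, ← pos_inj (c := p)] at *
  grind -ring

theorem sbtw_rotate {p q r : S1} : sbtw p q r ↔ sbtw q r p := by
  simp only [sbtw_iff p, Cyc]
  grind -ring

theorem not_sbtw_iff {p q r : S1} (h1 : p ≠ q) (h2 : q ≠ r) (h3 : p ≠ r) :
    ¬ sbtw p q r ↔ sbtw r q p := by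
  simp only [sbtw_iff p, Cyc, ne_eq, ← pos_inj (c := p)] at *
  grind -ring

theorem not_sbtw_iff_swap {p q r : S1} (h1 : p ≠ q) (h2 : q ≠ r) (h3 : p ≠ r) :
    ¬ sbtw p q r ↔ sbtw p r q := by
  rw [not_sbtw_iff h1 h2 h3, sbtw_rotate, sbtw_rotate]

/-! ### Iterates -/

/-- The iterate `σ_d^k`. -/
def it (d k : ℕ) (t : S1) : S1 := (sigma d)^[k] t

@[simp] theorem it_zero (d : ℕ) (t : S1) : it d 0 t = t := rfl

theorem it_it (d m n : ℕ) (t : S1) : it d m (it d n t) = it d (n + m) t := by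
  rw [it, it, it, add_comm, Function.iterate_add_apply]

theorem sigma_it (d k : ℕ) (t : S1) : sigma d (it d k t) = it d (k + 1) t := by
  rw [it, it, Function.iterate_succ_apply']

/-- A forward invariant collection of pairwise uncrossed chords, given as a relation between the
endpoints, in which `σ_d` preserves the circular order of chords with a common endpoint whose
images are nondegenerate and distinct. -/
structure Lam (d : ℕ) (L : S1 → S1 → Prop) : Prop where
  symm : ∀ {p q}, L p q → L q p
  fwd : ∀ {p q}, L p q → L (sigma d p) (sigma d q)
  uncrossed : ∀ {p q r s}, L p q → L r s → ¬ Cross p q r s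
  vertex : ∀ {p q r}, L p q → L p r → sigma d p ≠ sigma d q → sigma d p ≠ sigma d r →
    sigma d q ≠ sigma d r → sbtw p q r → sbtw (sigma d p) (sigma d q) (sigma d r)

theorem Lam.iter {d : ℕ} {L : S1 → S1 → Prop} (hL : Lam d L) {p q : S1} (h : L p q) (k : ℕ) :
    L (it d k p) (it d k q) := by
  induction k with
  | zero => simpa
  | succ k ih => rw [← sigma_it, ← sigma_it]; exact hL.fwd ih

/-- The endpoints of the chord `σ^i(ab)` and of the chords `σ^j(xy)` that cross it. -/
def accEnds (d : ℕ) (a b x y : S1) (i : ℕ) : Set S1 :=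
  {t | t = it d i a ∨ t = it d i b ∨
    ∃ j, Cross (it d i a) (it d i b) (it d j x) (it d j y) ∧ (t = it d j x ∨ t = it d j y)}

/-- Two crossing chords `ab` and `xy` from laminations `L` and `M` with mutually order preserving
accordions. -/
structure Sys (d : ℕ) (L M : S1 → S1 → Prop) (a b x y : S1) : Prop where
  two_le : 2 ≤ d
  lamL : Lam d L
  lamM : Lam d M
  memL : L a b
  memM : M x y
  cross : Cross a b x y
  opA : ∀ i, OrderPreservingOn d (accEnds d a b x y i)
  opX : ∀ i, OrderPreservingOn d (accEnds d x y a b i)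

theorem accEnds_flip_left (d : ℕ) (a b x y : S1) (i : ℕ) :
    accEnds d b a x y i = accEnds d a b x y i := by
  ext t
  simp only [accEnds, Set.mem_ofPred_eq, cross_flip_left (p := it d i a)]
  exact or_left_comm

theorem accEnds_flip_right (d : ℕ) (a b x y : S1) (i : ℕ) :
    accEnds d a b y x i = accEnds d a b x y i := by
  ext t
  simp only [accEnds, Set.mem_ofPred_eq, cross_flip_right (r := it d _ x),
    or_comm (a := t = it d _ y)]

theorem OrderPreservingOn.mono {d : ℕ} {X Y : Set S1} (h : OrderPreservingOn d Y) (hs : X ⊆ Y) :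
    OrderPreservingOn d X :=
  ⟨h.1.mono hs, fun x hx y hy z hz => h.2 x (hs hx) y (hs hy) z (hs hz)⟩

theorem OrderPreservingOn.iff {d : ℕ} {X : Set S1} (h : OrderPreservingOn d X) {p q r : S1}
    (hp : p ∈ X) (hq : q ∈ X) (hr : r ∈ X) :
    sbtw (sigma d p) (sigma d q) (sigma d r) ↔ sbtw p q r := by
  refine ⟨fun hh => ?_, h.2 p hp q hq r hr⟩
  by_contra hn
  obtain ⟨h1, h2, h3⟩ := sbtw_ne hh
  rw [not_sbtw_iff_swap (fun e => h1 (by rw [e])) (fun e => h2 (by rw [e]))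
    (fun e => h3 (by rw [e]))] at hn
  exact (not_sbtw_iff_swap h1 h2 h3).2 (h.2 _ hp _ hr _ hq hn) hh

namespace Sys

variable {d : ℕ} {L M : S1 → S1 → Prop} {a b x y : S1}

theorem swap (S : Sys d L M a b x y) : Sys d M L x y a b :=
  ⟨S.two_le, S.lamM, S.lamL, S.memM, S.memL, S.cross.symm, S.opX, S.opA⟩

theorem flipA (S : Sys d L M a b x y) : Sys d L M b a x y :=
  ⟨S.two_le, S.lamL, S.lamM, S.lamL.symm S.memL, S.memM, S.cross.flip_left,
    fun i => by rw [accEnds_flip_left]; exact S.opA i,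
    fun i => by rw [accEnds_flip_right]; exact S.opX i⟩

theorem flipX (S : Sys d L M a b x y) : Sys d L M a b y x := S.swap.flipA.swap

theorem mem_a (i : ℕ) : it d i a ∈ accEnds d a b x y i := Or.inl rfl

theorem mem_b (i : ℕ) : it d i b ∈ accEnds d a b x y i := Or.inr (Or.inl rfl)

theorem mem_x {i j : ℕ} (h : Cross (it d i a) (it d i b) (it d j x) (it d j y)) :
    it d j x ∈ accEnds d a b x y i := Or.inr (Or.inr ⟨j, h, Or.inl rfl⟩)

theorem mem_y {i j : ℕ} (h : Cross (it d i a) (it d i b) (it d j x) (it d j y)) :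
    it d j y ∈ accEnds d a b x y i := Or.inr (Or.inr ⟨j, h, Or.inr rfl⟩)

theorem cross_succ (S : Sys d L M a b x y) {i j : ℕ}
    (h : Cross (it d i a) (it d i b) (it d j x) (it d j y)) :
    Cross (it d (i + 1) a) (it d (i + 1) b) (it d (j + 1) x) (it d (j + 1) y) := by
  simp only [← sigma_it]
  have h1 := (S.opA i).iff (mem_a i) (mem_x h) (mem_b i)
  have h2 := (S.opA i).iff (mem_b i) (mem_y h) (mem_a i)
  have h3 := (S.opA i).iff (mem_a i) (mem_y h) (mem_b i)
  have h4 := (S.opA i).iff (mem_b i) (mem_x h) (mem_a i)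
  rw [Cross, h1, h2, h3, h4]
  exact h

theorem cross_add (S : Sys d L M a b x y) {i j : ℕ} (k : ℕ)
    (h : Cross (it d i a) (it d i b) (it d j x) (it d j y)) :
    Cross (it d (i + k) a) (it d (i + k) b) (it d (j + k) x) (it d (j + k) y) := by
  induction k with
  | zero => exact h
  | succ k ih => exact S.cross_succ ih

theorem cross_diag (S : Sys d L M a b x y) (i : ℕ) :
    Cross (it d i a) (it d i b) (it d i x) (it d i y) := by
  have := S.cross_add (i := 0) (j := 0) i S.cross
  rwa [zero_add] at this

theorem it_mem (S : Sys d L M a b x y) {i : ℕ} (k : ℕ) {t : S1} (h : t ∈ accEnds d a b x y i) :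
    it d k t ∈ accEnds d a b x y (i + k) := by
  rcases h with rfl | rfl | ⟨j, hj, rfl | rfl⟩
  · rw [it_it]; exact mem_a _
  · rw [it_it]; exact mem_b _
  · rw [it_it]; exact mem_x (S.cross_add k hj)
  · rw [it_it]; exact mem_y (S.cross_add k hj)

theorem it_inj (S : Sys d L M a b x y) {i : ℕ} (k : ℕ) {s t : S1} (hs : s ∈ accEnds d a b x y i)
    (ht : t ∈ accEnds d a b x y i) (h : it d k s = it d k t) : s = t := by
  induction k with
  | zero => exact h
  | succ k ih =>
    rw [← sigma_it, ← sigma_it] at h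
    exact ih ((S.opA (i + k)).1 (S.it_mem k hs) (S.it_mem k ht) h)

theorem it_sbtw (S : Sys d L M a b x y) {i : ℕ} (k : ℕ) {p q r : S1}
    (hp : p ∈ accEnds d a b x y i) (hq : q ∈ accEnds d a b x y i)
    (hr : r ∈ accEnds d a b x y i) :
    sbtw (it d k p) (it d k q) (it d k r) ↔ sbtw p q r := by
  induction k with
  | zero => rfl
  | succ k ih =>
    rw [← sigma_it, ← sigma_it, ← sigma_it,
      (S.opA (i + k)).iff (S.it_mem k hp) (S.it_mem k hq) (S.it_mem k hr), ih]

theorem shift (S : Sys d L M a b x y) (k : ℕ) :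
    Sys d L M (it d k a) (it d k b) (it d k x) (it d k y) := by
  have key : ∀ a b x y i, accEnds d (it d k a) (it d k b) (it d k x) (it d k y) i ⊆
      accEnds d a b x y (k + i) := by
    intro a b x y i t ht
    simp only [accEnds, it_it, Set.mem_ofPred_eq] at ht ⊢
    rcases ht with h | h | ⟨j, h, h'⟩
    · exact Or.inl h
    · exact Or.inr (Or.inl h)
    · exact Or.inr (Or.inr ⟨_, h, h'⟩)
  exact ⟨S.two_le, S.lamL, S.lamM, S.lamL.iter S.memL k, S.lamM.iter S.memM k, S.cross_diag k,
    fun i => (S.opA (k + i)).mono (key _ _ _ _ i), fun i => (S.opX (k + i)).mono (key _ _ _ _ i)⟩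

theorem uncrossedA (S : Sys d L M a b x y) (i j : ℕ) :
    ¬ Cross (it d i a) (it d i b) (it d j a) (it d j b) :=
  S.lamL.uncrossed (S.lamL.iter S.memL i) (S.lamL.iter S.memL j)

theorem uncrossedX (S : Sys d L M a b x y) (i j : ℕ) :
    ¬ Cross (it d i x) (it d i y) (it d j x) (it d j y) :=
  S.swap.uncrossedA i j

end Sys

/-! ### Chords crossing a common chord in the same direction -/

/-- In the positive order, `u ≤ u' < v' ≤ v` on the arc from `u` to `v`. -/
def Nested (u v u' v' : S1) : Prop :=
  (u' = u ∨ sbtw u u' v') ∧ (v' = v ∨ sbtw u v' v) ∧ u ≠ v' ∧ u' ≠ v'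

theorem nested_of_same_side {a b x y x' y' : S1} (h : Cross a b x y) (h' : Cross a b x' y')
    (hs : sbtw a x b ↔ sbtw a x' b) (hn : ¬ Cross x y x' y') :
    Nested x y x' y' ∨ Nested y x y' x' := by
  have h1 := pos_nonneg a b
  simp only [Nested, Cross, sbtw_iff a, Cyc, ne_eq, ← pos_inj (c := a), pos_self] at *
  generalize pos a b = b at *
  generalize pos a x = x at *
  generalize pos a y = y at *
  generalize pos a x' = x' at *
  generalize pos a y' = y' at *
  grind -ring (splits := 30)

theorem Nested.pos_le {c u v u' v' : S1} (h : Nested u v u' v') (hc : pos c u < pos c v) :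
    pos c u ≤ pos c u' ∧ pos c u' < pos c v' ∧ pos c v' ≤ pos c v := by
  simp only [Nested, sbtw_iff c, Cyc, ne_eq, ← pos_inj (c := c)] at *
  generalize pos c u = u at *
  generalize pos c v = v at *
  generalize pos c u' = u' at *
  generalize pos c v' = v' at *
  grind -ring (splits := 30)

/-- A sequence of nested chords forming a `σ^h`-orbit is eventually constant. -/
theorem Nested.exists_eq {d h : ℕ} (hd : 2 ≤ d) (hh : 0 < h) {u v : S1} (huv : u ≠ v)
    (hn : ∀ k, Nested (it d (k * h) u) (it d (k * h) v) (it d ((k + 1) * h) u)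
      (it d ((k + 1) * h) v)) :
    (∃ k, it d (k * h) u = it d ((k + 1) * h) u) ∧
      (∃ k, it d (k * h) v = it d ((k + 1) * h) v) := by
  have hlt : ∀ k, pos u (it d (k * h) u) < pos u (it d (k * h) v) := by
    intro k
    induction k with
    | zero =>
      rw [zero_mul, it_zero, it_zero, pos_self]
      exact lt_of_le_of_ne (pos_nonneg _ _) fun h => huv (pos_inj.1 ((pos_self u).trans h))
    | succ k ih => exact ((hn k).pos_le ih).2.1
  have hmu : Monotone (fun k => pos u (it d (k * h) u)) :=
    monotone_nat_of_le_succ fun k => ((hn k).pos_le (hlt k)).1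
  have hmv : Antitone (fun k => pos u (it d (k * h) v)) :=
    antitone_nat_of_succ_le fun k => ((hn k).pos_le (hlt k)).2.2
  constructor
  · obtain ⟨i, j, hij, he⟩ := exists_repeat_of_monotone hd hh u u (Or.inl hmu)
    refine ⟨i, pos_inj.1 (le_antisymm (hmu (Nat.le_succ i)) ?_)⟩
    refine (hmu (Nat.succ_le_of_lt hij)).trans_eq ?_
    exact congrArg _ he.symm
  · obtain ⟨i, j, hij, he⟩ := exists_repeat_of_monotone hd hh v u (Or.inr hmv)
    refine ⟨i, pos_inj.1 (le_antisymm ?_ (hmv (Nat.le_succ i)))⟩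
    refine Eq.trans_le ?_ (hmv (Nat.succ_le_of_lt hij))
    exact congrArg _ he

namespace Sys

variable {d : ℕ} {L M : S1 → S1 → Prop} {a b x y : S1}

theorem it_nested (S : Sys d L M a b x y) {i : ℕ} (k : ℕ) {u v u' v' : S1}
    (hu : u ∈ accEnds d a b x y i) (hv : v ∈ accEnds d a b x y i)
    (hu' : u' ∈ accEnds d a b x y i) (hv' : v' ∈ accEnds d a b x y i) (h : Nested u v u' v') :
    Nested (it d k u) (it d k v) (it d k u') (it d k v') := by
  obtain ⟨h1, h2, h3, h4⟩ := h
  refine ⟨?_, ?_, fun e => h3 (S.it_inj k hu hv' e), fun e => h4 (S.it_inj k hu' hv' e)⟩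
  · rcases h1 with rfl | h1
    · exact Or.inl rfl
    · exact Or.inr ((S.it_sbtw k hu hu' hv').2 h1)
  · rcases h2 with rfl | h2
    · exact Or.inl rfl
    · exact Or.inr ((S.it_sbtw k hu hv' hv).2 h2)

/-- Two images of `xy` that cross the same image of `ab` in the same direction coincide:
otherwise, the appropriate iterate of `σ` would move the first of them monotonically. -/
theorem eq_of_same_side (S : Sys d L M a b x y) {i j j' : ℕ}
    (h : Cross (it d i a) (it d i b) (it d j x) (it d j y))
    (h' : Cross (it d i a) (it d i b) (it d j' x) (it d j' y))
    (hs : sbtw (it d i a) (it d j x) (it d i b) ↔ sbtw (it d i a) (it d j' x) (it d i b)) :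
    it d j x = it d j' x ∧ it d j y = it d j' y := by
  wlog hjj : j ≤ j' generalizing j j'
  · have := this h' h hs.symm (by omega)
    exact ⟨this.1.symm, this.2.symm⟩
  rcases hjj.eq_or_lt with rfl | hlt
  · exact ⟨rfl, rfl⟩
  obtain ⟨n, hn, rfl⟩ : ∃ n, 0 < n ∧ j' = j + n := ⟨j' - j, by omega, by omega⟩
  have hx := mem_x h
  have hy := mem_y h
  have hx' := mem_x h'
  have hy' := mem_y h'
  have hxy := (Cross.ne h).2.2.2.2.2
  have hit : ∀ k t, it d (k * n) (it d (j + n) t) = it d ((k + 1) * n) (it d j t) := by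
    intro k t
    rw [it_it, it_it]; congr 1; ring
  rcases nested_of_same_side h h' hs (S.uncrossedX _ _) with hN | hN
  · obtain ⟨⟨k, hk⟩, ⟨l, hl⟩⟩ := Nested.exists_eq S.two_le hn hxy fun k => by
      have := S.it_nested (k * n) hx hy hx' hy' hN
      rwa [hit, hit] at this
    exact ⟨S.it_inj (k * n) hx hx' (by rw [hit, hk]), S.it_inj (l * n) hy hy' (by rw [hit, hl])⟩
  · obtain ⟨⟨k, hk⟩, ⟨l, hl⟩⟩ := Nested.exists_eq S.two_le hn hxy.symm fun k => by
      have := S.it_nested (k * n) hy hx hy' hx' hN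
      rwa [hit, hit] at this
    exact ⟨S.it_inj (l * n) hx hx' (by rw [hit, hl]), S.it_inj (k * n) hy hy' (by rw [hit, hk])⟩

end Sys

/-! ### Closed arcs -/

/-- The closed positive arc from `u` to `v`, for distinct `u` and `v`. -/
def Arc (u v t : S1) : Prop := t = u ∨ t = v ∨ sbtw u t v

theorem arc_of_uncrossed {u v p q : S1} (h : u ≠ v) (hn : ¬ Cross u v p q) :
    (Arc u v p ∧ Arc u v q) ∨ (Arc v u p ∧ Arc v u q) := by
  have h0 := pos_nonneg u v
  have h1 := pos_nonneg u p
  have h2 := pos_nonneg u q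
  simp only [Cross, Arc, sbtw_iff u, Cyc, ne_eq, ← pos_inj (c := u), pos_self] at *
  generalize pos u v = v at *
  generalize pos u p = p at *
  generalize pos u q = q at *
  grind -ring (splits := 30)

theorem not_cross_of_arc_of_arc {u v p q r s : S1} (hp : Arc u v p) (hq : Arc u v q)
    (hr : Arc v u r) (hs : Arc v u s) : ¬ Cross p q r s := by
  have h0 := pos_nonneg u v
  have h1 := pos_nonneg u p
  have h2 := pos_nonneg u q
  have h3 := pos_nonneg u r
  have h4 := pos_nonneg u s
  simp only [Cross, Arc, sbtw_iff u, Cyc, ← pos_inj (c := u), pos_self] at *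
  generalize pos u v = v at *
  generalize pos u p = p at *
  generalize pos u q = q at *
  generalize pos u r = r at *
  generalize pos u s = s at *
  have hp' : p ≤ v := by grind -ring
  have hq' : q ≤ v := by grind -ring
  have hr' : r = 0 ∨ v ≤ r := by grind -ring
  have hs' : s = 0 ∨ v ≤ s := by grind -ring
  clear hp hq hr hs
  grind -ring (splits := 30)

/-- Crossing chords that do not cross `uv` lie on the same side of it. -/
theorem arc_of_cross {u v p q r s : S1} (huv : u ≠ v) (h : Cross p q r s)
    (hrs : ¬ Cross u v r s) (hp : Arc u v p) (hq : Arc u v q) : Arc u v r ∧ Arc u v s := by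
  rcases arc_of_uncrossed huv hrs with h1 | h1
  · exact h1
  · exact absurd h (not_cross_of_arc_of_arc hp hq h1.1 h1.2)

/-- `u` and `v` are endpoints of `ab` and `xy`, and all four endpoints lie on the closed arc from
`v` to `u`. -/
def IsGap (a b x y u v : S1) : Prop :=
  u ≠ v ∧ (u = a ∨ u = b ∨ u = x ∨ u = y) ∧ (v = a ∨ v = b ∨ v = x ∨ v = y) ∧
    Arc v u a ∧ Arc v u b ∧ Arc v u x ∧ Arc v u y

theorem IsGap.flip_left {a b x y u v : S1} (h : IsGap b a x y u v) : IsGap a b x y u v := by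
  unfold IsGap at *; tauto

theorem IsGap.swap {a b x y u v : S1} (h : IsGap x y a b u v) : IsGap a b x y u v := by
  unfold IsGap at *; tauto

theorem isGap_of_sbtw {a b x y : S1} (h : Cross a b x y) (hs : sbtw a x b) :
    IsGap a b x y x b := by
  obtain ⟨-, -, -, n, -, -⟩ := h.ne
  refine ⟨n.symm, by tauto, by tauto, ?_⟩
  simp only [Cross, Arc, sbtw_iff x, Cyc, ne_eq, ← pos_inj (c := x), pos_self] at *
  grind -ring (splits := 30)

theorem arc_inter {a b x y t : S1} (h : Cross a b x y) (hs : sbtw a x b) (h5 : Arc a b t)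
    (h6 : Arc x y t) : Arc x b t := by
  have h0 := pos_nonneg x t
  simp only [Cross, Arc, sbtw_iff x, Cyc, ← pos_inj (c := x), pos_self] at *
  grind -ring (splits := 30)

/-- Two pairs of crossing chords with no crossings between the pairs: the second pair lies in a
closed arc between two neighbouring endpoints of the first. -/
theorem exists_gap {a b x y a' b' x' y' : S1} (h : Cross a b x y) (h' : Cross a' b' x' y')
    (h1 : ¬ Cross a b a' b') (h2 : ¬ Cross a b x' y') (h3 : ¬ Cross x y a' b')
    (h4 : ¬ Cross x y x' y') :
    ∃ u v, IsGap a b x y u v ∧ Arc u v a' ∧ Arc u v b' ∧ Arc u v x' ∧ Arc u v y' := by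
  have key : ∀ a b x y : S1, Cross a b x y → ¬ Cross a b x' y' → ¬ Cross x y x' y' →
      Arc a b a' → Arc a b b' → Arc x y a' → Arc x y b' → sbtw a x b →
      ∃ u v, IsGap a b x y u v ∧ Arc u v a' ∧ Arc u v b' ∧ Arc u v x' ∧ Arc u v y' := by
    intro a b x y h h2 h4 A1 A2 A3 A4 hs
    obtain ⟨n1, -, -, -, -, n2⟩ := h.ne
    obtain ⟨B1, B2⟩ := arc_of_cross n1 h' h2 A1 A2
    obtain ⟨B3, B4⟩ := arc_of_cross n2 h' h4 A3 A4
    exact ⟨x, b, isGap_of_sbtw h hs, arc_inter h hs A1 A3, arc_inter h hs A2 A4,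
      arc_inter h hs B1 B3, arc_inter h hs B2 B4⟩
  -- up to renaming, `a'b'` lies in the arcs from `a` to `b` and from `x` to `y`
  have key2 : ∀ a b x y : S1, Cross a b x y → ¬ Cross a b x' y' → ¬ Cross x y x' y' →
      Arc a b a' → Arc a b b' → Arc x y a' → Arc x y b' →
      ∃ u v, IsGap a b x y u v ∧ Arc u v a' ∧ Arc u v b' ∧ Arc u v x' ∧ Arc u v y' := by
    intro a b x y h h2 h4 A1 A2 A3 A4
    rcases h with ⟨hs, hs'⟩ | ⟨hs, hs'⟩
    · exact key a b x y (Or.inl ⟨hs, hs'⟩) h2 h4 A1 A2 A3 A4 hs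
    · have hc : Cross x y a b := Cross.symm (Or.inr ⟨hs, hs'⟩)
      have hs2 : sbtw x a y := by
        clear key h2 h4 A1 A2 A3 A4 hc
        simp only [sbtw_iff x, Cyc, pos_self] at hs hs' ⊢
        grind -ring (splits := 30)
      obtain ⟨u, v, g1, g2⟩ := key x y a b hc h4 h2 A3 A4 A1 A2 hs2
      exact ⟨u, v, g1.swap, g2⟩
  rcases arc_of_uncrossed h.ne.1 h1 with ⟨A1, A2⟩ | ⟨A1, A2⟩ <;>
    rcases arc_of_uncrossed h.ne.2.2.2.2.2 h3 with ⟨A3, A4⟩ | ⟨A3, A4⟩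
  · exact key2 a b x y h h2 h4 A1 A2 A3 A4
  · obtain ⟨u, v, g1, g2⟩ := key2 a b y x h.flip_right h2 (mt cross_flip_left.1 h4) A1 A2 A3 A4
    exact ⟨u, v, g1.swap.flip_left.swap, g2⟩
  · obtain ⟨u, v, g1, g2⟩ := key2 b a x y h.flip_left (mt cross_flip_left.1 h2) h4 A1 A2 A3 A4
    exact ⟨u, v, g1.flip_left, g2⟩
  · obtain ⟨u, v, g1, g2⟩ := key2 b a y x h.flip_left.flip_right
      (mt cross_flip_left.1 h2) (mt cross_flip_left.1 h4) A1 A2 A3 A4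
    exact ⟨u, v, g1.flip_left.swap.flip_left.swap, g2⟩

/-! ### Reflection -/

theorem pos_neg {c t : S1} (h : t ≠ c) : pos (-c) (-t) = 1 - pos c t := by
  have h0 : 0 < pos c t := lt_of_le_of_ne (pos_nonneg _ _) fun e => h
    (pos_inj.1 ((pos_self c).trans e)).symm
  have h1 := pos_lt_one c t
  have : -t = -c + ((1 - pos c t : ℝ) : S1) := by
    rw [AddCircle.coe_sub, coe_pos]
    have : ((1 : ℝ) : S1) = 0 := AddCircle.coe_period 1
    rw [this]; abel
  rw [this, pos_coe_add (by linarith) (by linarith)]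

theorem sbtw_neg {p q r : S1} : sbtw (-p) (-q) (-r) ↔ sbtw r q p := by
  by_cases h1 : q = p
  · subst h1; exact iff_of_false (fun h => (sbtw_ne h).1 rfl) fun h => (sbtw_ne h).2.1 rfl
  by_cases h2 : r = p
  · subst h2; exact iff_of_false (fun h => (sbtw_ne h).2.2 rfl) fun h => (sbtw_ne h).2.2 rfl
  rw [sbtw_iff (-p), sbtw_iff p, pos_neg h1, pos_neg h2]
  have g1 := pos_lt_one p q
  have g2 := pos_lt_one p r
  have g3 := pos_nonneg p q
  have g4 := pos_nonneg p r
  have g5 := fun e => h1 (pos_inj (c := p).1 e)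
  have g6 := fun e => h2 (pos_inj (c := p).1 e)
  simp only [pos_self] at *
  unfold Cyc
  grind -ring

theorem cross_neg {p q r s : S1} : Cross (-p) (-q) (-r) (-s) ↔ Cross p q r s := by
  simp only [Cross, sbtw_neg]
  tauto

theorem sigma_neg (d : ℕ) (t : S1) : sigma d (-t) = -sigma d t := by simp [sigma]

theorem it_neg (d k : ℕ) (t : S1) : it d k (-t) = -it d k t := by
  induction k with
  | zero => rfl
  | succ k ih => rw [← sigma_it, ← sigma_it, ih, sigma_neg]

theorem Lam.neg {d : ℕ} {L : S1 → S1 → Prop} (h : Lam d L) :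
    Lam d (fun p q => L (-p) (-q)) where
  symm := fun hh => h.symm hh
  fwd := fun hh => by rw [← sigma_neg, ← sigma_neg]; exact h.fwd hh
  uncrossed := fun h1 h2 h3 => h.uncrossed h1 h2 (cross_neg.2 h3)
  vertex := fun {p q r} h1 h2 h3 h4 h5 h6 => by
    have := h.vertex h2 h1 (by simpa [sigma_neg] using h4) (by simpa [sigma_neg] using h3)
      (by simpa [sigma_neg] using h5.symm)
      (by rw [sbtw_neg]; exact sbtw_rotate.1 h6)
    rw [sigma_neg, sigma_neg, sigma_neg, sbtw_neg] at this
    exact sbtw_rotate.2 this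

theorem OrderPreservingOn.neg {d : ℕ} {X : Set S1} (h : OrderPreservingOn d X) :
    OrderPreservingOn d {t | -t ∈ X} := by
  refine ⟨fun s hs t ht e => ?_, fun p hp q hq r hr hh => ?_⟩
  · have := h.1 hs ht (by rw [sigma_neg, sigma_neg, e])
    exact neg_injective this
  · have := h.2 _ hr _ hq _ hp (sbtw_neg.2 hh)
    rwa [sigma_neg, sigma_neg, sigma_neg, sbtw_neg] at this

theorem accEnds_neg (d : ℕ) (a b x y : S1) (i : ℕ) :
    accEnds d (-a) (-b) (-x) (-y) i = {t | -t ∈ accEnds d a b x y i} := by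
  ext t
  simp only [accEnds, Set.mem_ofPred_eq, it_neg, cross_neg, neg_eq_iff_eq_neg]

/-- The mirror image of a system. -/
theorem Sys.neg {d : ℕ} {L M : S1 → S1 → Prop} {a b x y : S1} (S : Sys d L M a b x y) :
    Sys d (fun p q => L (-p) (-q)) (fun p q => M (-p) (-q)) (-a) (-b) (-x) (-y) where
  two_le := S.two_le
  lamL := S.lamL.neg
  lamM := S.lamM.neg
  memL := by simpa using S.memL
  memM := by simpa using S.memM
  cross := cross_neg.2 S.cross
  opA := fun i => by rw [accEnds_neg]; exact (S.opA i).neg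
  opX := fun i => by rw [accEnds_neg]; exact (S.opX i).neg

/-! ### Preperiodic points -/

/-- The forward orbit of `t` repeats itself. -/
def Pre (d : ℕ) (t : S1) : Prop := ∃ i j, i < j ∧ it d i t = it d j t

theorem pre_of_repeat {d h : ℕ} (hh : 0 < h) {t : S1}
    (H : ∃ i j, i < j ∧ (sigma d)^[i * h] t = (sigma d)^[j * h] t) : Pre d t := by
  obtain ⟨i, j, hij, he⟩ := H
  exact ⟨i * h, j * h, Nat.mul_lt_mul_of_pos_right hij hh, he⟩

theorem Pre.of_it {d k : ℕ} {t : S1} (h : Pre d (it d k t)) : Pre d t := by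
  obtain ⟨i, j, hij, he⟩ := h
  rw [it_it, it_it] at he
  exact ⟨k + i, k + j, by omega, he⟩

theorem it_mul_of_fixed {d n : ℕ} {t : S1} (h : it d n t = t) (m : ℕ) : it d (m * n) t = t := by
  induction m with
  | zero => simp
  | succ m ih => rw [add_mul, one_mul, ← it_it, ih, h]

theorem it_add_of_fixed {d n : ℕ} {t : S1} (h : it d n t = t) (k : ℕ) :
    it d (k + n) t = it d k t := by
  rw [add_comm, ← it_it, h]

theorem it_fixed {d n : ℕ} {t : S1} (h : it d n t = t) (k : ℕ) :
    it d n (it d k t) = it d k t := by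
  rw [it_it, it_add_of_fixed h]

theorem Pre.exists_fixed {d : ℕ} {t : S1} (h : Pre d t) :
    ∃ K n, 0 < n ∧ it d n (it d K t) = it d K t := by
  obtain ⟨i, j, hij, he⟩ := h
  refine ⟨i, j - i, by omega, ?_⟩
  rw [it_it, show i + (j - i) = j by omega, he]

theorem sbtw_base_iff {c s t : S1} (hs : s ≠ c) :
    sbtw c s t ↔ pos c s < pos c t := by
  have h1 := pos_nonneg c s
  have h2 := pos_nonneg c t
  simp only [sbtw_iff c, Cyc, ne_eq, ← pos_inj (c := c), pos_self] at *
  grind -ring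

/-- If one endpoint of a leaf is fixed by `σ^n` and the other one is not, then the other one moves
monotonically under `σ^n`, since the leaves with a common endpoint keep their order. -/
theorem Lam.strictMono_or_strictAnti {d n : ℕ} {L : S1 → S1 → Prop} (hL : Lam d L) {a b : S1}
    (h : L a b) (ha : it d n a = a) (hab : ∀ i, it d i a ≠ it d i b)
    (hb : ∀ i, it d i b ≠ it d (i + n) b) :
    StrictMono (fun k => pos a (it d (k * n) b)) ∨
      StrictAnti (fun k => pos a (it d (k * n) b)) := by
  have hab' : ∀ i, it d i a ≠ it d (i + n) b := fun i => by
    rw [← it_add_of_fixed ha i]; exact hab _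
  have hLn : ∀ i, L (it d i a) (it d (i + n) b) := fun i => by
    rw [← it_add_of_fixed ha i]; exact hL.iter h _
  have hstep : ∀ i, sbtw (it d i a) (it d i b) (it d (i + n) b) ↔
      sbtw (it d (i + 1) a) (it d (i + 1) b) (it d (i + 1 + n) b) := by
    intro i
    have e : i + n + 1 = i + 1 + n := by ring
    have h1 := hL.vertex (hL.iter h i) (hLn i)
    have h2 := hL.vertex (hLn i) (hL.iter h i)
    simp only [sigma_it, e] at h1 h2
    refine ⟨h1 (hab _) (hab' _) (hb _), fun h3 => ?_⟩
    by_contra h4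
    rw [not_sbtw_iff_swap (hab _) (hb _) (hab' _)] at h4
    exact (not_sbtw_iff_swap (hab _) (hb _) (hab' _)).2 (h2 (hab' _) (hab _) (hb _).symm h4) h3
  have hall : ∀ i, sbtw a b (it d n b) ↔
      sbtw (it d i a) (it d i b) (it d (i + n) b) := by
    intro i
    induction i with
    | zero => simp
    | succ i ih => rw [ih]; exact hstep i
  have hpos : ∀ k, sbtw a b (it d n b) ↔
      pos a (it d (k * n) b) < pos a (it d ((k + 1) * n) b) := by
    intro k
    rw [hall (k * n), it_mul_of_fixed ha, add_mul, one_mul, sbtw_base_iff]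
    have := hab (k * n)
    rw [it_mul_of_fixed ha] at this
    exact this.symm
  by_cases hs : sbtw a b (it d n b)
  · exact Or.inl (strictMono_nat_of_lt_succ fun k => (hpos k).1 hs)
  · refine Or.inr (strictAnti_nat_of_succ_lt fun k => ?_)
    refine lt_of_le_of_ne (not_lt.1 (mt (hpos k).2 hs)) fun e => ?_
    have := hb (k * n)
    rw [show k * n + n = (k + 1) * n by ring] at this
    exact this (pos_inj.1 e).symm

theorem Lam.pre_of_pre {d : ℕ} {L : S1 → S1 → Prop} (hd : 2 ≤ d) (hL : Lam d L) {a b : S1}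
    (h : L a b) (hab : ∀ i, it d i a ≠ it d i b) (ha : Pre d a) : Pre d b := by
  by_contra hb
  obtain ⟨K, n, hn, hK⟩ := ha.exists_fixed
  have := hL.strictMono_or_strictAnti (hL.iter h K) hK
    (fun i => by rw [it_it, it_it]; exact hab _)
    (fun i e => hb ⟨K + i, K + (i + n), by omega, by rw [it_it, it_it] at e; exact e⟩)
  exact hb (pre_of_repeat hn (exists_repeat_of_monotone hd hn _ _
    (this.imp StrictMono.monotone StrictAnti.antitone))).of_it

/-- All the endpoints of the chords `ab` and `xy` are fixed by `σ^n`. -/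
def Fixed (d n : ℕ) (a b x y : S1) : Prop :=
  it d n a = a ∧ it d n b = b ∧ it d n x = x ∧ it d n y = y

theorem Fixed.iter {d n : ℕ} {a b x y : S1} (h : Fixed d n a b x y) (k : ℕ) :
    Fixed d n (it d k a) (it d k b) (it d k x) (it d k y) :=
  ⟨it_fixed h.1 k, it_fixed h.2.1 k, it_fixed h.2.2.1 k, it_fixed h.2.2.2 k⟩

namespace Sys

variable {d : ℕ} {L M : S1 → S1 → Prop} {a b x y : S1}

/-- If `σ^n` fixes both endpoints of one of two crossing chords, it fixes those of the other. -/
theorem fixed_of_fixed (S : Sys d L M a b x y) {n : ℕ} (ha : it d n a = a) (hb : it d n b = b) :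
    it d n x = x ∧ it d n y = y := by
  have h0 := S.cross_diag 0
  have h1 := S.cross_diag n
  rw [ha, hb] at h1
  have h2 := S.it_sbtw n (mem_a 0) (mem_x h0) (mem_b 0)
  simp only [it_zero] at h0 h2
  rw [ha, hb] at h2
  have := S.eq_of_same_side (i := 0) (j := n) (j' := 0) h1 h0 h2
  exact this

theorem ne_it (S : Sys d L M a b x y) (i : ℕ) : it d i a ≠ it d i b := (S.cross_diag i).ne.1

theorem exists_fixed_of_pre (S : Sys d L M a b x y) (ha : Pre d a) :
    ∃ K n, 0 < n ∧ Fixed d n (it d K a) (it d K b) (it d K x) (it d K y) := by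
  obtain ⟨K, n, hn, hK⟩ := ha.exists_fixed
  obtain ⟨K', n', hn', hK'⟩ := (S.lamL.pre_of_pre S.two_le S.memL S.ne_it ha).exists_fixed
  have h1 : it d (n * n') (it d (K + K') a) = it d (K + K') a := by
    have := it_mul_of_fixed (it_fixed hK K') n'
    rwa [it_it d K', mul_comm] at this
  have h2 : it d (n * n') (it d (K + K') b) = it d (K + K') b := by
    have := it_mul_of_fixed (it_fixed hK' K) n
    rwa [it_it d K, add_comm] at this
  exact ⟨K + K', n * n', Nat.mul_pos hn hn', h1, h2, (S.shift (K + K')).fixed_of_fixed h1 h2⟩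

theorem exists_fixed_of_pre_vertex (S : Sys d L M a b x y)
    (h : Pre d a ∨ Pre d b ∨ Pre d x ∨ Pre d y) :
    ∃ K n, 0 < n ∧ Fixed d n (it d K a) (it d K b) (it d K x) (it d K y) := by
  rcases h with h | h | h | h
  · exact S.exists_fixed_of_pre h
  · obtain ⟨K, n, hn, h1, h2, h3, h4⟩ := S.flipA.exists_fixed_of_pre h
    exact ⟨K, n, hn, h2, h1, h3, h4⟩
  · obtain ⟨K, n, hn, h1, h2, h3, h4⟩ := S.swap.exists_fixed_of_pre h
    exact ⟨K, n, hn, h3, h4, h1, h2⟩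
  · obtain ⟨K, n, hn, h1, h2, h3, h4⟩ := S.flipX.swap.exists_fixed_of_pre h
    exact ⟨K, n, hn, h3, h4, h2, h1⟩

/-- If `ab` also crosses a later image of `xy`, periodicity can be pulled back to time `0`. -/
theorem fixed_of_cross (S : Sys d L M a b x y) {h : ℕ} (hh : 0 < h)
    (hc : Cross a b (it d h x) (it d h y)) {K n : ℕ}
    (hK : Fixed d n (it d K a) (it d K b) (it d K x) (it d K y)) : Fixed d n a b x y := by
  have key : ∀ k, Fixed d n (it d (k + h) a) (it d (k + h) b) (it d (k + h) x) (it d (k + h) y) →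
      Fixed d n (it d k a) (it d k b) (it d k x) (it d k y) := by
    rintro k ⟨h1, h2, h3, h4⟩
    have c1 := S.cross_add (i := 0) (j := h) k hc
    rw [zero_add, add_comm h] at c1
    have c2 := S.cross_add n c1
    rw [it_it] at h1 h2 h3 h4
    rw [h3, h4] at c2
    have e1 : it d k a = it d (k + n) a :=
      S.swap.it_inj h (mem_x c1.symm) (mem_x c2.symm)
        (by rw [it_it, it_it, ← h1]; congr 1; ring)
    have e2 : it d k b = it d (k + n) b :=
      S.swap.it_inj h (mem_y c1.symm) (mem_y c2.symm)
        (by rw [it_it, it_it, ← h2]; congr 1; ring)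
    have e1' : it d n (it d k a) = it d k a := by rw [it_it, ← e1]
    have e2' : it d n (it d k b) = it d k b := by rw [it_it, ← e2]
    exact ⟨e1', e2', (S.shift k).fixed_of_fixed e1' e2'⟩
  have hKh : Fixed d n (it d (K * h) a) (it d (K * h) b) (it d (K * h) x) (it d (K * h) y) := by
    have := hK.iter (K * h - K)
    simp only [it_it] at this
    rwa [Nat.add_sub_cancel' (Nat.le_mul_of_pos_right K hh)] at this
  clear hK
  induction K with
  | zero => simpa using hKh
  | succ K ih => exact ih (key _ (by rw [add_mul, one_mul] at hKh; exact hKh))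

end Sys

/-! ### Chains of crossing chords -/

/-- The chord `p₁q₁` crosses `p₀q₀` and then `p₂q₂`, and the two turns are to the same side: the
positive order of the endpoints is `p₀ < p₁ < q₀ ≤ p₂ < q₁ < q₂ ≤ p₀`. -/
def Turn (p₀ q₀ p₁ q₁ p₂ q₂ : S1) : Prop :=
  sbtw p₀ p₁ q₀ ∧ sbtw p₁ p₂ q₁ ∧ sbtw p₀ q₀ q₁ ∧ sbtw p₂ q₁ q₂ ∧
    (p₂ = q₀ ∨ sbtw p₁ q₀ p₂) ∧ (q₂ = p₀ ∨ sbtw q₁ q₂ p₀)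

theorem Turn.coord {p₀ q₀ p₁ q₁ p₂ q₂ : S1} (h : Turn p₀ q₀ p₁ q₁ p₂ q₂) :
    0 < pos p₀ p₁ ∧ pos p₀ p₁ < pos p₀ q₀ ∧ pos p₀ q₀ ≤ pos p₀ p₂ ∧ pos p₀ p₂ < pos p₀ q₁ ∧
      (q₂ = p₀ ∨ pos p₀ q₁ < pos p₀ q₂) := by
  have h1 := pos_nonneg p₀ p₁
  have h2 := pos_nonneg p₀ q₁
  have h3 := pos_nonneg p₀ q₂
  simp only [Turn, sbtw_iff p₀, Cyc, ← pos_inj (c := p₀), pos_self] at *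
  generalize pos p₀ p₁ = p₁ at *
  generalize pos p₀ q₁ = q₁ at *
  generalize pos p₀ q₀ = q₀ at *
  generalize pos p₀ p₂ = p₂ at *
  generalize pos p₀ q₂ = q₂ at *
  grind -ring (splits := 30)

theorem Turn.cross {p₀ q₀ p₁ q₁ p₂ q₂ : S1} (h : Turn p₀ q₀ p₁ q₁ p₂ q₂) :
    Cross p₀ q₀ p₁ q₁ := by
  have h1 := h.coord
  simp only [Cross, sbtw_iff p₀, Cyc, pos_self]
  grind -ring

theorem Turn.arc {p₀ q₀ p₁ q₁ p₂ q₂ : S1} (h : Turn p₀ q₀ p₁ q₁ p₂ q₂) :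
    q₂ ≠ p₂ ∧ Arc q₂ p₂ p₀ ∧ Arc q₂ p₂ q₀ := by
  have h1 := h.coord
  clear h
  simp only [Arc, sbtw_iff p₀, Cyc, ← pos_inj (c := p₀), pos_self, ne_eq] at *
  grind -ring

/-- Seen from a point on all the arcs from `qᵢ` to `pᵢ`, the point `p₀` comes before `p₂`. -/
theorem Turn.sbtw_of_arc {p₀ q₀ p₁ q₁ p₂ q₂ z : S1} (h : Turn p₀ q₀ p₁ q₁ p₂ q₂)
    (h0 : Arc q₀ p₀ z) (h1 : Arc q₁ p₁ z) (h2 : Arc q₂ p₂ z) (hz : z ≠ p₀) (hz' : z ≠ p₂) :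
    sbtw z p₀ p₂ := by
  have h3 := h.coord
  have h4 := pos_nonneg p₀ z
  clear h
  simp only [Arc, sbtw_iff p₀, Cyc, ← pos_inj (c := p₀), pos_self, ne_eq] at *
  generalize pos p₀ p₁ = p₁ at *
  generalize pos p₀ q₁ = q₁ at *
  generalize pos p₀ q₀ = q₀ at *
  generalize pos p₀ p₂ = p₂ at *
  generalize pos p₀ q₂ = q₂ at *
  generalize pos p₀ z = z at *
  have h5 : q₀ ≤ z := by grind -ring (splits := 30)
  have h6 : q₁ ≤ z := by grind -ring (splits := 30)
  grind -ring (splits := 30)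

theorem Turn.neg {p₀ q₀ p₁ q₁ p₂ q₂ : S1} (h : Turn p₀ q₀ p₁ q₁ p₂ q₂) :
    Turn (-q₀) (-p₀) (-p₁) (-q₁) (-q₂) (-p₂) := by
  have h3 := h.coord
  clear h
  simp only [Turn, sbtw_neg, neg_inj]
  simp only [sbtw_iff p₀, Cyc, ← pos_inj (c := p₀), pos_self] at *
  grind -ring (splits := 30)

/-- An infinite chain of chords, each crossing only the next one and turning always to the same
side, winds around the circle less than once. -/
theorem sbtw_of_chain {p q : ℕ → S1}
    (hT : ∀ i, Turn (p i) (q i) (p (i + 1)) (q (i + 1)) (p (i + 2)) (q (i + 2)))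
    (hu : ∀ i j, i + 2 ≤ j → ¬ Cross (p i) (q i) (p j) (q j)) {i : ℕ} (hi : 2 ≤ i)
    (h0 : p 0 ≠ p i) (h2 : p 0 ≠ p (i + 2)) : sbtw (p 0) (p i) (p (i + 2)) := by
  -- every chord of the chain has all chords before its predecessor on the same side
  have back : ∀ j m, m + 2 ≤ j → Arc (q j) (p j) (p (j - 2 - m)) ∧
      Arc (q j) (p j) (q (j - 2 - m)) := by
    intro j m
    induction m with
    | zero =>
      intro hj
      have := (hT (j - 2)).arc.2
      rwa [show j - 2 + 2 = j by omega] at this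
    | succ m ih =>
      intro hj
      obtain ⟨h1, h2⟩ := ih (by omega)
      have hc := (hT (j - 2 - (m + 1))).cross
      rw [show j - 2 - (m + 1) + 1 = j - 2 - m by omega] at hc
      have hne := (hT (j - 2)).arc.1
      rw [show j - 2 + 2 = j by omega] at hne
      refine arc_of_cross hne hc.symm ?_ h1 h2
      intro h3
      exact hu (j - 2 - (m + 1)) j (by omega) h3.flip_left.symm
  have back0 : ∀ j, 2 ≤ j → Arc (q j) (p j) (p 0) := by
    intro j hj
    have := (back j (j - 2) (by omega)).1
    rwa [show j - 2 - (j - 2) = 0 by omega] at this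
  exact (hT i).sbtw_of_arc (back0 _ hi) (back0 _ (by omega)) (back0 _ (by omega)) h0 h2

/-- Two uncrossed chords that cross `ab` in opposite directions form a turn, up to the names of the
endpoints. -/
theorem turn_of_opposite {a b x y x' y' : S1} (h : Cross a b x y) (h' : Cross a b x' y')
    (hs : ¬ (sbtw a x b ↔ sbtw a x' b)) (hu : ¬ Cross x y x' y') :
    Turn y x a b y' x' ∨ Turn x y a b x' y' ∨ Turn x y b a x' y' ∨ Turn y x b a y' x' := by
  have key : ∀ a b x y x' y' : S1, Cross a b x y → Cross a b x' y' → sbtw a x b → ¬ sbtw a x' b →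
      ¬ Cross x y x' y' → Turn y x a b y' x' ∨ Turn x y b a x' y' := by
    intro a b x y x' y' h h' hs hs' hu
    have g0 := pos_nonneg a b
    have g1 := pos_nonneg a x
    have g2 := pos_nonneg a x'
    have g3 := pos_nonneg a y
    have g4 := pos_nonneg a y'
    simp only [Turn, Cross, sbtw_iff a, Cyc, ← pos_inj (c := a), pos_self] at *
    generalize pos a b = b at *
    generalize pos a x = x at *
    generalize pos a y = y at *
    generalize pos a x' = x' at *
    generalize pos a y' = y' at *
    have e1 : 0 < x ∧ x < b ∧ b < y := by grind -ring (splits := 30)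
    have e2 : 0 < y' ∧ y' < b ∧ b < x' := by grind -ring (splits := 30)
    clear h h' hs hs'
    have e3 : (x ≤ y' ∧ x' ≤ y) ∨ (y' ≤ x ∧ y ≤ x') := by grind -ring (splits := 30)
    clear hu
    rcases e3 with e3 | e3
    · left; grind -ring (splits := 30)
    · right; grind -ring (splits := 30)
  by_cases hx : sbtw a x b
  · have hx' : ¬ sbtw a x' b := fun e => hs (iff_of_true hx e)
    rcases key a b x y x' y' h h' hx hx' hu with h1 | h1
    · exact Or.inl h1
    · exact Or.inr (Or.inr (Or.inl h1))
  · have hx' : sbtw a x' b := by by_contra e; exact hs (iff_of_false hx e)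
    have side : ∀ x y, Cross a b x y → (sbtw a y b ↔ ¬ sbtw a x b) := by
      clear key hs hu h h' hx hx'
      intro x y h
      simp only [Cross, sbtw_iff a, Cyc, pos_self] at *
      grind -ring (splits := 30)
    rcases key a b y x y' x' h.flip_right h'.flip_right ((side _ _ h).2 hx)
      (fun e => (side _ _ h').1 e hx')
      (fun e => hu e.flip_left.flip_right) with h1 | h1
    · exact Or.inr (Or.inl h1)
    · exact Or.inr (Or.inr (Or.inr h1))

/-- After the turn from `xy` to `x'y'` along `ab`, the turn from `ab` to `a'b'` along `x'y'` is
either to the same side, or to the other side and then it is a turn of the mirror image. -/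
theorem turn_next {a b x y x' y' a' b' : S1} (h : Turn y x a b y' x') (hc : Cross a' b' x' y')
    (hs : sbtw a' x' b') (hu : ¬ Cross a b a' b') :
    Turn a b y' x' a' b' ∨ Turn (-a) (-b) (-x') (-y') (-a') (-b') := by
  have h1 := h.coord
  have e1 : 0 < pos a y' ∧ pos a y' < pos a b ∧ pos a b < pos a x' := by
    clear h hc hs hu
    have g0 := pos_nonneg a b
    have g1 := pos_nonneg a y'
    have g2 := pos_nonneg a x'
    have h2 : sbtw a y' b ∧ sbtw a b x' := by
      simp only [sbtw_iff y, Cyc, ← pos_inj (c := y), pos_self] at *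
      grind -ring (splits := 30)
    simp only [sbtw_iff a, Cyc, pos_self] at h2
    grind -ring (splits := 30)
  clear h h1
  have g0 := pos_nonneg a a'
  have g1 := pos_nonneg a b'
  simp only [Turn, sbtw_neg, neg_inj]
  simp only [Cross, sbtw_iff a, Cyc, ← pos_inj (c := a), pos_self] at *
  generalize pos a b = b at *
  generalize pos a x' = x' at *
  generalize pos a y' = y' at *
  generalize pos a a' = a' at *
  generalize pos a b' = b' at *
  have e3 : (b ≤ a' ∧ a' < x' ∧ (b' = 0 ∨ x' < b')) ∨ (b' < y' ∧ y' < a' ∧ a' ≤ b) := by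
    grind -ring (splits := 40)
  clear hc hs hu
  rcases e3 with e3 | e3
  · left; grind -ring (splits := 30)
  · right; grind -ring (splits := 30)

/-! ### A quadrilateral crossed by a later one -/

/-- The set of the endpoints of `σ^i(ab)` and `σ^i(xy)`. -/
def verts (d : ℕ) (a b x y : S1) (i : ℕ) : Set S1 :=
  {t | t = it d i a ∨ t = it d i b ∨ t = it d i x ∨ t = it d i y}

namespace Sys

variable {d : ℕ} {L M : S1 → S1 → Prop} {a b x y : S1}

theorem it_turn (S : Sys d L M a b x y) {i : ℕ} (k : ℕ) {p₀ q₀ p₁ q₁ p₂ q₂ : S1}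
    (h1 : p₀ ∈ accEnds d a b x y i) (h2 : q₀ ∈ accEnds d a b x y i)
    (h3 : p₁ ∈ accEnds d a b x y i) (h4 : q₁ ∈ accEnds d a b x y i)
    (h5 : p₂ ∈ accEnds d a b x y i) (h6 : q₂ ∈ accEnds d a b x y i)
    (h : Turn p₀ q₀ p₁ q₁ p₂ q₂) :
    Turn (it d k p₀) (it d k q₀) (it d k p₁) (it d k q₁) (it d k p₂) (it d k q₂) := by
  obtain ⟨g1, g2, g3, g4, g5, g6⟩ := h
  refine ⟨(S.it_sbtw k h1 h3 h2).2 g1, (S.it_sbtw k h3 h5 h4).2 g2, (S.it_sbtw k h1 h2 h4).2 g3,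
    (S.it_sbtw k h5 h4 h6).2 g4, g5.imp (congrArg _) (S.it_sbtw k h3 h2 h5).2,
    g6.imp (congrArg _) (S.it_sbtw k h4 h6 h1).2⟩

/-- If `ab` crosses only `xy` and `σ^h(xy)`, and the chain `xy`, `ab`, `σ^h(xy)`, `σ^h(ab)`, ...
always turns to the same side, then `y` moves monotonically under `σ^h`. -/
theorem pre_of_turn (S : Sys d L M a b x y) {h : ℕ} (hh : 0 < h)
    (hno : ∀ k l, Cross (it d (k * h) a) (it d (k * h) b) (it d (l * h) x) (it d (l * h) y) →
      l = k ∨ l = k + 1)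
    (hc : Cross a b (it d h x) (it d h y))
    (h1 : Turn y x a b (it d h y) (it d h x))
    (h2 : Turn a b (it d h y) (it d h x) (it d h a) (it d h b)) : Pre d y := by
  by_contra hy
  set p : ℕ → S1 := fun i => if i % 2 = 0 then it d (i / 2 * h) y else it d (i / 2 * h) a with hp
  set q : ℕ → S1 := fun i => if i % 2 = 0 then it d (i / 2 * h) x else it d (i / 2 * h) b with hq
  have p0 : ∀ k, p (2 * k) = it d (k * h) y := fun k => by simp [hp]
  have q0 : ∀ k, q (2 * k) = it d (k * h) x := fun k => by simp [hq]
  have p1 : ∀ k, p (2 * k + 1) = it d (k * h) a := fun k => by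
    simp [hp, Nat.add_mod, show (2 * k + 1) / 2 = k by omega]
  have q1 : ∀ k, q (2 * k + 1) = it d (k * h) b := fun k => by
    simp [hq, Nat.add_mod, show (2 * k + 1) / 2 = k by omega]
  have e : ∀ k t, it d (k * h) (it d h t) = it d ((k + 1) * h) t := fun k t => by
    rw [it_it, add_mul, one_mul, add_comm]
  have hT : ∀ i, Turn (p i) (q i) (p (i + 1)) (q (i + 1)) (p (i + 2)) (q (i + 2)) := by
    intro i
    have c0 : Cross (it d 0 a) (it d 0 b) (it d 0 x) (it d 0 y) := S.cross
    have c1 : Cross (it d 0 a) (it d 0 b) (it d h x) (it d h y) := hc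
    rcases Nat.even_or_odd' i with ⟨k, rfl | rfl⟩
    · rw [p0, q0, p1, q1, show 2 * k + 2 = 2 * (k + 1) by ring, p0, q0]
      have := S.it_turn (k * h) (mem_y c0) (mem_x c0) (mem_a 0) (mem_b 0) (mem_y c1) (mem_x c1) h1
      simpa only [it_zero, e] using this
    · rw [p1, q1, show 2 * k + 1 + 1 = 2 * (k + 1) by ring, p0, q0,
        show 2 * k + 1 + 2 = 2 * (k + 1) + 1 by ring, p1, q1]
      have c2 := S.cross_diag h
      have := S.swap.it_turn (k * h) (i := h) (mem_x c1.symm) (mem_y c1.symm) (mem_b h) (mem_a h)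
        (mem_x c2.symm) (mem_y c2.symm) h2
      simpa only [it_zero, e] using this
  have hu : ∀ i j, i + 2 ≤ j → ¬ Cross (p i) (q i) (p j) (q j) := by
    intro i j hij
    rcases Nat.even_or_odd' i with ⟨k, rfl | rfl⟩ <;> rcases Nat.even_or_odd' j with ⟨l, rfl | rfl⟩
    · rw [p0, p0, q0, q0]; exact S.flipX.uncrossedX _ _
    · rw [p0, q0, p1, q1]
      intro hc
      have := hno l k hc.symm.flip_right
      omega
    · rw [p1, q1, p0, q0]
      intro hc
      have := hno k l hc.flip_right
      omega
    · rw [p1, q1, p1, q1]; exact S.uncrossedA _ _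
  have hne : ∀ k, 0 < k → y ≠ it d (k * h) y := fun k hk he =>
    hy ⟨0, k * h, Nat.mul_pos hk hh, he⟩
  have hmono : StrictMono (fun k => pos y (it d (k * h) (it d h y))) := by
    refine strictMono_nat_of_lt_succ fun k => ?_
    have := sbtw_of_chain hT hu (i := 2 * (k + 1)) (by omega)
    rw [show 2 * (k + 1) + 2 = 2 * (k + 2) by ring, p0, p0,
      show p 0 = y by simpa using p0 0] at this
    have := this (hne _ (by omega)) (hne _ (by omega))
    rw [sbtw_base_iff (hne _ (by omega)).symm] at this
    rwa [e, e]
  exact hy (pre_of_repeat hh (exists_repeat_of_monotone S.two_le hh _ y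
    (Or.inl hmono.monotone))).of_it

/-- If `ab` crosses `xy` and also a later image of `xy`, some endpoint is preperiodic. -/
theorem pre_of_cross (S : Sys d L M a b x y) {h : ℕ} (hh : 0 < h)
    (hc : Cross a b (it d h x) (it d h y)) : Pre d a ∨ Pre d b ∨ Pre d x ∨ Pre d y := by
  by_contra hcon
  push Not at hcon
  obtain ⟨-, -, hx, hy⟩ := hcon
  have hcc : ∀ k, Cross (it d (k * h) a) (it d (k * h) b) (it d ((k + 1) * h) x)
      (it d ((k + 1) * h) y) := by
    intro k
    have := S.cross_add (i := 0) (j := h) (k * h) hc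
    rwa [zero_add, show h + k * h = (k + 1) * h by ring] at this
  have hneq : ∀ k l, k ≠ l → it d (k * h) x ≠ it d (l * h) x := by
    intro k l hkl he
    rcases lt_or_gt_of_ne hkl with h1 | h1
    · exact hx ⟨_, _, Nat.mul_lt_mul_of_pos_right h1 hh, he⟩
    · exact hx ⟨_, _, Nat.mul_lt_mul_of_pos_right h1 hh, he.symm⟩
  -- three images of `xy` crossing the same image of `ab` include two in the same direction
  have hno : ∀ k l, Cross (it d (k * h) a) (it d (k * h) b) (it d (l * h) x) (it d (l * h) y) →
      l = k ∨ l = k + 1 := by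
    intro k l hkl
    by_contra hl
    push Not at hl
    have h1 := S.cross_diag (k * h)
    have h2 := hcc k
    have e1 := mt (fun hs => (S.eq_of_same_side h1 h2 hs).1) (hneq _ _ (by omega))
    have e2 := mt (fun hs => (S.eq_of_same_side hkl h1 hs).1) (hneq _ _ hl.1)
    have e3 := mt (fun hs => (S.eq_of_same_side hkl h2 hs).1) (hneq _ _ hl.2)
    tauto
  have c0 : Cross (it d 0 a) (it d 0 b) (it d 0 x) (it d 0 y) := S.cross
  have hopp : ¬ (sbtw a x b ↔ sbtw a (it d h x) b) := by
    intro hs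
    have := (S.eq_of_same_side (i := 0) (j := 0) c0 hc hs).1
    exact hneq 0 1 (by omega) (by simpa using this)
  have hu := S.uncrossedX 0 h
  -- a system in which the first turn is normalised
  have main : ∀ {L M : S1 → S1 → Prop} {a b x y : S1}, Sys d L M a b x y →
      (∀ k l, Cross (it d (k * h) a) (it d (k * h) b) (it d (l * h) x) (it d (l * h) y) →
        l = k ∨ l = k + 1) → Cross a b (it d h x) (it d h y) →
      Turn y x a b (it d h y) (it d h x) → Pre d x ∨ Pre d y := by
    intro L M a b x y S hno hc h1
    have c0 : Cross (it d 0 a) (it d 0 b) (it d 0 x) (it d 0 y) := S.cross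
    have hs : sbtw a x b := by
      have h3 := h1.coord
      simp only [sbtw_iff y, Cyc]
      grind -ring
    rcases turn_next h1 (S.cross_diag h) ((S.it_sbtw h (mem_a 0) (mem_x c0) (mem_b 0)).2 hs)
      (S.uncrossedA 0 h) with h2 | h2
    · exact Or.inr (S.pre_of_turn hh hno hc h1 h2)
    · left
      have hP := S.neg.flipX.pre_of_turn hh
        (fun k l hkl => hno k l (by
          simp only [it_neg, cross_neg] at hkl
          exact hkl.flip_right)) (by
          simp only [it_neg, cross_neg]
          exact hc.flip_right) (by simpa only [it_neg] using h1.neg)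
        (by simpa only [it_neg] using h2)
      obtain ⟨i, j, hij, he⟩ := hP
      exact ⟨i, j, hij, by simpa only [it_neg, neg_inj] using he⟩
  rcases turn_of_opposite c0 hc hopp hu with h1 | h1 | h1 | h1
  · rcases main S hno hc h1 with h2 | h2 <;> tauto
  · rcases main S.flipX (fun k l hkl => hno k l hkl.flip_right) hc.flip_right h1 with h2 | h2 <;>
      tauto
  · rcases main S.flipX.flipA (fun k l hkl => hno k l hkl.flip_right.flip_left)
      hc.flip_right.flip_left h1 with h2 | h2 <;> tauto
  · rcases main S.flipA (fun k l hkl => hno k l hkl.flip_left) hc.flip_left h1 with h2 | h2 <;>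
      tauto

/-! ### Uncrossed quadrilaterals -/

/-- Quadrilaterals that do not cross are separated by two neighbouring vertices `u` and `v` of the
first of them. -/
theorem exists_gap (S : Sys d L M a b x y) {i j : ℕ}
    (h1 : ¬ Cross (it d i a) (it d i b) (it d j x) (it d j y))
    (h2 : ¬ Cross (it d j a) (it d j b) (it d i x) (it d i y)) :
    ∃ u v, u ≠ v ∧ u ∈ verts d a b x y i ∧ v ∈ verts d a b x y i ∧
      (∀ t ∈ verts d a b x y i, Arc v u t) ∧ (∀ t ∈ verts d a b x y j, Arc u v t) := by
  obtain ⟨u, v, ⟨g1, g2, g3, g4, g5, g6, g7⟩, g8, g9, g10, g11⟩ :=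
    CircleLam.exists_gap (S.cross_diag i) (S.cross_diag j) (S.uncrossedA i j) h1
      (fun h => h2 h.symm) (S.uncrossedX i j)
  refine ⟨u, v, g1, g2, g3, ?_, ?_⟩
  · rintro t (rfl | rfl | rfl | rfl) <;> assumption
  · rintro t (rfl | rfl | rfl | rfl) <;> assumption

theorem it_mem_verts {i k : ℕ} {t : S1} (h : t ∈ verts d a b x y i) :
    it d k t ∈ verts d a b x y (i + k) := by
  rcases h with rfl | rfl | rfl | rfl <;> simp [verts, it_it]

/-- If no two quadrilaterals cross but two of them share a vertex, some vertex is preperiodic. -/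
theorem pre_of_touch (S : Sys d L M a b x y)
    (hno : ∀ i j, Cross (it d i a) (it d i b) (it d j x) (it d j y) → i = j)
    {h : ℕ} (hh : 0 < h) {t : S1} (ht : t ∈ verts d a b x y 0)
    (ht' : it d h t ∈ verts d a b x y 0) : Pre d t := by
  refine pre_of_repeat hh (exists_repeat_of_path S.two_le hh t fun i j hc => ?_)
  have m1 : ∀ k, it d (k * h) t ∈ verts d a b x y (k * h) := fun k => by
    simpa using it_mem_verts (k := k * h) ht
  have m2 : ∀ k, it d ((k + 1) * h) t ∈ verts d a b x y (k * h) := fun k => by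
    have := it_mem_verts (k := k * h) ht'
    rwa [it_it, zero_add, show h + k * h = (k + 1) * h by ring] at this
  change Cross (it d (i * h) t) (it d ((i + 1) * h) t) (it d (j * h) t) (it d ((j + 1) * h) t) at hc
  rcases eq_or_ne i j with rfl | hij
  · exact hc.ne.2.1 rfl
  · have hij' : i * h ≠ j * h := fun e => hij (Nat.eq_of_mul_eq_mul_right hh e)
    obtain ⟨u, v, -, -, -, g1, g2⟩ := S.exists_gap (fun h => hij' (hno _ _ h))
      (fun h => hij'.symm (hno _ _ h))
    exact not_cross_of_arc_of_arc (g1 _ (m1 i)) (g1 _ (m2 i)) (g2 _ (m1 j)) (g2 _ (m2 j)) hc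

theorem exists_fixed_of_shift {k : ℕ} (h : ∃ K n, 0 < n ∧ Fixed d n (it d K (it d k a))
      (it d K (it d k b)) (it d K (it d k x)) (it d K (it d k y))) :
    ∃ K n, 0 < n ∧ Fixed d n (it d K a) (it d K b) (it d K x) (it d K y) := by
  obtain ⟨K, n, hn, hF⟩ := h
  simp only [it_it] at hF
  exact ⟨_, n, hn, hF⟩

theorem exists_fixed_of_cross (S : Sys d L M a b x y) {i j : ℕ} (hij : i ≠ j)
    (hc : Cross (it d i a) (it d i b) (it d j x) (it d j y)) :
    ∃ K n, 0 < n ∧ Fixed d n (it d K a) (it d K b) (it d K x) (it d K y) := by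
  rcases lt_or_gt_of_ne hij with h | h
  · obtain ⟨m, hm, rfl⟩ : ∃ m, 0 < m ∧ j = i + m := ⟨j - i, by omega, by omega⟩
    refine exists_fixed_of_shift ((S.shift i).exists_fixed_of_pre_vertex
      ((S.shift i).pre_of_cross hm ?_))
    rwa [it_it, it_it]
  · obtain ⟨m, hm, rfl⟩ : ∃ m, 0 < m ∧ i = j + m := ⟨i - j, by omega, by omega⟩
    obtain ⟨K, n, hn, h1, h2, h3, h4⟩ := (S.shift j).swap.exists_fixed_of_pre_vertex
      ((S.shift j).swap.pre_of_cross hm (by rw [it_it, it_it]; exact hc.symm))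
    exact exists_fixed_of_shift ⟨K, n, hn, h3, h4, h1, h2⟩

/-- If two of the quadrilaterals cross or share a vertex, they are eventually periodic. -/
theorem exists_fixed_of_meet (S : Sys d L M a b x y) {i j : ℕ} (hij : i ≠ j)
    (hm : Cross (it d i a) (it d i b) (it d j x) (it d j y) ∨
      Cross (it d j a) (it d j b) (it d i x) (it d i y) ∨
      (verts d a b x y i ∩ verts d a b x y j).Nonempty) :
    ∃ K n, 0 < n ∧ Fixed d n (it d K a) (it d K b) (it d K x) (it d K y) := by
  by_cases hno : ∀ i j, Cross (it d i a) (it d i b) (it d j x) (it d j y) → i = j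
  · rcases hm with h | h | h
    · exact absurd (hno _ _ h) hij
    · exact absurd (hno _ _ h) hij.symm
    · wlog hlt : i < j generalizing i j
      · exact this hij.symm (by rwa [Set.inter_comm]) (by omega)
      obtain ⟨m, hm, rfl⟩ : ∃ m, 0 < m ∧ j = i + m := ⟨j - i, by omega, by omega⟩
      obtain ⟨t, ht, ht'⟩ := h
      have hno' : ∀ k l, Cross (it d k (it d i a)) (it d k (it d i b)) (it d l (it d i x))
          (it d l (it d i y)) → k = l := by
        intro k l h
        simp only [it_it] at h
        have := hno _ _ h
        omega
      -- a vertex `s` at time `i` with `σ^m(s) = t`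
      obtain ⟨s, hs, rfl⟩ : ∃ s ∈ verts d a b x y i, it d m s = t := by
        rcases ht' with rfl | rfl | rfl | rfl
        · exact ⟨it d i a, by simp [verts], it_it _ _ _ _⟩
        · exact ⟨it d i b, by simp [verts], it_it _ _ _ _⟩
        · exact ⟨it d i x, by simp [verts], it_it _ _ _ _⟩
        · exact ⟨it d i y, by simp [verts], it_it _ _ _ _⟩
      have hP := (S.shift i).pre_of_touch hno' hm (t := s) hs ht
      refine exists_fixed_of_shift ((S.shift i).exists_fixed_of_pre_vertex ?_)
      rcases hs with rfl | rfl | rfl | rfl <;> tauto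
  · push Not at hno
    obtain ⟨i', j', h1, h2⟩ := hno
    exact S.exists_fixed_of_cross h2 h1

/-- If `σ^i(ab)` crosses a later image of `xy`, or vice versa, all endpoints are periodic from
time `i` on. -/
theorem fixed_of_cross_later (S : Sys d L M a b x y) {i j : ℕ} (hij : i < j)
    (hc : Cross (it d i a) (it d i b) (it d j x) (it d j y) ∨
      Cross (it d j a) (it d j b) (it d i x) (it d i y)) :
    ∃ n, 0 < n ∧ Fixed d n (it d i a) (it d i b) (it d i x) (it d i y) := by
  obtain ⟨m, hm, rfl⟩ : ∃ m, 0 < m ∧ j = i + m := ⟨j - i, by omega, by omega⟩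
  obtain ⟨K, n, hn, hF⟩ := S.exists_fixed_of_meet (i := i) (j := i + m) (by omega)
    (by tauto)
  have hF' := hF.iter i
  simp only [it_it, add_comm K] at hF'
  refine ⟨n, hn, ?_⟩
  rcases hc with hc | hc
  · refine (S.shift i).fixed_of_cross hm (by rwa [it_it, it_it]) (K := K) ?_
    simpa only [it_it] using hF'
  · have hF2 : Fixed d n (it d (i + K) x) (it d (i + K) y) (it d (i + K) a) (it d (i + K) b) :=
      ⟨hF'.2.2.1, hF'.2.2.2, hF'.1, hF'.2.1⟩
    obtain ⟨h1, h2, h3, h4⟩ := (S.shift i).swap.fixed_of_cross hm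
      (by rw [it_it, it_it]; exact hc.symm) (K := K) (by simpa only [it_it] using hF2)
    exact ⟨h3, h4, h1, h2⟩

end Sys

/-! ### Periodic systems -/

theorem it_inj_of_fixed {d N k : ℕ} (hN : 0 < N) {s t : S1} (hs : it d N s = s)
    (ht : it d N t = t) (h : it d k s = it d k t) : s = t := by
  have hk : k ≤ k * N := Nat.le_mul_of_pos_right k hN
  have := congrArg (it d (k * N - k)) h
  rwa [it_it, it_it, Nat.add_sub_cancel' hk, it_mul_of_fixed hs, it_mul_of_fixed ht] at this

theorem exists_it_of_fixed {d N k : ℕ} (hN : 0 < N) {s t : S1} (hs : it d N s = s)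
    (h : t = it d k s) : ∃ l, s = it d l t := by
  have hk : k ≤ k * N := Nat.le_mul_of_pos_right k hN
  exact ⟨k * N - k, by rw [h, it_it, Nat.add_sub_cancel' hk, it_mul_of_fixed hs]⟩

/-- The endpoints of a leaf with periodic endpoints have the same period. -/
theorem Lam.fixed_of_fixed {d N n : ℕ} {L : S1 → S1 → Prop} (hL : Lam d L) {a b : S1}
    (h : L a b) (hab : ∀ i, it d i a ≠ it d i b) (hN : 0 < N) (hb : it d N b = b)
    (ha : it d n a = a) : it d n b = b := by
  by_contra hne
  have hmono := hL.strictMono_or_strictAnti h ha hab (fun i e => hne (by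
    rw [add_comm, ← it_it] at e
    exact (it_inj_of_fixed hN hb (it_fixed hb n) e).symm))
  have e : pos a (it d (N * n) b) = pos a (it d (0 * n) b) := by
    rw [mul_comm, it_mul_of_fixed hb, zero_mul, it_zero]
  rcases hmono with hm | hm
  · exact hN.ne' (hm.injective e)
  · exact hN.ne' (hm.injective e)

/-- A chord that crosses two chords on opposite sides of `ab` crosses `ab`. -/
theorem cross_of_cross_opposite {a b z w z' w' u v : S1} (hab : a ≠ b) (hz : z ≠ a ∧ z ≠ b)
    (hz' : z' ≠ a ∧ z' ≠ b) (hs : ¬ (sbtw a z b ↔ sbtw a z' b)) (h1 : ¬ Cross a b z w)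
    (h2 : ¬ Cross a b z' w') (h3 : Cross z w u v) (h4 : Cross z' w' u v) : Cross a b u v := by
  by_contra hc
  have key : (Arc a b z ∧ Arc a b z') ∨ (Arc b a z ∧ Arc b a z') := by
    rcases arc_of_uncrossed hab hc with ⟨g1, g2⟩ | ⟨g1, g2⟩
    · exact Or.inl ⟨(arc_of_cross hab h3.symm h1 g1 g2).1, (arc_of_cross hab h4.symm h2 g1 g2).1⟩
    · exact Or.inr ⟨(arc_of_cross hab.symm h3.symm (mt cross_flip_left.1 h1) g1 g2).1,
        (arc_of_cross hab.symm h4.symm (mt cross_flip_left.1 h2) g1 g2).1⟩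
  clear h1 h2 h3 h4 hc
  have g0 := pos_nonneg a b
  have g1 := pos_nonneg a z
  have g2 := pos_nonneg a z'
  simp only [Arc, sbtw_iff a, Cyc, ← pos_inj (c := a), pos_self, ne_eq] at *
  grind -ring (splits := 30)

theorem not_single_orbit_aux {a b x y x' y' b' : S1} (h : sbtw a x b) (h' : sbtw b y a)
    (h1 : sbtw b x' b') (h2 : sbtw b' y' b) (hx : ¬ Cross a b x x') (hy : ¬ Cross a b y y') :
    False := by
  have g1 := pos_nonneg b a
  have g2 := pos_nonneg b x
  have g3 := pos_nonneg b y
  have g4 := pos_nonneg b x'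
  have g5 := pos_nonneg b y'
  have g6 := pos_nonneg b b'
  simp only [Cross, sbtw_iff b, Cyc, pos_self] at *
  have e1 : 0 < pos b y ∧ pos b y < pos b a ∧ pos b a < pos b x := by grind -ring (splits := 30)
  have e2 : 0 < pos b x' ∧ pos b x' < pos b b' ∧ pos b b' < pos b y' := by
    grind -ring (splits := 30)
  clear h h' h1 h2
  have e3 : pos b a ≤ pos b x' := by grind -ring (splits := 30)
  have e4 : pos b y' ≤ pos b a := by grind -ring (splits := 30)
  linarith

/-- For the positive order `x < a < y < b`, the gap between neighbouring endpoints that contains a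
point `z` of the arc from `a` to `y`, or `a` and a point `z` of the arc from `a` to `b`, is the arc
from `a` to `y`. -/
theorem gap_unique {a b x y u v z : S1} (h : Cross a b x y) (hs : sbtw x a y)
    (hu : u = a ∨ u = b ∨ u = x ∨ u = y) (hv : v = a ∨ v = b ∨ v = x ∨ v = y) (huv : u ≠ v)
    (hA : Arc v u a ∧ Arc v u b ∧ Arc v u x ∧ Arc v u y)
    (hz : Arc u v z) (hz' : sbtw a z y ∨ (sbtw a z b ∧ Arc u v a)) : u = a ∧ v = y := by
  have e1 : 0 < pos a y ∧ pos a y < pos a b ∧ pos a b < pos a x := by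
    clear hu hv huv hA hz hz'
    have g1 := pos_nonneg a b
    have g2 := pos_nonneg a x
    have g3 := pos_nonneg a y
    simp only [Cross, sbtw_iff a, Cyc, pos_self] at *
    grind -ring (splits := 30)
  clear h hs
  obtain ⟨A1, A2, A3, A4⟩ := hA
  have g4 := pos_nonneg a z
  simp only [Arc, sbtw_iff a, Cyc, ← pos_inj (c := a), pos_self, ne_eq] at *
  have e2 : 0 < pos a z ∧ pos a z < pos a b := by
    clear A1 A2 A3 A4 hz hu hv huv
    grind -ring (splits := 30)
  generalize pos a b = b at *
  generalize pos a x = x at *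
  generalize pos a y = y at *
  generalize pos a z = z at *
  generalize pos a u = u at *
  generalize pos a v = v at *
  rcases hu with rfl | rfl | rfl | rfl <;> rcases hv with rfl | rfl | rfl | rfl <;>
    grind -ring (splits := 30)

/-- The order `a < a' < y' < b' ≤ y` of the flower configuration, where `x' = a`. -/
theorem flower_order {a y a' b' y' : S1} (h' : Cross a' b' a y')
    (hs' : sbtw a a' y') (hb' : Arc a y b') :
    pos a a' < pos a y' ∧ pos a y' < pos a b' ∧ pos a b' ≤ pos a y ∧ 0 < pos a a' := by
  have g1 := pos_nonneg a a'
  have g2 := pos_nonneg a b'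
  have g3 := pos_nonneg a y'
  have g4 := pos_nonneg a y
  simp only [Cross, Arc, sbtw_iff a, Cyc, ← pos_inj (c := a), pos_self] at *
  grind -ring (splits := 30)

/-- In the configuration `flower_order`, a quadrilateral in a gap `uv` of `a'b'`, `ay'` with a
vertex in `y` and one in `y'` forces `y = b'`. -/
theorem flower_exit {a y a' b' y' u v : S1}
    (ho : pos a a' < pos a y' ∧ pos a y' < pos a b' ∧ pos a b' ≤ pos a y ∧ 0 < pos a a')
    (hu : u = a' ∨ u = b' ∨ u = a ∨ u = y') (hv : v = a' ∨ v = b' ∨ v = a ∨ v = y')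
    (huv : u ≠ v) (hA : Arc v u a' ∧ Arc v u b' ∧ Arc v u a ∧ Arc v u y')
    (h1 : Arc u v y) (h2 : Arc u v y') : y = b' := by
  obtain ⟨A1, A2, A3, A4⟩ := hA
  simp only [Arc, sbtw_iff a, Cyc, ← pos_inj (c := a), pos_self, ne_eq] at *
  generalize pos a a' = a' at *
  generalize pos a b' = b' at *
  generalize pos a y = y at *
  generalize pos a y' = y' at *
  generalize pos a u = u at *
  generalize pos a v = v at *
  rcases hu with rfl | rfl | rfl | rfl <;> rcases hv with rfl | rfl | rfl | rfl <;>
    grind -ring (splits := 30)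

namespace Sys

variable {d N : ℕ} {L M : S1 → S1 → Prop} {a b x y : S1}

theorem fixed_of_fixed_a (S : Sys d L M a b x y) (hN : 0 < N) (hP : Fixed d N a b x y) {n : ℕ}
    (h : it d n a = a) : Fixed d n a b x y := by
  have hb := S.lamL.fixed_of_fixed S.memL S.ne_it hN hP.2.1 h
  exact ⟨h, hb, S.fixed_of_fixed h hb⟩

theorem fixed_of_fixed_vertex (S : Sys d L M a b x y) (hN : 0 < N) (hP : Fixed d N a b x y)
    {n : ℕ} {t : S1} (ht : t = a ∨ t = b ∨ t = x ∨ t = y) (h : it d n t = t) :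
    Fixed d n a b x y := by
  obtain ⟨p1, p2, p3, p4⟩ := hP
  rcases ht with rfl | rfl | rfl | rfl
  · exact S.fixed_of_fixed_a hN ⟨p1, p2, p3, p4⟩ h
  · obtain ⟨h1, h2, h3, h4⟩ := S.flipA.fixed_of_fixed_a hN ⟨p2, p1, p3, p4⟩ h
    exact ⟨h2, h1, h3, h4⟩
  · obtain ⟨h1, h2, h3, h4⟩ := S.swap.fixed_of_fixed_a hN ⟨p3, p4, p1, p2⟩ h
    exact ⟨h3, h4, h1, h2⟩
  · obtain ⟨h1, h2, h3, h4⟩ := S.flipX.swap.fixed_of_fixed_a hN ⟨p4, p3, p1, p2⟩ h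
    exact ⟨h3, h4, h2, h1⟩

/-- The endpoints of `ab` and `xy` do not all belong to the same periodic orbit. -/
theorem not_single_orbit (S : Sys d L M a b x y) {k s s' : ℕ} (hb : b = it d k a)
    (hx : x = it d s a) (hy : y = it d s' a) : False := by
  have key : ∀ {x y : S1} {s s' : ℕ}, Sys d L M a b x y → x = it d s a → y = it d s' a →
      sbtw a x b → sbtw b y a → False := by
    intro x y s s' S hx hy h1 h2
    have c0 : Cross (it d 0 a) (it d 0 b) (it d 0 x) (it d 0 y) := S.cross
    have o1 := (S.it_sbtw k (mem_a 0) (mem_x c0) (mem_b 0)).2 h1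
    have o2 := (S.it_sbtw k (mem_b 0) (mem_y c0) (mem_a 0)).2 h2
    simp only [it_zero, ← hb] at o1 o2
    have l1 := S.lamL.iter S.memL s
    have l2 := S.lamL.iter S.memL s'
    have e : ∀ s, it d s b = it d k (it d s a) := fun s => by
      rw [hb, it_it, it_it, add_comm]
    rw [e, ← hx] at l1
    rw [e, ← hy] at l2
    exact not_single_orbit_aux h1 h2 o1 o2 (S.lamL.uncrossed S.memL l1)
      (S.lamL.uncrossed S.memL l2)
  rcases S.cross with ⟨h1, h2⟩ | ⟨h1, h2⟩
  · exact key S hx hy h1 h2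
  · exact key S.flipX hy hx h1 h2

/-- If the orbits of `x` and `a` coincide, two images of `ab` and `xy` cross only if they belong to
the same quadrilateral. Otherwise some image of `xy` crosses two images of `ab` that lie on opposite
sides of a third one; it is then the third chord to cross that one, which is impossible. -/
theorem eq_of_cross_of_orbit (S : Sys d L M a b x y) (hN : 0 < N) (hP : Fixed d N a b x y)
    {i₀ s₀ : ℕ} (h0 : it d i₀ x = it d s₀ a) {i j : ℕ}
    (hc : Cross (it d i a) (it d i b) (it d j x) (it d j y)) :
    it d j x = it d i x ∧ it d j y = it d i y := by
  obtain ⟨h, hx, hy⟩ : ∃ h, it d j x = it d (i + h) x ∧ it d j y = it d (i + h) y := by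
    have hle : i ≤ i * N := Nat.le_mul_of_pos_right i hN
    refine ⟨i * N - i + j, ?_, ?_⟩
    · rw [show i + (i * N - i + j) = i * N + j by omega, ← it_it, it_mul_of_fixed hP.2.2.1]
    · rw [show i + (i * N - i + j) = i * N + j by omega, ← it_it, it_mul_of_fixed hP.2.2.2]
  rw [hx, hy] at hc ⊢
  clear hx hy j
  by_contra hne
  have hle : i ≤ i * N := Nat.le_mul_of_pos_right i hN
  -- times `e` and `s`, both at least `i`, with `x_e = a_s`
  obtain ⟨e, s, f, g, he, hs, hes⟩ : ∃ e s f g, e = i + f ∧ s = i + g ∧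
      it d e x = it d s a := by
    refine ⟨i * N + i₀, i * N + s₀, i * N - i + i₀, i * N - i + s₀, by omega, by omega, ?_⟩
    rw [← it_it, ← it_it, it_mul_of_fixed hP.1, it_mul_of_fixed hP.2.2.1, h0]
  have hes' : it d (e + h) x = it d (s + h) a := by
    rw [← it_it, ← it_it, hes]
  have c1 := S.cross_diag e
  have c2 := S.cross_add f hc
  rw [← he, show i + h + f = e + h by omega] at c2
  have c3 := S.cross_add g hc
  rw [← hs, show i + h + g = s + h by omega] at c3
  have c4 := S.cross_diag (s + h)
  have hopp : ¬ (sbtw (it d e a) (it d e x) (it d e b) ↔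
      sbtw (it d e a) (it d (e + h) x) (it d e b)) := by
    intro hs
    obtain ⟨g1, g2⟩ := S.eq_of_same_side c1 c2 hs
    refine hne ⟨?_, ?_⟩
    · rw [he, show i + f + h = i + h + f by omega, ← it_it, ← it_it d f] at g1
      exact (it_inj_of_fixed hN (it_fixed hP.2.2.1 _) (it_fixed hP.2.2.1 _) g1).symm
    · rw [he, show i + f + h = i + h + f by omega, ← it_it, ← it_it d f] at g2
      exact (it_inj_of_fixed hN (it_fixed hP.2.2.2 _) (it_fixed hP.2.2.2 _) g2).symm
  have c5 : Cross (it d e a) (it d e b) (it d (s + h) x) (it d (s + h) y) := by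
    refine cross_of_cross_opposite (z := it d e x) (w := it d s b) (z' := it d (e + h) x)
      (w' := it d (s + h) b) c1.ne.1 ⟨c1.ne.2.1.symm, c1.ne.2.2.2.1.symm⟩
      ⟨c2.ne.2.1.symm, c2.ne.2.2.2.1.symm⟩ hopp ?_ ?_ ?_ ?_
    · rw [hes]; exact S.uncrossedA _ _
    · rw [hes']; exact S.uncrossedA _ _
    · rw [hes]; exact c3
    · rw [hes']; exact c4
  have n1 : it d (s + h) x ≠ it d e x := by rw [hes]; exact c3.ne.2.1.symm
  have n2 : it d (s + h) x ≠ it d (e + h) x := by rw [hes']; exact c4.ne.2.1.symm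
  have m1 := mt (fun hs => (S.eq_of_same_side c5 c1 hs).1) n1
  have m2 := mt (fun hs => (S.eq_of_same_side c5 c2 hs).1) n2
  tauto

/-- Suppose that `σ^m(x) = a`, so that the quadrilateral at time `m` touches the first one in `a`.
If the positive order is `x < a < y < b`, the touching quadrilateral lies on the arc from `x` to
`a`: if it were on the arc from `a` to `y`, so would be its images under `σ^m`, which then never
return to the first one; they can leave the arc only through `y`, and then all vertices are in one
orbit. -/
theorem flower (S : Sys d L M a b x y) (hN : 0 < N) (hP : Fixed d N a b x y) {m : ℕ}
    (hm : it d m x = a) (ho : sbtw x a y) : sbtw a b (it d m y) := by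
  have hNC := fun {i j : ℕ} => S.eq_of_cross_of_orbit hN hP (i₀ := m) (s₀ := 0) hm (i := i) (j := j)
  have c0 : Cross (it d 0 a) (it d 0 b) (it d 0 x) (it d 0 y) := S.cross
  have cm := S.cross_diag m
  rw [hm] at cm
  by_contra hcon
  have n1 : a ≠ it d m y := cm.ne.2.2.2.2.2
  have n2 : b ≠ it d m y := by
    intro e
    have := S.lamM.iter S.memM m
    rw [hm, ← e] at this
    exact S.lamM.uncrossed this S.memM S.cross
  rw [not_sbtw_iff_swap S.cross.ne.1 n2 n1] at hcon
  -- quadrilaterals other than the first one lie in a gap of the first one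
  have gap0 : ∀ j, it d j x ≠ x → ∃ u v, u ≠ v ∧ u ∈ verts d a b x y 0 ∧ v ∈ verts d a b x y 0 ∧
      (∀ t ∈ verts d a b x y 0, Arc v u t) ∧ (∀ t ∈ verts d a b x y j, Arc u v t) := by
    intro j hj
    exact S.exists_gap (fun hc => hj (hNC hc).1) (fun hc => hj (hNC hc).1.symm)
  have gap1 : ∀ j, it d j x ≠ x → (∃ z ∈ verts d a b x y j, sbtw a z y ∨
      (sbtw a z b ∧ a ∈ verts d a b x y j)) → ∀ t ∈ verts d a b x y j, Arc a y t := by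
    rintro j hj ⟨z, hz, hz'⟩
    obtain ⟨u, v, g1, g2, g3, g4, g5⟩ := gap0 j hj
    obtain ⟨rfl, rfl⟩ := gap_unique S.cross ho g2 g3 g1
      ⟨g4 _ (by simp [verts]), g4 _ (by simp [verts]), g4 _ (by simp [verts]),
        g4 _ (by simp [verts])⟩ (g5 z hz) (hz'.imp_right fun h => ⟨h.1, g5 _ h.2⟩)
    exact g5
  have hxm : it d m x ≠ x := by rw [hm]; exact S.cross.ne.2.1
  have hVm := gap1 m hxm ⟨it d m y, by simp [verts], Or.inr ⟨hcon, by simp [verts, hm]⟩⟩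
  have om : sbtw a (it d m a) (it d m y) := by
    have := (S.it_sbtw m (mem_x c0) (mem_a 0) (mem_y c0)).2 ho
    simpa only [it_zero, hm] using this
  have ord := flower_order cm om (hVm _ (by simp [verts]))
  have hx : ∀ n, it d (n + m) x = it d n a := fun n => by rw [add_comm, ← it_it, hm]
  -- the images of `a` under `σ^m` never leave the arc from `a` to `y`
  have claim : ∀ k, sbtw a (it d ((k + 1) * m) a) y := by
    intro k
    induction k with
    | zero =>
      rw [zero_add, one_mul, sbtw_base_iff]
      · linarith [ord.1, ord.2.1, ord.2.2.1]
      · exact (sbtw_ne om).1.symm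
    | succ k ih =>
      set j := (k + 1 + 1) * m with hj
      have hxj : it d j x = it d ((k + 1) * m) a := by
        rw [hj, add_mul (k + 1), one_mul, hx]
      have hjx : it d j x ≠ x := by
        rw [hxj]
        intro e
        rw [e] at ih
        have h3 := S.cross.ne.2.2.2.2.2
        exact (not_sbtw_iff_swap (sbtw_ne ih).1 h3 (sbtw_ne ih).2.2).2
          (sbtw_rotate.1 ho) ih
      have hA := gap1 j hjx ⟨it d j x, by simp [verts], Or.inl (by rw [hxj]; exact ih)⟩
        (it d j a) (by simp [verts])
      rcases hA with hA | hA | hA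
      · exact absurd (S.fixed_of_fixed_a hN hP hA).2.2.1 hjx
      · -- the path of petals leaves the arc through `y`, so that all vertices are in one orbit
        exfalso
        have e1 : it d (j + m) x = y := by rw [hx, hA]
        have e2 : it d (j + m) a = it d m y := by rw [← it_it, hA]
        have hne : it d (j + m) x ≠ it d m x := by
          rw [e1, hm]; exact S.cross.ne.2.2.1.symm
        obtain ⟨u, v, g1, g2, g3, g4, g5⟩ := S.exists_gap (i := m) (j := j + m)
          (fun hc => hne (hNC hc).1) (fun hc => hne (hNC hc).1.symm)
        have g2' : u = it d m a ∨ u = it d m b ∨ u = a ∨ u = it d m y :=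
          g2.imp_right (Or.imp_right (Or.imp_left fun h => h.trans hm))
        have g3' : v = it d m a ∨ v = it d m b ∨ v = a ∨ v = it d m y :=
          g3.imp_right (Or.imp_right (Or.imp_left fun h => h.trans hm))
        have hy := flower_exit ord g2' g3' g1
          ⟨g4 _ (by simp [verts]), g4 _ (by simp [verts]), g4 _ (by simp [verts, hm]),
            g4 _ (by simp [verts])⟩ (g5 _ (by simp [verts, e1])) (g5 _ (by simp [verts, e2]))
        obtain ⟨s, hs⟩ := exists_it_of_fixed hN hP.2.2.1 hm.symm
        obtain ⟨l, hl⟩ := exists_it_of_fixed hN hP.2.1 hy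
        have hya : y = it d (s + (j + m)) a := by rw [← it_it, ← hs, e1]
        exact S.not_single_orbit (k := s + (j + m) + l) (by rw [← it_it, ← hya, ← hl]) hs hya
      · exact hA
  have hlast := claim (N - 1)
  rw [Nat.sub_add_cancel hN, mul_comm, it_mul_of_fixed hP.1] at hlast
  exact (sbtw_ne hlast).1 rfl

end Sys

/-! ### Sides of a chord -/

/-- The position of `t` relative to the oriented chord `pq` is preserved by `σ_d`. -/
def Good (d : ℕ) (p q t : S1) : Prop :=
  sbtw p q t ↔ sbtw (sigma d p) (sigma d q) (sigma d t)

theorem sides_of_uncrossed {u v p q : S1} (h : ¬ Cross u v p q) (hp : p ≠ u ∧ p ≠ v)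
    (hq : q ≠ u ∧ q ≠ v) : sbtw u v p ↔ sbtw u v q := by
  have h0 := pos_nonneg u v
  have h1 := pos_nonneg u p
  have h2 := pos_nonneg u q
  simp only [Cross, sbtw_iff u, Cyc, ne_eq, ← pos_inj (c := u), pos_self] at *
  generalize pos u v = v at *
  generalize pos u p = p at *
  generalize pos u q = q at *
  grind -ring (splits := 30)

theorem sides_of_cross {u v p q r s : S1} (h : Cross p q r s) (h1 : ¬ Cross u v p q)
    (h2 : ¬ Cross u v r s) (huv : u ≠ v) (hp : p ≠ u ∧ p ≠ v) (hr : r ≠ u ∧ r ≠ v) :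
    sbtw u v p ↔ sbtw u v r := by
  have e1 : sbtw u v p ↔ ¬ Arc u v p := by
    have h1 := pos_nonneg u v
    have h2 := pos_nonneg u p
    simp only [Arc, sbtw_iff u, Cyc, ne_eq, ← pos_inj (c := u), pos_self] at *
    clear * - hp h1 h2 huv
    grind -ring
  have e2 : sbtw u v r ↔ ¬ Arc u v r := by
    have h1 := pos_nonneg u v
    have h2 := pos_nonneg u r
    simp only [Arc, sbtw_iff u, Cyc, ne_eq, ← pos_inj (c := u), pos_self] at *
    clear * - hr h1 h2 huv
    grind -ring
  have e3 : ∀ t, t ≠ u → t ≠ v → Arc v u t → ¬ Arc u v t := by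
    intro t h3 h4
    have h1 := pos_nonneg u v
    have h2 := pos_nonneg u t
    simp only [Arc, sbtw_iff u, Cyc, ne_eq, ← pos_inj (c := u), pos_self] at *
    clear * - h1 h2 h3 h4 huv
    grind -ring
  rw [e1, e2]
  rcases arc_of_uncrossed huv h1 with ⟨g1, g2⟩ | ⟨g1, g2⟩
  · have := (arc_of_cross huv h h2 g1 g2).1
    tauto
  · have := (arc_of_cross huv.symm h (mt cross_flip_left.1 h2) g1 g2).1
    have := e3 _ hp.1 hp.2 g1
    have := e3 r hr.1 hr.2 (by assumption)
    tauto

theorem sbtw_flip {p q r : S1} (h1 : p ≠ q) (h2 : q ≠ r) (h3 : p ≠ r) :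
    sbtw q p r ↔ ¬ sbtw p q r :=
  (sbtw_rotate.symm.trans (not_sbtw_iff h1 h2 h3).symm)

theorem Good.symm {d : ℕ} {p q t : S1} (h : Good d p q t) (h1 : sigma d p ≠ sigma d q)
    (h2 : sigma d q ≠ sigma d t) (h3 : sigma d p ≠ sigma d t) : Good d q p t := by
  unfold Good at *
  rw [sbtw_flip h1 h2 h3, sbtw_flip (fun e => h1 (by rw [e])) (fun e => h2 (by rw [e]))
    (fun e => h3 (by rw [e])), h]

theorem good_left (d : ℕ) (p q : S1) : Good d p q p :=
  iff_of_false (fun h => (sbtw_ne h).2.2 rfl) fun h => (sbtw_ne h).2.2 rfl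

theorem good_right (d : ℕ) (p q : S1) : Good d p q q :=
  iff_of_false (fun h => (sbtw_ne h).2.1 rfl) fun h => (sbtw_ne h).2.1 rfl

/-- `pq` is, up to orientation, one of the images of `ab`. -/
def IsImage (d : ℕ) (a b p q : S1) : Prop :=
  ∃ k, (p = it d k a ∧ q = it d k b) ∨ (p = it d k b ∧ q = it d k a)

theorem IsImage.symm {d : ℕ} {a b p q : S1} (h : IsImage d a b p q) : IsImage d a b q p :=
  h.imp fun _ h => h.symm.imp And.symm And.symm

theorem IsImage.sigma {d : ℕ} {a b p q : S1} (h : IsImage d a b p q) :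
    IsImage d a b (sigma d p) (sigma d q) := by
  obtain ⟨k, ⟨rfl, rfl⟩ | ⟨rfl, rfl⟩⟩ := h
  · exact ⟨k + 1, Or.inl ⟨sigma_it _ _ _, sigma_it _ _ _⟩⟩
  · exact ⟨k + 1, Or.inr ⟨sigma_it _ _ _, sigma_it _ _ _⟩⟩

theorem IsImage.fixed {d N : ℕ} {a b p q : S1} (h : IsImage d a b p q) (ha : it d N a = a)
    (hb : it d N b = b) : it d N p = p := by
  obtain ⟨k, ⟨rfl, rfl⟩ | ⟨rfl, rfl⟩⟩ := h
  · exact it_fixed ha k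
  · exact it_fixed hb k

theorem IsImage.mem {d : ℕ} {L : S1 → S1 → Prop} {a b p q : S1} (h : IsImage d a b p q)
    (hL : Lam d L) (hab : L a b) : L p q := by
  obtain ⟨k, ⟨rfl, rfl⟩ | ⟨rfl, rfl⟩⟩ := h
  · exact hL.iter hab k
  · exact hL.iter (hL.symm hab) k

theorem sigma_inj_of_fixed {d N : ℕ} (hN : 0 < N) {s t : S1} (hs : it d N s = s)
    (ht : it d N t = t) (h : sigma d s = sigma d t) : s = t :=
  it_inj_of_fixed (k := 1) hN hs ht h

/-- Leaves with a common periodic endpoint keep their sides. -/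
theorem Lam.good {d N : ℕ} {L : S1 → S1 → Prop} (hL : Lam d L) (hN : 0 < N) {p q r : S1}
    (h1 : L p q) (h2 : L p r) (hp : it d N p = p) (hq : it d N q = q) (hr : it d N r = r) :
    Good d p q r := by
  by_cases e1 : p = q
  · subst e1; exact iff_of_false (fun h => (sbtw_ne h).1 rfl) fun h => (sbtw_ne h).1 rfl
  by_cases e2 : q = r
  · subst e2; exact good_right _ _ _
  by_cases e3 : p = r
  · subst e3; exact good_left _ _ _
  have f1 := mt (sigma_inj_of_fixed hN hp hq) e1
  have f2 := mt (sigma_inj_of_fixed hN hq hr) e2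
  have f3 := mt (sigma_inj_of_fixed hN hp hr) e3
  refine ⟨hL.vertex h1 h2 f1 f3 f2, fun h => ?_⟩
  by_contra hn
  rw [not_sbtw_iff_swap e1 e2 e3] at hn
  exact (not_sbtw_iff_swap f1 f2 f3).2 (hL.vertex h2 h1 f3 f1 (Ne.symm f2) hn) h

/-- The quadrilaterals at times `i` and `j` cross or share a vertex. -/
def Meet (d : ℕ) (a b x y : S1) (i j : ℕ) : Prop :=
  Cross (it d i a) (it d i b) (it d j x) (it d j y) ∨
    Cross (it d j a) (it d j b) (it d i x) (it d i y) ∨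
      (verts d a b x y i ∩ verts d a b x y j).Nonempty

namespace Sys

variable {d N : ℕ} {L M : S1 → S1 → Prop} {a b x y : S1}

/-- An image of `xy` that touches `ab` in an endpoint keeps its side, by the flower lemma or its
mirror image. -/
theorem good_image_of_flower (S : Sys d L M a b x y) (hN : 0 < N) (hP : Fixed d N a b x y)
    {k : ℕ} (h : it d k x = a) : Good d a b (it d k y) := by
  have key : ∀ {a b x y : S1} {L M : S1 → S1 → Prop}, Sys d L M a b x y → Fixed d N a b x y →
      it d k x = a → sbtw x a y → Good d a b (it d k y) := by
    intro a b x y L M S hP h ho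
    have c0 : Cross (it d 0 a) (it d 0 b) (it d 0 x) (it d 0 y) := S.cross
    have ho' := (S.it_sbtw 1 (mem_x c0) (mem_a 0) (mem_y c0)).2 ho
    refine iff_of_true (S.flower hN hP h ho) ?_
    have := (S.shift 1).flower hN (hP.iter 1) (m := k) (by rw [it_it, add_comm, ← it_it, h]) ho'
    rwa [it_it, add_comm, ← it_it] at this
  rcases S.cross.symm with ⟨h1, -⟩ | ⟨-, h2⟩
  · exact key S hP h h1
  · have hP' : Fixed d N (-a) (-b) (-x) (-y) := by
      simpa only [Fixed, it_neg, neg_inj] using hP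
    have g := key S.neg hP' (by rw [it_neg, h]) (sbtw_neg.2 h2)
    simp only [Good, sigma_neg, it_neg, sbtw_neg] at g
    rw [sbtw_rotate, sbtw_rotate (p := sigma d _)] at g
    have hy := it_fixed hP.2.2.2 k
    by_cases e : b = it d k y
    · rw [← e]; exact good_right _ _ _
    · exact Good.symm g (mt (sigma_inj_of_fixed hN hP.2.1 hP.1) S.cross.ne.1.symm)
        (mt (sigma_inj_of_fixed hN hP.1 hy) (by rw [← h]; exact S.swap.ne_it k))
        (mt (sigma_inj_of_fixed hN hP.2.1 hy) e)

/-- A chord with an endpoint on `ab` keeps its side. -/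
theorem good_of_touch (S : Sys d L M a b x y) (hN : 0 < N) (hP : Fixed d N a b x y) {r s : S1}
    (h : IsImage d a b r s ∨ IsImage d x y r s) (hr : r = a ∨ r = b) : Good d a b s := by
  have key : ∀ {a b x y : S1} {L M : S1 → S1 → Prop}, Sys d L M a b x y → Fixed d N a b x y →
      IsImage d a b r s ∨ IsImage d x y r s → r = a → Good d a b s := by
    rintro a b x y L M S hP (h | ⟨k, ⟨h1, rfl⟩ | ⟨h1, rfl⟩⟩) rfl
    · exact S.lamL.good hN S.memL (h.mem S.lamL S.memL) hP.1 hP.2.1 (h.symm.fixed hP.1 hP.2.1)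
    · exact S.good_image_of_flower hN hP h1.symm
    · exact S.flipX.good_image_of_flower hN ⟨hP.1, hP.2.1, hP.2.2.2, hP.2.2.1⟩ h1.symm
  rcases hr with hr | hr
  · exact key S hP h hr
  · have hs : it d N s = s := h.elim (fun h => h.symm.fixed hP.1 hP.2.1)
      fun h => h.symm.fixed hP.2.2.1 hP.2.2.2
    have g := key S.flipA ⟨hP.2.1, hP.1, hP.2.2⟩
      (h.imp_left fun ⟨k, h⟩ => ⟨k, h.symm⟩) hr
    by_cases e1 : b = s
    · subst e1; exact good_right _ _ _
    by_cases e2 : a = s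
    · subst e2; exact good_left _ _ _
    · exact g.symm (mt (sigma_inj_of_fixed hN hP.2.1 hP.1) S.cross.ne.1.symm)
        (mt (sigma_inj_of_fixed hN hP.1 hs) e2) (mt (sigma_inj_of_fixed hN hP.2.1 hs) e1)

theorem good_of_mem (S : Sys d L M a b x y) {s : S1} (h : s ∈ accEnds d a b x y 0) :
    Good d a b s :=
  ((S.opA 0).iff (mem_a 0) (mem_b 0) h).symm

/-- The images of `ab` and `xy` that do not cross `ab` keep not crossing it. -/
theorem not_cross_sigma (S : Sys d L M a b x y) (hN : 0 < N) (hP : Fixed d N a b x y) {r s : S1}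
    (h : IsImage d a b r s ∨ IsImage d x y r s) (hc : ¬ Cross a b r s) :
    ¬ Cross (sigma d a) (sigma d b) (sigma d r) (sigma d s) := by
  have key : ∀ k, Cross (sigma d a) (sigma d b) (it d (k + 1) x) (it d (k + 1) y) →
      Cross a b (it d k x) (it d k y) := by
    intro k h
    have := S.cross_add (i := 1) (j := k + 1) (N - 1) h
    rwa [Nat.add_sub_cancel' hN, add_assoc, Nat.add_sub_cancel' hN, hP.1, hP.2.1,
      add_comm k, ← it_it, ← it_it, hP.2.2.1, hP.2.2.2] at this
  rcases h with h | ⟨k, ⟨rfl, rfl⟩ | ⟨rfl, rfl⟩⟩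
  · exact S.lamL.uncrossed (S.lamL.fwd S.memL) (h.sigma.mem S.lamL S.memL)
  · rw [sigma_it, sigma_it]
    exact mt (key k) hc
  · rw [sigma_it, sigma_it]
    exact fun h => hc (key k h.flip_right).flip_right

theorem good_of_cross (S : Sys d L M a b x y) {r s : S1}
    (h : IsImage d a b r s ∨ IsImage d x y r s) (hc : Cross a b r s) :
    IsImage d x y r s ∧ Good d a b r ∧ Good d a b s := by
  rcases h with h | h
  · exact absurd hc (S.lamL.uncrossed S.memL (h.mem S.lamL S.memL))
  · refine ⟨h, ?_⟩
    obtain ⟨k, ⟨rfl, rfl⟩ | ⟨rfl, rfl⟩⟩ := h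
    · exact ⟨S.good_of_mem (mem_x (i := 0) hc), S.good_of_mem (mem_y (i := 0) hc)⟩
    · exact ⟨S.good_of_mem (mem_y (i := 0) hc.flip_right),
        S.good_of_mem (mem_x (i := 0) hc.flip_right)⟩

/-- If one endpoint of an image of `ab` or `xy` keeps its side of `ab`, so does the other one. -/
theorem good_of_good (S : Sys d L M a b x y) (hN : 0 < N) (hP : Fixed d N a b x y) {r s : S1}
    (h : IsImage d a b r s ∨ IsImage d x y r s) (hr : Good d a b r) : Good d a b s := by
  by_cases hrab : r = a ∨ r = b
  · exact S.good_of_touch hN hP h hrab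
  by_cases hsab : s = a ∨ s = b
  · rcases hsab with rfl | rfl
    · exact good_left _ _ _
    · exact good_right _ _ _
  by_cases hc : Cross a b r s
  · exact (S.good_of_cross h hc).2.2
  push Not at hrab hsab
  have fr : it d N r = r := h.elim (fun h => h.fixed hP.1 hP.2.1)
      fun h => h.fixed hP.2.2.1 hP.2.2.2
  have fs : it d N s = s := h.elim (fun h => h.symm.fixed hP.1 hP.2.1)
      fun h => h.symm.fixed hP.2.2.1 hP.2.2.2
  have e1 := sides_of_uncrossed hc hrab hsab
  have e2 := sides_of_uncrossed (S.not_cross_sigma hN hP h hc)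
    ⟨mt (sigma_inj_of_fixed hN fr hP.1) hrab.1, mt (sigma_inj_of_fixed hN fr hP.2.1) hrab.2⟩
    ⟨mt (sigma_inj_of_fixed hN fs hP.1) hsab.1, mt (sigma_inj_of_fixed hN fs hP.2.1) hsab.2⟩
  unfold Good at *
  rw [← e1, hr, e2]

theorem cross_sigma (S : Sys d L M a b x y) {p q r s : S1} (h1 : IsImage d a b p q)
    (h2 : IsImage d x y r s) (h : Cross p q r s) :
    Cross (sigma d p) (sigma d q) (sigma d r) (sigma d s) := by
  obtain ⟨k, ⟨rfl, rfl⟩ | ⟨rfl, rfl⟩⟩ := h1 <;> obtain ⟨l, ⟨rfl, rfl⟩ | ⟨rfl, rfl⟩⟩ := h2 <;>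
    simp only [sigma_it]
  · exact S.cross_succ h
  · exact S.flipX.cross_succ h
  · exact S.flipA.cross_succ h
  · exact S.flipA.flipX.cross_succ h

/-- Chords that both cross an image of `xy` keep their relative position. -/
theorem good_of_common_cross (S : Sys d L M a b x y) {p q r s : S1} (h1 : IsImage d x y p q)
    (h2 : IsImage d a b r s) (hc : Cross p q a b) (hc' : Cross p q r s) : Good d a b r := by
  have key : ∀ {x y : S1}, Sys d L M a b x y → ∀ l, p = it d l x → q = it d l y →
      Good d a b r := by
    rintro x y S l rfl rfl
    have hr : r ∈ accEnds d x y a b l := by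
      obtain ⟨k, ⟨rfl, rfl⟩ | ⟨rfl, rfl⟩⟩ := h2
      · exact mem_x hc'
      · exact mem_y hc'.flip_right
    exact ((S.opX l).iff (mem_x (j := 0) hc) (mem_y (j := 0) hc) hr).symm
  obtain ⟨l, ⟨hp, hq⟩ | ⟨hp, hq⟩⟩ := h1
  · exact key S l hp hq
  · exact key S.flipX l hp hq

/-- If one of two crossing chords keeps its side of `ab`, so does the other one. -/
theorem good_of_good_of_cross (S : Sys d L M a b x y) (hN : 0 < N) (hP : Fixed d N a b x y)
    {p q r s : S1} (hpq : IsImage d a b p q ∨ IsImage d x y p q)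
    (hrs : IsImage d a b r s ∨ IsImage d x y r s) (hc : Cross p q r s) (hp : Good d a b p) :
    Good d a b r := by
  have hc' : Cross (sigma d p) (sigma d q) (sigma d r) (sigma d s) := by
    rcases hpq with h1 | h1 <;> rcases hrs with h2 | h2
    · exact absurd hc (S.lamL.uncrossed (h1.mem S.lamL S.memL) (h2.mem S.lamL S.memL))
    · exact S.cross_sigma h1 h2 hc
    · exact (S.cross_sigma h2 h1 hc.symm).symm
    · exact absurd hc (S.lamM.uncrossed (h1.mem S.lamM S.memM) (h2.mem S.lamM S.memM))
  by_cases hrab : r = a ∨ r = b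
  · rcases hrab with rfl | rfl
    · exact good_left _ _ _
    · exact good_right _ _ _
  by_cases c2 : Cross a b r s
  · exact (S.good_of_cross hrs c2).2.1
  by_cases c1 : Cross a b p q
  · obtain ⟨h1, -⟩ := S.good_of_cross hpq c1
    rcases hrs with h2 | h2
    · exact S.good_of_common_cross h1 h2 c1.symm hc
    · exact absurd hc (S.lamM.uncrossed (h1.mem S.lamM S.memM) (h2.mem S.lamM S.memM))
  wlog hpab : p ≠ a ∧ p ≠ b generalizing p q
  · refine this (hpq.imp IsImage.symm IsImage.symm) hc.flip_left (S.good_of_good hN hP hpq hp)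
      hc'.flip_left (fun h => c1 h.flip_right) ?_
    by_contra hq
    have hpq' := hc.ne.1
    have : (p = a ∧ q = b) ∨ (p = b ∧ q = a) := by grind
    rcases this with ⟨rfl, rfl⟩ | ⟨rfl, rfl⟩
    · exact c2 hc
    · exact c2 hc.flip_left
  push Not at hrab
  have fix : ∀ {r s : S1}, IsImage d a b r s ∨ IsImage d x y r s → it d N r = r := fun h =>
    h.elim (fun h => h.fixed hP.1 hP.2.1) fun h => h.fixed hP.2.2.1 hP.2.2.2
  have e1 := sides_of_cross hc c1 c2 S.cross.ne.1 hpab hrab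
  have e2 := sides_of_cross hc' (S.not_cross_sigma hN hP hpq c1) (S.not_cross_sigma hN hP hrs c2)
    (mt (sigma_inj_of_fixed hN hP.1 hP.2.1) S.cross.ne.1)
    ⟨mt (sigma_inj_of_fixed hN (fix hpq) hP.1) hpab.1,
      mt (sigma_inj_of_fixed hN (fix hpq) hP.2.1) hpab.2⟩
    ⟨mt (sigma_inj_of_fixed hN (fix hrs) hP.1) hrab.1,
      mt (sigma_inj_of_fixed hN (fix hrs) hP.2.1) hrab.2⟩
  unfold Good at *
  rw [← e1, hp, e2]

theorem good_of_good_verts (S : Sys d L M a b x y) (hN : 0 < N) (hP : Fixed d N a b x y) {j : ℕ}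
    {t : S1} (ht : t ∈ verts d a b x y j) (h : Good d a b t) :
    ∀ s ∈ verts d a b x y j, Good d a b s := by
  have iA : IsImage d a b (it d j a) (it d j b) := ⟨j, Or.inl ⟨rfl, rfl⟩⟩
  have iX : IsImage d x y (it d j x) (it d j y) := ⟨j, Or.inl ⟨rfl, rfl⟩⟩
  have c := S.cross_diag j
  have a1 := S.good_of_good hN hP (Or.inl iA)
  have a2 := S.good_of_good hN hP (Or.inl iA.symm)
  have x1 := S.good_of_good hN hP (Or.inr iX)
  have x2 := S.good_of_good hN hP (Or.inr iX.symm)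
  have h1 := S.good_of_good_of_cross hN hP (Or.inl iA) (Or.inr iX) c
  have h2 := S.good_of_good_of_cross hN hP (Or.inr iX) (Or.inl iA) c.symm
  have : Good d a b (it d j a) := by
    rcases ht with rfl | rfl | rfl | rfl
    · exact h
    · exact a2 h
    · exact h2 h
    · exact h2 (x2 h)
  rintro s (rfl | rfl | rfl | rfl)
  · exact this
  · exact a1 this
  · exact h1 this
  · exact x1 (h1 this)

theorem good_of_meet (S : Sys d L M a b x y) (hN : 0 < N) (hP : Fixed d N a b x y) {i j : ℕ}
    (hij : Meet d a b x y i j) (h : ∀ t ∈ verts d a b x y i, Good d a b t) :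
    ∀ t ∈ verts d a b x y j, Good d a b t := by
  have iA : ∀ j, IsImage d a b (it d j a) (it d j b) := fun j => ⟨j, Or.inl ⟨rfl, rfl⟩⟩
  have iX : ∀ j, IsImage d x y (it d j x) (it d j y) := fun j => ⟨j, Or.inl ⟨rfl, rfl⟩⟩
  rcases hij with hc | hc | ⟨t, h1, h2⟩
  · exact S.good_of_good_verts hN hP (t := it d j x) (by simp [verts])
      (S.good_of_good_of_cross hN hP (Or.inl (iA i)) (Or.inr (iX j)) hc (h _ (by simp [verts])))
  · exact S.good_of_good_verts hN hP (t := it d j a) (by simp [verts])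
      (S.good_of_good_of_cross hN hP (Or.inr (iX i)) (Or.inl (iA j)) hc.symm
        (h _ (by simp [verts])))
  · exact S.good_of_good_verts hN hP h2 (h t h1)

theorem good_of_reflTransGen (S : Sys d L M a b x y) (hN : 0 < N) (hP : Fixed d N a b x y)
    {i j : ℕ} (h : Relation.ReflTransGen (Meet d a b x y) i j)
    (hi : ∀ t ∈ verts d a b x y i, Good d a b t) : ∀ t ∈ verts d a b x y j, Good d a b t := by
  induction h with
  | refl => exact hi
  | tail _ hm ih => exact S.good_of_meet hN hP hm ih

theorem _root_.CircleLam.verts_add {m : ℕ} (hP : Fixed d m a b x y) (i : ℕ) :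
    verts d a b x y (i + m) = verts d a b x y i := by
  simp only [verts, it_add_of_fixed hP.1, it_add_of_fixed hP.2.1, it_add_of_fixed hP.2.2.1,
    it_add_of_fixed hP.2.2.2]

theorem _root_.CircleLam.meet_add {m : ℕ} (hP : Fixed d m a b x y) {i j : ℕ} :
    Meet d a b x y (i + m) (j + m) ↔ Meet d a b x y i j := by
  simp only [Meet, verts_add hP, it_add_of_fixed hP.1, it_add_of_fixed hP.2.1,
    it_add_of_fixed hP.2.2.1, it_add_of_fixed hP.2.2.2]

/-- All quadrilaterals that can be reached from the one at time `i` keep their sides of its first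
diagonal. -/
theorem good_of_reach (S : Sys d L M a b x y) (hN : 0 < N) (hP : Fixed d N a b x y) {i j : ℕ}
    (h : Relation.ReflTransGen (Meet d a b x y) i j) :
    ∀ t ∈ verts d a b x y j, Good d (it d i a) (it d i b) t := by
  -- measure time from `i`, modulo the period
  have hle : i ≤ i * N := Nat.le_mul_of_pos_right i hN
  have hP' : Fixed d (i * N) a b x y := ⟨it_mul_of_fixed hP.1 i, it_mul_of_fixed hP.2.1 i,
    it_mul_of_fixed hP.2.2.1 i, it_mul_of_fixed hP.2.2.2 i⟩
  have hv : ∀ k, verts d (it d i a) (it d i b) (it d i x) (it d i y) (k + i * N - i) =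
      verts d a b x y k := fun k => by
    rw [← verts_add hP' k]
    simp only [verts, it_it, show i + (k + i * N - i) = k + i * N by omega]
  have h' := h.lift (p := Meet d (it d i a) (it d i b) (it d i x) (it d i y))
    (fun k => k + i * N - i) fun k l hkl => by
      rw [← meet_add hP'] at hkl
      simp only [Meet, verts, it_it, show ∀ k, i + (k + i * N - i) = k + i * N by omega] at hkl ⊢
      exact hkl
  have := (S.shift i).good_of_reflTransGen hN (hP.iter i) h'
    ((S.shift i).good_of_good_verts hN (hP.iter i) (t := it d i a) (by
      rw [hv]; simp [verts]) (good_left _ _ _))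
  rwa [hv] at this

end Sys

/-! ### Order preservation from preserved sides -/

/-- If points keep their sides of `pq` and of `qr`, they keep their sides of `pr`. -/
theorem good_trans {d : ℕ} {Q : Set S1} (hinj : Set.InjOn (sigma d) Q) {p q r : S1} (hp : p ∈ Q)
    (hq : q ∈ Q) (hr : r ∈ Q) (h1 : ∀ s ∈ Q, Good d p q s) (h2 : ∀ s ∈ Q, Good d q r s) :
    ∀ s ∈ Q, Good d p r s := by
  intro s hs
  have e1 := hinj.eq_iff hp hq
  have e2 := hinj.eq_iff hp hr
  have e3 := hinj.eq_iff hp hs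
  have e4 := hinj.eq_iff hq hr
  have e5 := hinj.eq_iff hq hs
  have e6 := hinj.eq_iff hr hs
  have g1 := h1 r hr
  have g2 := h1 s hs
  have g3 := h2 p hp
  have g4 := h2 s hs
  clear h1 h2 hinj
  have k0 := pos_nonneg p q
  have k1 := pos_nonneg p r
  have k2 := pos_nonneg p s
  simp only [Good, sbtw_iff p, Cyc, pos_self, ← pos_inj (c := p)] at *
  generalize pos p q = q at *
  generalize pos p r = r at *
  generalize pos p s = s at *
  generalize pos p (sigma d p) = p' at *
  generalize pos p (sigma d q) = q' at *
  generalize pos p (sigma d r) = r' at *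
  generalize pos p (sigma d s) = s' at *
  grind -ring (splits := 30)

theorem sbtw_iff_of_cross {a b x y s : S1} (hc : Cross a b x y) : sbtw a x s ↔
    (sbtw a b x ∧ s ≠ x ∧ sbtw a b s ∧ ¬ sbtw x y s) ∨
      (¬ sbtw a b x ∧ s ≠ a ∧ s ≠ x ∧ (sbtw a b s ∨ ¬ sbtw x y s)) := by
  have k0 := pos_nonneg a b
  have k1 := pos_nonneg a x
  have k2 := pos_nonneg a s
  have k3 := pos_nonneg a y
  simp only [Cross, sbtw_iff a, Cyc, pos_self, ne_eq, ← pos_inj (c := a)] at *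
  have : (0 < pos a x ∧ pos a x < pos a b ∧ pos a b < pos a y) ∨
    (0 < pos a y ∧ pos a y < pos a b ∧ pos a b < pos a x) := by grind -ring
  clear hc
  generalize pos a b = b at *
  generalize pos a x = x at *
  generalize pos a s = s at *
  generalize pos a y = y at *
  grind -ring (splits := 30)

theorem good_of_cross {d : ℕ} {Q : Set S1} (hinj : Set.InjOn (sigma d) Q) {a b x y : S1}
    (hc : Cross a b x y) (hc' : Cross (sigma d a) (sigma d b) (sigma d x) (sigma d y))
    (ha : a ∈ Q) (hx : x ∈ Q) (h1 : ∀ s ∈ Q, Good d a b s) (h2 : ∀ s ∈ Q, Good d x y s) :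
    ∀ s ∈ Q, Good d a x s := by
  intro s hs
  have g1 := h1 x hx
  have g2 := h1 s hs
  have g3 := h2 s hs
  unfold Good at *
  rw [sbtw_iff_of_cross hc, sbtw_iff_of_cross hc', g1, g2, g3, ne_eq, ne_eq, ne_eq, ne_eq,
    hinj.eq_iff hs ha, hinj.eq_iff hs hx]

namespace Sys

variable {d N : ℕ} {L M : S1 → S1 → Prop} {a b x y : S1}

theorem _root_.CircleLam.Meet.swap {i j : ℕ} (h : Meet d a b x y i j) : Meet d x y a b i j := by
  have e : ∀ i, verts d x y a b i = verts d a b x y i := fun i => by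
    ext t; simp only [verts, Set.mem_ofPred_eq]; tauto
  rcases h with h | h | h
  · exact Or.inr (Or.inl h.symm)
  · exact Or.inl h.symm
  · exact Or.inr (Or.inr (by rwa [e, e]))

theorem _root_.CircleLam.Meet.symm {i j : ℕ} (h : Meet d a b x y i j) : Meet d a b x y j i := by
  rcases h with h | h | h
  · exact Or.inr (Or.inl h)
  · exact Or.inl h
  · exact Or.inr (Or.inr (by rwa [Set.inter_comm]))

theorem _root_.CircleLam.reach_symm {i j : ℕ}
    (h : Relation.ReflTransGen (Meet d a b x y) i j) :
    Relation.ReflTransGen (Meet d a b x y) j i := by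
  induction h with
  | refl => exact .refl
  | tail _ hm ih => exact .head hm.symm ih

/-- `σ_d` preserves the order of the vertices of a connected family of quadrilaterals. -/
theorem orderPreservingOn_of_reach (S : Sys d L M a b x y) (hN : 0 < N) (hP : Fixed d N a b x y)
    (i : ℕ) : OrderPreservingOn d
      (⋃ j ∈ {j | Relation.ReflTransGen (Meet d a b x y) i j}, verts d a b x y j) := by
  set J := {j | Relation.ReflTransGen (Meet d a b x y) i j}
  set Q := ⋃ j ∈ J, verts d a b x y j with hQ
  have mem : ∀ {j t}, j ∈ J → t ∈ verts d a b x y j → t ∈ Q := fun hj ht =>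
    Set.mem_biUnion hj ht
  have fix : ∀ {t}, t ∈ Q → it d N t = t := by
    intro t ht
    obtain ⟨j, -, h⟩ := Set.mem_iUnion₂.1 ht
    have := hP.iter j
    rcases h with rfl | rfl | rfl | rfl
    exacts [this.1, this.2.1, this.2.2.1, this.2.2.2]
  have hinj : Set.InjOn (sigma d) Q := fun s hs t ht => sigma_inj_of_fixed hN (fix hs) (fix ht)
  have reach : ∀ {j k}, j ∈ J → k ∈ J → Relation.ReflTransGen (Meet d a b x y) j k :=
    fun hj hk => (reach_symm hj).trans hk
  have gA : ∀ {j}, j ∈ J → ∀ t ∈ Q, Good d (it d j a) (it d j b) t := by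
    intro j hj t ht
    obtain ⟨k, hk, h⟩ := Set.mem_iUnion₂.1 ht
    exact S.good_of_reach hN hP (reach hj hk) t h
  have gX : ∀ {j}, j ∈ J → ∀ t ∈ Q, Good d (it d j x) (it d j y) t := by
    intro j hj t ht
    obtain ⟨k, hk, h⟩ := Set.mem_iUnion₂.1 ht
    refine S.swap.good_of_reach hN ⟨hP.2.2.1, hP.2.2.2, hP.1, hP.2.1⟩
      ((reach hj hk).lift id fun _ _ h => h.swap) t ?_
    simp only [verts, Set.mem_ofPred_eq] at h ⊢
    tauto
  -- all pairs of points of `Q` are related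
  let R : S1 → S1 → Prop := fun p q => ∀ t ∈ Q, Good d p q t
  have Rrefl : ∀ p, R p p := fun p t _ =>
    iff_of_false (fun h => (sbtw_ne h).1 rfl) fun h => (sbtw_ne h).1 rfl
  have Rsymm : ∀ {p q}, p ∈ Q → q ∈ Q → R p q → R q p := by
    intro p q hp hq h t ht
    by_cases e1 : p = q
    · subst e1; exact Rrefl p t ht
    by_cases e2 : q = t
    · subst e2; exact good_left _ _ _
    by_cases e3 : p = t
    · subst e3; exact good_right _ _ _
    exact (h t ht).symm (mt (hinj.eq_iff hp hq).1 e1) (mt (hinj.eq_iff hq ht).1 e2)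
      (mt (hinj.eq_iff hp ht).1 e3)
  have Rtrans : ∀ {p q r}, p ∈ Q → q ∈ Q → r ∈ Q → R p q → R q r → R p r :=
    fun hp hq hr h1 h2 => good_trans hinj hp hq hr h1 h2
  have Rx : ∀ {j}, j ∈ J → R (it d j a) (it d j x) := fun {j} hj =>
    CircleLam.good_of_cross hinj (S.cross_diag j)
      (by simpa only [sigma_it] using S.cross_diag (j + 1)) (mem hj (by simp [verts]))
      (mem hj (by simp [verts])) (gA hj) (gX hj)
  have Rv : ∀ {j t}, j ∈ J → t ∈ verts d a b x y j → R (it d j a) t := by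
    rintro j t hj (rfl | rfl | rfl | rfl)
    · exact Rrefl _
    · exact gA hj
    · exact Rx hj
    · exact Rtrans (mem hj (by simp [verts])) (mem hj (by simp [verts]))
        (mem hj (by simp [verts])) (Rx hj) (gX hj)
  have memA : ∀ {j}, j ∈ J → it d j a ∈ Q := fun hj => mem hj (by simp [verts])
  have Ra : ∀ {j}, j ∈ J → R (it d i a) (it d j a) := by
    intro j hj
    have hi : i ∈ J := Relation.ReflTransGen.refl
    change Relation.ReflTransGen _ _ _ at hj
    induction hj with
    | refl => exact Rrefl _
    | @tail j k hj hm ih =>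
      have hk : k ∈ J := Relation.ReflTransGen.tail hj hm
      have hj : j ∈ J := hj
      refine Rtrans (memA hi) (memA hj) (memA hk) ih ?_
      rcases hm with hc | hc | ⟨t, h1, h2⟩
      · have hx : it d k x ∈ Q := mem hk (by simp [verts])
        exact Rtrans (memA hj) hx (memA hk) (CircleLam.good_of_cross hinj hc
          (by simpa only [sigma_it] using S.cross_succ hc) (memA hj) hx (gA hj) (gX hk))
          (Rsymm (memA hk) hx (Rx hk))
      · have hx : it d j x ∈ Q := mem hj (by simp [verts])
        exact Rtrans (memA hj) hx (memA hk) (Rx hj) (Rsymm (memA hk) hx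
          (CircleLam.good_of_cross hinj hc
          (by simpa only [sigma_it] using S.cross_succ hc) (memA hk) hx (gA hk) (gX hj)))
      · exact Rtrans (memA hj) (mem hj h1) (memA hk) (Rv hj h1)
          (Rsymm (memA hk) (mem hk h2) (Rv hk h2))
  have Rall : ∀ {t}, t ∈ Q → R (it d i a) t := by
    intro t ht
    obtain ⟨k, hk, h⟩ := Set.mem_iUnion₂.1 ht
    exact Rtrans (memA .refl) (memA hk) ht (Ra hk) (Rv hk h)
  exact ⟨hinj, fun p hp q hq r hr h =>
    (Rtrans hp (memA .refl) hq (Rsymm (memA .refl) hp (Rall hp)) (Rall hq) r hr).1 h⟩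

end Sys

/-! ### Orientation in the plane -/

/-- Twice the oriented area of the triangle `PQz`. -/
def det (P Q z : ℂ) : ℝ := (Q.re - P.re) * (z.im - P.im) - (Q.im - P.im) * (z.re - P.re)

theorem toPlane_add (s : S1) (u : ℝ) : toPlane (s + (u : S1)) =
    toPlane s * (Real.cos (2 * Real.pi * u) + Real.sin (2 * Real.pi * u) * Complex.I) := by
  unfold toPlane
  rw [AddCircle.toCircle_add, Circle.coe_mul, AddCircle.toCircle_apply_mk, Circle.coe_exp]
  congr 1
  rw [div_one, Complex.exp_mul_I, Complex.ofReal_cos, Complex.ofReal_sin]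

theorem normSq_toPlane (s : S1) : (toPlane s).re ^ 2 + (toPlane s).im ^ 2 = 1 := by
  have := Circle.normSq_coe (AddCircle.toCircle s)
  rw [Complex.normSq_apply] at this
  simp only [toPlane]; linarith

theorem eq_add_pos (p q : S1) : q = p + ((pos p q : ℝ) : S1) := by
  rw [coe_pos]; abel

/-- The oriented area in terms of the coordinates based at the first vertex. -/
theorem det_toPlane (p q r : S1) : det (toPlane p) (toPlane q) (toPlane r) =
    4 * Real.sin (Real.pi * pos p q) * Real.sin (Real.pi * pos p r) *
      Real.sin (Real.pi * (pos p r - pos p q)) := by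
  conv_lhs => rw [eq_add_pos p q, eq_add_pos p r, toPlane_add, toPlane_add]
  have h := normSq_toPlane p
  generalize toPlane p = P at *
  generalize pos p q = u
  generalize pos p r = v
  rw [mul_assoc 2 Real.pi u, mul_assoc 2 Real.pi v, mul_sub]
  generalize Real.pi * u = α
  generalize Real.pi * v = β
  simp only [det, Complex.mul_re, Complex.mul_im, Complex.add_re, Complex.add_im, Complex.ofReal_re,
    Complex.ofReal_im, Complex.I_re, Complex.I_im, Real.cos_two_mul, Real.sin_two_mul,
    Real.sin_sub]
  have h1 := Real.sin_sq_add_cos_sq α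
  have h2 := Real.sin_sq_add_cos_sq β
  generalize Real.sin α = s at *
  generalize Real.cos α = c at *
  generalize Real.sin β = t at *
  generalize Real.cos β = e at *
  have h1 : c ^ 2 = 1 - s ^ 2 := by linarith
  have h2 : e ^ 2 = 1 - t ^ 2 := by linarith
  rw [h1, h2]
  ring_nf
  linear_combination (4 * s * t * (t * c - e * s)) * h

theorem det_pos_iff {p q r : S1} : 0 < det (toPlane p) (toPlane q) (toPlane r) ↔ sbtw p q r := by
  rw [det_toPlane, sbtw_iff p, pos_self]
  have h0 := pos_nonneg p q
  have h1 := pos_nonneg p r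
  have h2 := pos_lt_one p q
  have h3 := pos_lt_one p r
  generalize pos p q = u at *
  generalize pos p r = v at *
  have hs : ∀ w : ℝ, 0 ≤ w → w < 1 → 0 ≤ Real.sin (Real.pi * w) ∧
      (0 < w → 0 < Real.sin (Real.pi * w)) := fun w h h' =>
    ⟨Real.sin_nonneg_of_nonneg_of_le_pi (by positivity) (by nlinarith [Real.pi_pos]),
      fun h => Real.sin_pos_of_pos_of_lt_pi (by positivity) (by nlinarith [Real.pi_pos])⟩
  constructor
  · intro h
    have hu : 0 < u := lt_of_le_of_ne h0 fun e => by simp [← e] at h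
    have hv : 0 < v := lt_of_le_of_ne h1 fun e => by simp [← e] at h
    refine Or.inl ⟨hu, ?_⟩
    by_contra hc
    push Not at hc
    have g := (hs (u - v) (by linarith) (by linarith)).1
    rw [← neg_sub u v, mul_neg, Real.sin_neg] at h
    have := (hs u h0 h2).2 hu
    have := (hs v h1 h3).2 hv
    have : 0 ≤ 4 * Real.sin (Real.pi * u) * Real.sin (Real.pi * v) *
        Real.sin (Real.pi * (u - v)) := by
      positivity
    linarith
  · rintro (⟨h, h'⟩ | ⟨h, h'⟩ | ⟨h, h'⟩)
    · have := (hs u h0 h2).2 h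
      have := (hs v h1 h3).2 (by linarith)
      have := (hs (v - u) (by linarith) (by linarith)).2 (by linarith)
      positivity
    · linarith
    · linarith

theorem det_swap (P Q R : ℂ) : det Q P R = -det P Q R := by unfold det; ring

theorem det_neg_iff {p q r : S1} : det (toPlane p) (toPlane q) (toPlane r) < 0 ↔ sbtw q p r := by
  rw [← det_pos_iff, det_swap, neg_lt_zero]

theorem det_self_left (P Q : ℂ) : det P Q P = 0 := by unfold det; ring

theorem det_self_right (P Q : ℂ) : det P Q Q = 0 := by unfold det; ring

theorem det_combo (P Q z w : ℂ) {s t : ℝ} (h : s + t = 1) :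
    det P Q (s • z + t • w) = s * det P Q z + t * det P Q w := by
  obtain rfl : s = 1 - t := by linarith
  simp only [det, Complex.add_re, Complex.add_im, Complex.real_smul, Complex.mul_re, Complex.mul_im,
    Complex.ofReal_re, Complex.ofReal_im]
  ring

theorem convex_det_lt (P Q : ℂ) (c : ℝ) : Convex ℝ {z | det P Q z < c} := by
  intro z hz w hw s t hs ht hst
  simp only [Set.mem_ofPred_eq] at *
  rw [det_combo _ _ _ _ hst]
  obtain rfl : s = 1 - t := by linarith
  rcases ht.eq_or_lt with rfl | ht
  · simpa
  · nlinarith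

theorem convex_det_le (P Q : ℂ) (c : ℝ) : Convex ℝ {z | det P Q z ≤ c} := by
  intro z hz w hw s t hs ht hst
  simp only [Set.mem_ofPred_eq] at *
  rw [det_combo _ _ _ _ hst]
  obtain rfl : s = 1 - t := by linarith
  nlinarith

theorem norm_toPlane (s : S1) : ‖toPlane s‖ = 1 := Circle.norm_coe _

theorem toPlane_inj {s t : S1} : toPlane s = toPlane t ↔ s = t :=
  ⟨fun h => AddCircle.injective_toCircle one_ne_zero (Circle.ext h), fun h => by rw [h]⟩

/-! ### Chords and polygons -/

theorem ends_mk (p q : S1) : Chord.ends s(p, q) = {p, q} := by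
  ext t; simp [Chord.ends]

theorem carrier_mk (p q : S1) : Chord.carrier s(p, q) = segment ℝ (toPlane p) (toPlane q) := by
  rw [Chord.carrier, ends_mk, ch, Set.image_pair, convexHull_pair]

theorem ball_of_openSegment {p q : S1} (h : p ≠ q) {z : ℂ}
    (hz : z ∈ openSegment ℝ (toPlane p) (toPlane q)) : z ∈ Metric.ball (0 : ℂ) 1 := by
  have := (strictConvex_closedBall ℝ (0 : ℂ) 1).openSegment_subset
    (x := toPlane p) (y := toPlane q) (by simp [norm_toPlane]) (by simp [norm_toPlane])
    (mt toPlane_inj.1 h) hz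
  rwa [interior_closedBall _ one_ne_zero] at this

theorem Cross.linked {a b x y : S1} (h : Cross a b x y) : Chord.Linked s(a, b) s(x, y) := by
  wlog hs : sbtw a x b ∧ sbtw b y a generalizing x y
  · have := this h.flip_right (h.resolve_left hs)
    rwa [Sym2.eq_swap (a := y)] at this
  have n := h.ne
  refine ⟨?_, ?_⟩
  · rw [ne_eq, Sym2.eq_iff]; tauto
  rw [carrier_mk, carrier_mk]
  have hs' : sbtw x b y ∧ sbtw y a x := by
    simp only [sbtw_iff a, Cyc, pos_self] at *
    have := pos_nonneg a b
    have := pos_nonneg a x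
    have := pos_nonneg a y
    clear h
    grind -ring
  have d1 : det (toPlane a) (toPlane b) (toPlane x) < 0 := det_neg_iff.2 (sbtw_rotate.2 hs.1)
  have d2 : 0 < det (toPlane a) (toPlane b) (toPlane y) := det_pos_iff.2 (sbtw_rotate.2 hs.2)
  have d3 : det (toPlane x) (toPlane y) (toPlane b) < 0 := det_neg_iff.2 (sbtw_rotate.2 hs'.1)
  have d4 : 0 < det (toPlane x) (toPlane y) (toPlane a) := det_pos_iff.2 (sbtw_rotate.2 hs'.2)
  have o1 := fun z => ball_of_openSegment (z := z) n.1
  generalize toPlane a = A at *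
  generalize toPlane b = B at *
  generalize toPlane x = X at *
  generalize toPlane y = Y at *
  -- the intersection point, in terms of both chords
  have e : det X Y A - det X Y B = det A B Y - det A B X := by unfold det; ring
  set D := det A B Y - det A B X with hD
  have hD0 : 0 < D := by linarith
  have hz : (-det X Y B / D) • A + (det X Y A / D) • B =
      (det A B Y / D) • X + (-det A B X / D) • Y := by
    simp only [div_eq_inv_mul, mul_smul, ← smul_add]
    congr 1
    apply Complex.ext <;>
    simp only [det, Complex.add_re, Complex.add_im, Complex.real_smul, Complex.mul_re,
      Complex.mul_im, Complex.ofReal_re, Complex.ofReal_im] <;> ring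
  have ho : (-det X Y B / D) • A + (det X Y A / D) • B ∈ openSegment ℝ A B :=
    ⟨_, _, div_pos (by linarith) hD0, div_pos d4 hD0, by
      rw [← add_div, div_eq_one_iff_eq hD0.ne']; linarith, rfl⟩
  refine ⟨_, ⟨openSegment_subset_segment _ _ _ ho, ?_⟩, o1 _ ho⟩
  rw [hz]
  exact ⟨_, _, (div_pos d2 hD0).le, (div_pos (by linarith) hD0).le,
    by rw [← add_div, div_eq_one_iff_eq hD0.ne']; linarith, rfl⟩

theorem det_nonpos_of_arc {u v t : S1} (h : Arc u v t) :
    det (toPlane u) (toPlane v) (toPlane t) ≤ 0 := by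
  rcases h with rfl | rfl | h
  · rw [det_self_left]
  · rw [det_self_right]
  · exact (det_neg_iff.2 (sbtw_rotate.2 h)).le

theorem cross_of_linked {a b x y : S1} (h : Chord.Linked s(a, b) s(x, y)) : Cross a b x y := by
  obtain ⟨hne, z, ⟨h1, h2⟩, h3⟩ := h
  rw [carrier_mk] at h1 h2
  have hz : ∀ t, z ≠ toPlane t := by
    rintro t rfl
    simp [norm_toPlane] at h3
  have hab : a ≠ b := by
    rintro rfl
    rw [segment_same] at h1
    exact hz _ h1
  have hxy : x ≠ y := by
    rintro rfl
    rw [segment_same] at h2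
    exact hz _ h2
  obtain ⟨s, t, hs, ht, hst, hzz⟩ : z ∈ openSegment ℝ (toPlane x) (toPlane y) :=
    mem_openSegment_of_ne_left_right (hz x).symm (hz y).symm h2
  have d0 : det (toPlane a) (toPlane b) z = 0 := by
    obtain ⟨s, t, hs, ht, hst, rfl⟩ := h1
    rw [det_combo _ _ _ _ hst, det_self_left, det_self_right]; simp
  rw [← hzz, det_combo _ _ _ _ hst] at d0
  by_contra hc
  have main : ∀ a b, a ≠ b → s(a, b) ≠ s(x, y) → s * det (toPlane a) (toPlane b) (toPlane x) +
      t * det (toPlane a) (toPlane b) (toPlane y) = 0 → Arc a b x → Arc a b y → False := by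
    intro a b hab hne d0 g1 g2
    have n1 := det_nonpos_of_arc g1
    have n2 := det_nonpos_of_arc g2
    have z1 : det (toPlane a) (toPlane b) (toPlane x) = 0 := by nlinarith
    have z2 : det (toPlane a) (toPlane b) (toPlane y) = 0 := by nlinarith
    have f1 : x = a ∨ x = b := by
      rcases g1 with g | g | g
      · exact Or.inl g
      · exact Or.inr g
      · exact absurd z1 (det_neg_iff.2 (sbtw_rotate.2 g)).ne
    have f2 : y = a ∨ y = b := by
      rcases g2 with g | g | g
      · exact Or.inl g
      · exact Or.inr g
      · exact absurd z2 (det_neg_iff.2 (sbtw_rotate.2 g)).ne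
    rw [ne_eq, Sym2.eq_iff] at hne
    grind
  rcases arc_of_uncrossed hab hc with ⟨g1, g2⟩ | ⟨g1, g2⟩
  · exact main a b hab hne d0 g1 g2
  · refine main b a hab.symm (by rwa [Sym2.eq_swap]) ?_ g1 g2
    rw [det_swap, det_swap (toPlane a)]
    linarith

theorem ch_mono {A B : Set S1} (h : A ⊆ B) : ch A ⊆ ch B := convexHull_mono (Set.image_mono h)

theorem ch_subset {V : Set S1} {S : Set ℂ} (hS : Convex ℝ S) (h : ∀ t ∈ V, toPlane t ∈ S) :
    ch V ⊆ S := convexHull_min (Set.image_subset_iff.2 h) hS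

theorem isPreconnected_ch (V : Set S1) : IsPreconnected (ch V) :=
  (convex_convexHull ℝ _).isPreconnected

theorem isClosed_ch {V : Set S1} (h : V.Finite) : IsClosed (ch V) :=
  (h.image _).isClosed_convexHull ℝ

/-- Points of the circle are extreme points of the disk. -/
theorem toPlane_mem_ch {V : Set S1} {t : S1} : toPlane t ∈ ch V ↔ t ∈ V := by
  refine ⟨fun h => ?_, fun h => subset_convexHull ℝ _ (Set.mem_image_of_mem _ h)⟩
  by_contra hn
  have key : ∀ s ≠ t, (toPlane t).re * (toPlane s).re + (toPlane t).im * (toPlane s).im < 1 := by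
    intro s hs
    have h1 := normSq_toPlane s
    have h2 := normSq_toPlane t
    have h3 : 0 < ((toPlane t).re - (toPlane s).re) ^ 2 +
        ((toPlane t).im - (toPlane s).im) ^ 2 := by
      by_contra hc
      refine hs (toPlane_inj.1 (Complex.ext ?_ ?_)) <;>
      nlinarith [sq_nonneg ((toPlane t).re - (toPlane s).re),
        sq_nonneg ((toPlane t).im - (toPlane s).im)]
    nlinarith
  have hconv : Convex ℝ {z : ℂ | (toPlane t).re * z.re + (toPlane t).im * z.im < 1} := by
    intro z hz w hw s r hs hr hsr
    simp only [Set.mem_ofPred_eq, Complex.add_re, Complex.add_im, Complex.real_smul,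
      Complex.mul_re, Complex.mul_im, Complex.ofReal_re, Complex.ofReal_im] at *
    obtain rfl : s = 1 - r := by linarith
    rcases hr.eq_or_lt with rfl | hr
    · simpa
    · nlinarith
  have := ch_subset hconv (fun s hs => key s fun e => hn (e ▸ hs)) h
  simp only [Set.mem_ofPred_eq] at this
  nlinarith [normSq_toPlane t]

theorem basis_ch (V : Set S1) : basis (ch V) = V := by
  ext t; exact toPlane_mem_ch

theorem interior_det_nonneg {P Q : ℂ} (h : P ≠ Q) {S : Set ℂ} (hS : ∀ z ∈ S, 0 ≤ det P Q z)
    {z : ℂ} (hz : z ∈ interior S) : 0 < det P Q z := by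
  by_contra hc
  rw [mem_interior_iff_mem_nhds] at hz
  -- moving to the right of `PQ` decreases the area
  have hcont : Filter.Tendsto (fun ε : ℝ => z - ε • (Complex.I * (Q - P)))
      (nhdsWithin 0 (Set.Ioi 0)) (nhds z) := by
    have : Continuous (fun ε : ℝ => z - ε • (Complex.I * (Q - P))) := by fun_prop
    have := (this.tendsto 0).mono_left (nhdsWithin_le_nhds (s := Set.Ioi 0))
    simpa using this
  obtain ⟨ε, hε, h0⟩ := ((hcont.eventually hz).and self_mem_nhdsWithin).exists
  have := hS _ hε
  have h0 : 0 < ε := h0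
  have hpos : 0 < (Q.re - P.re) ^ 2 + (Q.im - P.im) ^ 2 := by
    by_contra hc
    exact h (Complex.ext (by nlinarith [sq_nonneg (Q.re - P.re), sq_nonneg (Q.im - P.im)])
      (by nlinarith [sq_nonneg (Q.re - P.re), sq_nonneg (Q.im - P.im)]))
  have e : det P Q (z - ε • (Complex.I * (Q - P))) =
      det P Q z - ε * ((Q.re - P.re) ^ 2 + (Q.im - P.im) ^ 2) := by
    simp [det]; ring
  nlinarith [mul_pos h0 hpos]

/-- Two polygons separated by the line through `u` and `v`. -/
theorem disjoint_interior_of_arc {u v : S1} (huv : u ≠ v) {V W : Set S1} (hV : ∀ t ∈ V, Arc v u t)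
    (hW : ∀ t ∈ W, Arc u v t) : Disjoint (interior (ch V)) (ch W) := by
  refine Set.disjoint_left.2 fun z hz hz' => ?_
  have h1 : det (toPlane u) (toPlane v) z ≤ 0 :=
    ch_subset (convex_det_le _ _ 0) (fun t ht => det_nonpos_of_arc (hW t ht)) hz'
  refine absurd h1 (not_le.2 (interior_det_nonneg (mt toPlane_inj.1 huv) (fun w hw => ?_) hz))
  have h2 : det (toPlane v) (toPlane u) w ≤ 0 :=
    ch_subset (convex_det_le _ _ 0) (fun t ht => det_nonpos_of_arc (hV t ht)) hw
  rw [det_swap] at h2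
  linarith

/-- Two polygons separated by the line through `u` and `v`, which are not vertices of the second
one. -/
theorem disjoint_ch_of_arc {u v : S1} {V W : Set S1} (hV : ∀ t ∈ V, Arc v u t)
    (hW : ∀ t ∈ W, Arc u v t) (hu : u ∉ W) (hv : v ∉ W) : Disjoint (ch V) (ch W) := by
  refine Set.disjoint_left.2 fun z hz hz' => ?_
  have h1 : det (toPlane u) (toPlane v) z < 0 := by
    refine ch_subset (convex_det_lt _ _ 0) (fun t ht => ?_) hz'
    rcases hW t ht with rfl | rfl | h
    · exact absurd ht hu
    · exact absurd ht hv
    · exact det_neg_iff.2 (sbtw_rotate.2 h)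
  have h2 : det (toPlane v) (toPlane u) z ≤ 0 :=
    ch_subset (convex_det_le _ _ 0) (fun t ht => det_nonpos_of_arc (hV t ht)) hz
  rw [det_swap] at h2
  linarith

/-! ### Sibling leaves -/

theorem sigma_add_coe (d : ℕ) (s : S1) (r : ℝ) :
    sigma d (s + (r : S1)) = sigma d s + ((d * r : ℝ) : S1) := by
  rw [sigma, smul_add, sigma, ← nsmul_eq_mul]; rfl

theorem exists_mul_pos (d : ℕ) (c t : S1) :
    ∃ k : ℕ, d * pos c t = k + pos (sigma d c) (sigma d t) := by
  have h0 : 0 ≤ d * pos c t := mul_nonneg (Nat.cast_nonneg _) (pos_nonneg _ _)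
  refine ⟨⌊d * pos c t⌋₊, ?_⟩
  have h1 := Nat.floor_le h0
  have h2 := Nat.lt_floor_add_one (d * pos c t)
  have e : sigma d t = sigma d c + ((d * pos c t - ⌊d * pos c t⌋₊ : ℝ) : S1) := by
    conv_lhs => rw [eq_add_pos c t, sigma_add_coe]
    congr 1
    rw [eq_comm, ← sub_eq_zero, ← AddCircle.coe_sub, AddCircle.coe_eq_zero_iff]
    exact ⟨-⌊d * pos c t⌋₊, by simp⟩
  rw [e, pos_coe_add (by linarith) (by linarith)]
  ring

/-- A fibre of `σ_d` has at most `d` points. -/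
theorem exists_injOn_fibre {d : ℕ} (hd : 0 < d) (c : S1) :
    ∃ κ : S1 → Fin d, Set.InjOn κ {t | sigma d t = sigma d c} := by
  choose k hk using exists_mul_pos d c
  refine ⟨fun t => ⟨k t % d, Nat.mod_lt _ hd⟩, fun s hs t ht h => ?_⟩
  have key : ∀ t, sigma d t = sigma d c → d * pos c t = k t ∧ k t < d := by
    intro t ht
    have h1 := hk t
    rw [ht, pos_self, add_zero] at h1
    refine ⟨h1, ?_⟩
    have h2 : (d : ℝ) * pos c t < d * 1 :=
      mul_lt_mul_of_pos_left (pos_lt_one _ _) (by exact_mod_cast hd)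
    rw [h1, mul_one] at h2
    exact_mod_cast h2
  obtain ⟨h1, h2⟩ := key s hs
  obtain ⟨h3, h4⟩ := key t ht
  have h5 := congrArg Fin.val h
  simp only [Nat.mod_eq_of_lt h2, Nat.mod_eq_of_lt h4] at h5
  rw [h5, ← h3] at h1
  exact pos_inj.1 (mul_left_cancel₀ (by positivity) h1)

theorem finite_fibre {d : ℕ} (hd : 0 < d) (c : S1) : {t | sigma d t = sigma d c}.Finite := by
  obtain ⟨κ, hκ⟩ := exists_injOn_fibre hd c
  exact Set.Finite.of_injOn (Set.mapsTo_univ κ _) hκ Set.finite_univ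

theorem exists_eq_of_injective {d : ℕ} (hd : 0 < d) {c : S1} {u : Fin d → S1}
    (hu : ∀ i, sigma d (u i) = sigma d c) (hinj : Function.Injective u) {t : S1}
    (ht : sigma d t = sigma d c) : ∃ i, u i = t := by
  obtain ⟨κ, hκ⟩ := exists_injOn_fibre hd c
  have : Function.Injective (κ ∘ u) := fun i j h => hinj (hκ (hu i) (hu j) h)
  obtain ⟨i, hi⟩ := (Finite.injective_iff_surjective.1 this) (κ t)
  exact ⟨i, hκ (hu i) ht hi⟩

theorem sbtw_advance {d : ℕ} (hd : 0 < d) {s q α γ : S1} (h : sbtw α γ (sigma d q))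
    (hs : sigma d s = α) :
    sbtw s (s + ((pos α γ / d : ℝ) : S1)) q := by
  subst hs
  have hd' : (0 : ℝ) < d := by exact_mod_cast hd
  obtain ⟨k, hk⟩ := exists_mul_pos d s q
  rw [sbtw_iff (sigma d s), pos_self] at h
  have h0 := pos_nonneg (sigma d s) γ
  have h1 := pos_nonneg (sigma d s) (sigma d q)
  have h3 := pos_lt_one (sigma d s) γ
  have h2 : 0 < pos (sigma d s) γ ∧ pos (sigma d s) γ < pos (sigma d s) (sigma d q) := by
    unfold Cyc at h; grind -ring
  have hd1 : (1 : ℝ) ≤ d := by exact_mod_cast hd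
  have e : pos s (s + ((pos (sigma d s) γ / d : ℝ) : S1)) = pos (sigma d s) γ / d :=
    pos_coe_add (by positivity) ((div_le_self h0 hd1).trans_lt h3)
  rw [sbtw_iff s, e, pos_self]
  refine Or.inl ⟨div_pos h2.1 hd', ?_⟩
  rw [div_lt_iff₀ hd', mul_comm, hk]
  have : (0 : ℝ) ≤ k := Nat.cast_nonneg k
  linarith

theorem sigma_advance {d : ℕ} (hd : 0 < d) {s α γ : S1} (hs : sigma d s = α) :
    sigma d (s + ((pos α γ / d : ℝ) : S1)) = γ := by
  have hd' : (d : ℝ) ≠ 0 := by positivity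
  rw [sigma_add_coe, hs, mul_div_cancel₀ _ hd']
  exact (eq_add_pos α γ).symm

theorem mem_carrier_left (p q : S1) : toPlane p ∈ Chord.carrier s(p, q) := by
  rw [carrier_mk]; exact left_mem_segment _ _ _

theorem mem_carrier_right (p q : S1) : toPlane q ∈ Chord.carrier s(p, q) := by
  rw [carrier_mk]; exact right_mem_segment _ _ _

/-- Leaves with a common endpoint keep their order: otherwise there would be too few siblings. -/
theorem IsInvariantGeolamination.sbtw_sigma {d : ℕ} (hd : 0 < d) {L : Set Chord}
    (hL : IsInvariantGeolamination d L) {p q r : S1} (h1 : s(p, q) ∈ L) (h2 : s(p, r) ∈ L)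
    (n1 : sigma d p ≠ sigma d q) (n2 : sigma d p ≠ sigma d r) (n3 : sigma d q ≠ sigma d r)
    (h : sbtw p q r) : sbtw (sigma d p) (sigma d q) (sigma d r) := by
  by_contra hn
  rw [not_sbtw_iff_swap n1 n3 n2] at hn
  obtain ⟨f, ⟨i₀, hi₀⟩, hf, him, hdis⟩ := hL.siblings _ h2 (by simpa [Chord.image] using n2)
  have hex : ∀ i, ∃ t u, f i = s(t, u) ∧ sigma d t = sigma d p ∧ sigma d u = sigma d r := by
    intro i
    have := him i
    generalize f i = l at this ⊢
    induction l using Sym2.ind with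
    | h t u =>
      simp only [Chord.image, Sym2.map_mk, Sym2.eq_iff] at this
      rcases this with h | h
      · exact ⟨t, u, rfl, h.1, h.2⟩
      · exact ⟨u, t, Sym2.eq_swap, h.2, h.1⟩
  choose t u hfi ht hu using hex
  have tinj : Function.Injective t := by
    intro i j hij
    by_contra hne
    refine Set.disjoint_left.1 (hdis i j hne) (show toPlane (t i) ∈ _ from ?_) ?_
    · rw [hfi]; exact mem_carrier_left _ _
    · rw [hfi, hij]; exact mem_carrier_left _ _
  have uinj : Function.Injective u := by
    intro i j hij
    by_contra hne
    refine Set.disjoint_left.1 (hdis i j hne) (show toPlane (u i) ∈ _ from ?_) ?_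
    · rw [hfi]; exact mem_carrier_right _ _
    · rw [hfi, hij]; exact mem_carrier_right _ _
  obtain ⟨ht0, hu0⟩ : t i₀ = p ∧ u i₀ = r := by
    have := hi₀
    rw [hfi, Sym2.eq_iff] at this
    rcases this with h | h
    · exact h
    · exact absurd (by rw [← h.1, ht]) n2
  -- the points of the fibre of `σ(p)` on the arc `[p, q)`
  set A : Set S1 := {s | sigma d s = sigma d p ∧ (s = p ∨ sbtw p s q)} with hA
  have hAfin : A.Finite := (finite_fibre hd p).subset fun s hs => hs.1
  -- advance to the fibre of `σ(r)`, then follow the sibling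
  have step : ∀ s, ∃ i, s ∈ A → u i = s + ((pos (sigma d p) (sigma d r) / d : ℝ) : S1) ∧
      t i ∈ A ∧ t i ≠ p := by
    intro s
    by_cases hs : s ∈ A
    swap
    · exact ⟨i₀, fun h => absurd h hs⟩
    obtain ⟨i, hi⟩ := exists_eq_of_injective hd hu uinj (sigma_advance hd hs.1)
    refine ⟨i, fun _ => ?_⟩
    have hb := sbtw_advance hd hn hs.1
    rw [← hi] at hb
    have hpq : sbtw p (u i) q := by
      rcases hs.2 with rfl | h'
      · exact hb
      · clear * - hb h'
        simp only [sbtw_iff p, Cyc] at *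
        grind -ring
    have hne : i ≠ i₀ := by
      rintro rfl
      rw [hu0] at hpq
      exact (not_sbtw_iff_swap (sbtw_ne h).1 (sbtw_ne h).2.1 (sbtw_ne h).2.2).2 hpq h
    have hp : t i ≠ p := fun e => hne (tinj (e.trans ht0.symm))
    refine ⟨hi, ⟨ht i, Or.inr ?_⟩, hp⟩
    have hq : t i ≠ q := fun e => n1 (by rw [← ht i, e])
    have hc : ¬ Cross p q (u i) (t i) := fun hc => by
      refine hL.unlinked _ h1 _ (hf i) ?_
      rw [hfi]
      exact hc.flip_right.linked
    clear * - hc hpq hp hq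
    have := pos_nonneg p q
    have := pos_nonneg p (t i)
    simp only [Cross, sbtw_iff p, Cyc, ne_eq, ← pos_inj (c := p), pos_self] at *
    grind -ring
  choose ι hι using step
  have hmaps : Set.MapsTo (fun s => t (ι s)) A A := fun s hs => (hι s hs).2.1
  have hinj : Set.InjOn (fun s => t (ι s)) A := fun s hs s' hs' e => by
    have e1 : ι s = ι s' := tinj e
    have := (hι s hs).1
    rw [e1, (hι s' hs').1] at this
    exact (add_right_cancel this).symm
  obtain ⟨s, hs, e⟩ := Set.surj_on_of_inj_on_of_ncard_le (fun s _ => t (ι s)) hmaps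
    (fun _ _ h1 h2 e => hinj h1 h2 e) le_rfl hAfin p ⟨rfl, Or.inl rfl⟩
  exact (hι s hs).2.2 e.symm

/-- The leaves of an invariant geolamination, as a relation between their endpoints. -/
theorem IsInvariantGeolamination.lam {d : ℕ} (hd : 0 < d) {L : Set Chord}
    (hL : IsInvariantGeolamination d L) : Lam d (fun p q => s(p, q) ∈ L) where
  symm h := by rwa [Sym2.eq_swap]
  fwd h := hL.forward _ h
  uncrossed h1 h2 h := hL.unlinked _ h1 _ h2 h.linked
  vertex h1 h2 n1 n2 n3 h := hL.sbtw_sigma hd h1 h2 n1 n2 n3 h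

theorem image_iterate (d k : ℕ) (p q : S1) :
    (Chord.image d)^[k] s(p, q) = s(it d k p, it d k q) := by
  induction k with
  | zero => rfl
  | succ k ih => rw [Function.iterate_succ_apply', ih, ← sigma_it, ← sigma_it]; rfl

theorem accEnds_subset (d : ℕ) (a b x y : S1) (i : ℕ) : accEnds d a b x y i ⊆
    accordionEnds d s(x, y) ((Chord.image d)^[i] s(a, b)) := by
  rw [image_iterate]
  rintro t (rfl | rfl | ⟨j, hj, h⟩)
  · exact Set.mem_biUnion (Or.inl rfl) (by simp [Chord.ends])
  · exact Set.mem_biUnion (Or.inl rfl) (by simp [Chord.ends])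
  · refine Set.mem_biUnion (x := s(it d j x, it d j y))
      (Or.inr ⟨⟨j, (image_iterate _ _ _ _).symm⟩, hj.symm.linked⟩) ?_
    simpa [Chord.ends] using h

theorem Sys.of_mutuallyOrderPreserving {d : ℕ} (hd : 2 ≤ d) {L₁ L₂ : Set Chord}
    (hL₁ : IsInvariantGeolamination d L₁) (hL₂ : IsInvariantGeolamination d L₂) {a b x y : S1}
    (hla : s(a, b) ∈ L₁) (hlx : s(x, y) ∈ L₂) (hlinked : Chord.Linked s(a, b) s(x, y))
    (hop : MutuallyOrderPreservingAccordions d s(a, b) s(x, y)) :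
    Sys d (fun p q => s(p, q) ∈ L₁) (fun p q => s(p, q) ∈ L₂) a b x y where
  two_le := hd
  lamL := hL₁.lam (by omega)
  lamM := hL₂.lam (by omega)
  memL := hla
  memM := hlx
  cross := cross_of_linked hlinked
  opA i := (hop.1.2 i).mono (accEnds_subset _ _ _ _ _ _)
  opX i := (hop.2.2 i).mono (accEnds_subset _ _ _ _ _ _)

/-! ### Components of a finite union of closed connected sets -/

/-- The component of a point of `s i` consists of the sets that are joined to `s i` by a chain of
intersecting sets. -/
theorem connectedComponentIn_iUnion {ι X : Type*} [TopologicalSpace X] {s : ι → Set X}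
    (hf : (Set.range s).Finite) (hc : ∀ i, IsClosed (s i)) (hp : ∀ i, IsPreconnected (s i))
    {i : ι} {z : X} (hz : z ∈ s i) : connectedComponentIn (⋃ j, s j) z =
      ⋃ j ∈ {j | Relation.ReflTransGen (fun k l => (s k ∩ s l).Nonempty) i j}, s j := by
  set R := fun k l => (s k ∩ s l).Nonempty with hR
  set J := {j | Relation.ReflTransGen R i j} with hJ
  have hclosed : ∀ T : Set ι, IsClosed (⋃ j ∈ T, s j) := by
    intro T
    rw [← Set.sUnion_image, Set.sUnion_eq_biUnion]
    refine (hf.subset (Set.image_subset_range s T)).isClosed_biUnion ?_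
    rintro _ ⟨j, -, rfl⟩
    exact hc j
  have hiJ : i ∈ J := .refl
  refine Set.Subset.antisymm ?_ ?_
  · have hzX : z ∈ ⋃ j, s j := Set.mem_iUnion.2 ⟨i, hz⟩
    have hpre : IsPreconnected (connectedComponentIn (⋃ j, s j) z) :=
      isPreconnected_connectedComponentIn
    have hdis : (⋃ j ∈ J, s j) ∩ (⋃ j ∈ Jᶜ, s j) = ∅ := by
      refine Set.eq_empty_iff_forall_notMem.2 ?_
      rintro w ⟨h1, h2⟩
      obtain ⟨k, hk, h1⟩ := Set.mem_iUnion₂.1 h1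
      obtain ⟨l, hl, h2⟩ := Set.mem_iUnion₂.1 h2
      exact hl (Relation.ReflTransGen.tail hk ⟨w, h1, h2⟩)
    have hsub : connectedComponentIn (⋃ j, s j) z ⊆ (⋃ j ∈ J, s j) ∪ (⋃ j ∈ Jᶜ, s j) := by
      refine (connectedComponentIn_subset _ _).trans fun w hw => ?_
      obtain ⟨k, hk⟩ := Set.mem_iUnion.1 hw
      by_cases h : k ∈ J
      · exact Or.inl (Set.mem_biUnion h hk)
      · exact Or.inr (Set.mem_biUnion (show k ∈ Jᶜ from h) hk)
    rcases isPreconnected_iff_subset_of_disjoint_closed.1 hpre _ _ (hclosed J) (hclosed Jᶜ) hsub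
      (by rw [hdis, Set.inter_empty]) with h | h
    · exact h
    · have h1 := h (mem_connectedComponentIn hzX)
      have h2 : z ∈ ⋃ j ∈ J, s j := Set.mem_biUnion hiJ hz
      exact absurd (Set.mem_inter h2 h1) (by rw [hdis]; exact Set.notMem_empty z)
  · refine IsPreconnected.subset_connectedComponentIn ?_ (Set.mem_biUnion hiJ hz)
      (Set.iUnion₂_subset fun j _ => Set.subset_iUnion s j)
    refine IsPreconnected.biUnion_of_reflTransGen (fun j _ => hp j) fun k hk l hl => ?_
    have key : ∀ l, Relation.ReflTransGen R i l →
        Relation.ReflTransGen (fun k l => (s k ∩ s l).Nonempty ∧ k ∈ J) i l ∧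
        Relation.ReflTransGen (fun k l => (s k ∩ s l).Nonempty ∧ k ∈ J) l i := by
      intro l h
      induction h with
      | refl => exact ⟨.refl, .refl⟩
      | @tail k l hk hm ih =>
        exact ⟨ih.1.tail ⟨hm, hk⟩, ih.2.head ⟨by rwa [hR, Set.inter_comm] at hm, hk.tail hm⟩⟩
    exact (key k hk).2.trans (key l hl).1

namespace Sys

variable {d N : ℕ} {L M : S1 → S1 → Prop} {a b x y : S1}

/-! ### Quadrilaterals in the plane -/

theorem meet_iff (S : Sys d L M a b x y) {i j : ℕ} : Meet d a b x y i j ↔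
    (ch (verts d a b x y i) ∩ ch (verts d a b x y j)).Nonempty := by
  constructor
  · have hsub : ∀ i p q, p ∈ verts d a b x y i → q ∈ verts d a b x y i →
        Chord.carrier s(p, q) ⊆ ch (verts d a b x y i) := by
      intro i p q hp hq
      rw [Chord.carrier, ends_mk]
      exact ch_mono (by rintro t (rfl | rfl) <;> assumption)
    rintro (h | h | ⟨t, h1, h2⟩)
    · obtain ⟨z, ⟨h1, h2⟩, -⟩ := h.linked.2
      exact ⟨z, hsub i _ _ (by simp [verts]) (by simp [verts]) h1,
        hsub j _ _ (by simp [verts]) (by simp [verts]) h2⟩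
    · obtain ⟨z, ⟨h1, h2⟩, -⟩ := h.linked.2
      exact ⟨z, hsub i _ _ (by simp [verts]) (by simp [verts]) h2,
        hsub j _ _ (by simp [verts]) (by simp [verts]) h1⟩
    · exact ⟨_, toPlane_mem_ch.2 h1, toPlane_mem_ch.2 h2⟩
  · intro h
    by_contra hm
    unfold Meet at hm
    push Not at hm
    obtain ⟨h1, h2, h3⟩ := hm
    obtain ⟨u, v, -, g2, g3, g4, g5⟩ := S.exists_gap h1 h2
    exact h.ne_empty (disjoint_ch_of_arc g4 g5
      (fun hu => Set.eq_empty_iff_forall_notMem.1 h3 u ⟨g2, hu⟩)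
      (fun hv => Set.eq_empty_iff_forall_notMem.1 h3 v ⟨g3, hv⟩)).inter_eq

theorem disjoint_interior (S : Sys d L M a b x y) {i j : ℕ}
    (h1 : ¬ Cross (it d i a) (it d i b) (it d j x) (it d j y))
    (h2 : ¬ Cross (it d j a) (it d j b) (it d i x) (it d i y)) :
    Disjoint (interior (ch (verts d a b x y i))) (ch (verts d a b x y j)) := by
  obtain ⟨u, v, g1, -, -, g4, g5⟩ := S.exists_gap h1 h2
  exact disjoint_interior_of_arc g1 g4 g5

theorem _root_.CircleLam.finite_verts (i : ℕ) : (verts d a b x y i).Finite := by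
  have : verts d a b x y i = {it d i a, it d i b, it d i x, it d i y} := by
    ext t; simp [verts]
  rw [this]
  exact Set.toFinite _

theorem ncard_verts (S : Sys d L M a b x y) (i : ℕ) : (verts d a b x y i).ncard = 4 := by
  have : verts d a b x y i = {it d i a, it d i b, it d i x, it d i y} := by
    ext t; simp [verts]
  obtain ⟨h1, h2, h3, h4, h5, h6⟩ := (S.cross_diag i).ne
  rw [this, Set.ncard_insert_of_notMem (by simp [*]), Set.ncard_insert_of_notMem (by simp [*]),
    Set.ncard_pair h6]

theorem _root_.CircleLam.verts_add_mul (hP : Fixed d N a b x y) (i q : ℕ) :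
    verts d a b x y (i + q * N) = verts d a b x y i := by
  induction q with
  | zero => simp
  | succ q ih => rw [add_mul, one_mul, ← add_assoc, verts_add hP, ih]

theorem _root_.CircleLam.finite_range_verts (hN : 0 < N) (hP : Fixed d N a b x y) :
    (Set.range (verts d a b x y)).Finite := by
  refine ((Set.finite_Iio N).image (verts d a b x y)).subset ?_
  rintro _ ⟨i, rfl⟩
  refine ⟨i % N, Nat.mod_lt _ hN, ?_⟩
  conv_rhs => rw [← Nat.mod_add_div i N, mul_comm N, verts_add_mul hP]

/-- The vertices of the quadrilaterals connected to the one at time `i`. -/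
def _root_.CircleLam.cluster (d : ℕ) (a b x y : S1) (i : ℕ) : Set S1 :=
  ⋃ j ∈ {j | Relation.ReflTransGen (Meet d a b x y) i j}, verts d a b x y j

theorem component_eq (S : Sys d L M a b x y) (hN : 0 < N) (hP : Fixed d N a b x y) {i : ℕ}
    {z : ℂ} (hz : z ∈ ch (verts d a b x y i)) :
    connectedComponentIn (⋃ j, ch (verts d a b x y j)) z =
      ⋃ j ∈ {j | Relation.ReflTransGen (Meet d a b x y) i j}, ch (verts d a b x y j) := by
  rw [connectedComponentIn_iUnion (s := fun j => ch (verts d a b x y j)) ?_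
    (fun j => isClosed_ch (finite_verts j)) (fun j => isPreconnected_ch _) hz]
  · simp only [← S.meet_iff]
  · have := (finite_range_verts hN hP).image ch
    rwa [← Set.range_comp] at this

theorem _root_.CircleLam.basis_biUnion (T : Set ℕ) (V : ℕ → Set S1) :
    basis (⋃ j ∈ T, ch (V j)) = ⋃ j ∈ T, V j := by
  ext t
  simp only [basis, Set.mem_ofPred_eq, Set.mem_iUnion, toPlane_mem_ch]

theorem _root_.CircleLam.finite_cluster (hN : 0 < N) (hP : Fixed d N a b x y) (i : ℕ) :
    (cluster d a b x y i).Finite := by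
  rw [cluster, ← Set.sUnion_image]
  refine ((finite_range_verts hN hP).subset (Set.image_subset_range _ _)).sUnion ?_
  rintro _ ⟨j, -, rfl⟩
  exact finite_verts j

theorem _root_.CircleLam.fixed_of_mem_verts {n : ℕ} (hP : Fixed d n a b x y) {j : ℕ} {t : S1}
    (h : t ∈ verts d a b x y j) : it d n t = t := by
  have := hP.iter j
  rcases h with rfl | rfl | rfl | rfl
  exacts [this.1, this.2.1, this.2.2.1, this.2.2.2]

theorem _root_.CircleLam.fixed_of_mem_cluster {n : ℕ} (hP : Fixed d n a b x y) {i : ℕ} {t : S1}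
    (h : t ∈ cluster d a b x y i) : it d n t = t := by
  obtain ⟨j, -, h⟩ := Set.mem_iUnion₂.1 h
  exact fixed_of_mem_verts hP h

theorem meet_add_right (S : Sys d L M a b x y) {i j : ℕ} (m : ℕ) (h : Meet d a b x y i j) :
    Meet d a b x y (i + m) (j + m) := by
  rcases h with h | h | ⟨t, h1, h2⟩
  · exact Or.inl (S.cross_add m h)
  · exact Or.inr (Or.inl (S.cross_add m h))
  · exact Or.inr (Or.inr ⟨it d m t, it_mem_verts h1, it_mem_verts h2⟩)

theorem _root_.CircleLam.meet_of_verts_eq {i j : ℕ}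
    (h : verts d a b x y i = verts d a b x y j) : Meet d a b x y i j :=
  Or.inr (Or.inr ⟨it d i a, by simp [verts], by rw [← h]; simp [verts]⟩)

/-- If the quadrilaterals at times `i` and `i + m` are connected, `σ^m` permutes the cluster. -/
theorem image_cluster (S : Sys d L M a b x y) (hN : 0 < N) (hP : Fixed d N a b x y) {i m : ℕ}
    (h : Relation.ReflTransGen (Meet d a b x y) i (i + m)) :
    (sigma d)^[m] '' cluster d a b x y i = cluster d a b x y i := by
  have hinj : Set.InjOn ((sigma d)^[m]) (cluster d a b x y i) := fun s hs t ht e =>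
    it_inj_of_fixed hN (fixed_of_mem_cluster hP hs) (fixed_of_mem_cluster hP ht) e
  refine Set.eq_of_subset_of_ncard_le ?_ hinj.ncard_image.ge
    (finite_cluster hN hP i)
  rintro _ ⟨t, ht, rfl⟩
  obtain ⟨j, hj, ht⟩ := Set.mem_iUnion₂.1 ht
  exact Set.mem_biUnion (h.trans (hj.out.lift (fun k => k + m)
    fun _ _ h => S.meet_add_right m h)) (it_mem_verts ht)

theorem exists_isReturnTime (S : Sys d L M a b x y) (hN : 0 < N) (hP : Fixed d N a b x y) {i : ℕ}
    {Q : Set ℂ} (hQ : basis Q = cluster d a b x y i) : ∃ n, IsReturnTime d Q n := by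
  have : ({n : ℕ | 0 < n ∧ (sigma d)^[n] '' basis Q = basis Q}).Nonempty :=
    ⟨N, hN, by
      rw [hQ]
      exact S.image_cluster hN hP (.single (meet_of_verts_eq (verts_add hP i).symm))⟩
  exact ⟨sInf _, Nat.sInf_mem this, fun m hm => Nat.sInf_le hm⟩

/-- Periodic vertices of a quadrilateral all have the same period. -/
theorem minimalPeriod_eq (S : Sys d L M a b x y) (hN : 0 < N) (hP : Fixed d N a b x y) {t : S1}
    (ht : t = a ∨ t = b ∨ t = x ∨ t = y) :
    Function.minimalPeriod (sigma d) t = Function.minimalPeriod (sigma d) a := by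
  refine Nat.dvd_antisymm ?_ ?_
  · refine Function.IsPeriodicPt.minimalPeriod_dvd ?_
    have := S.fixed_of_fixed_vertex hN hP (Or.inl rfl) (n := Function.minimalPeriod (sigma d) a)
      (Function.isPeriodicPt_minimalPeriod (sigma d) a)
    rcases ht with rfl | rfl | rfl | rfl
    exacts [this.1, this.2.1, this.2.2.1, this.2.2.2]
  · exact Function.IsPeriodicPt.minimalPeriod_dvd (S.fixed_of_fixed_vertex hN hP ht
      (n := Function.minimalPeriod (sigma d) t) (Function.isPeriodicPt_minimalPeriod (sigma d) t)).1

theorem ncard_orbit (S : Sys d L M a b x y) :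
    (orbit d '' {a, b, x, y}).ncard ∈ ({2, 3, 4} : Set ℕ) := by
  have hfin : (orbit d '' {a, b, x, y}).Finite := (Set.toFinite _).image _
  have h4 : (orbit d '' {a, b, x, y}).ncard ≤ 4 := by
    refine (Set.ncard_image_le (Set.toFinite _)).trans ?_
    have := S.ncard_verts 0
    rw [← this]
    refine Set.ncard_le_ncard ?_ (finite_verts 0)
    rintro t (rfl | rfl | rfl | rfl) <;> simp [verts]
  have h0 : (orbit d '' {a, b, x, y}).ncard ≠ 0 := by
    exact (Set.ncard_pos hfin).2 ⟨orbit d a, a, by simp, rfl⟩ |>.ne'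
  have h1 : (orbit d '' {a, b, x, y}).ncard ≠ 1 := by
    intro h
    obtain ⟨o, ho⟩ := Set.ncard_eq_one.1 h
    have key : ∀ t ∈ ({a, b, x, y} : Set S1), ∃ n, t = it d n a := by
      intro t ht
      have h1 : orbit d t = o := by
        have : orbit d t ∈ orbit d '' {a, b, x, y} := ⟨t, ht, rfl⟩
        rwa [ho] at this
      have h2 : orbit d a = o := by
        have : orbit d a ∈ orbit d '' {a, b, x, y} := ⟨a, by simp, rfl⟩
        rwa [ho] at this
      have : t ∈ orbit d t := ⟨0, rfl⟩
      rwa [h1, ← h2] at this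
    obtain ⟨k, hk⟩ := key b (by simp)
    obtain ⟨s, hs⟩ := key x (by simp)
    obtain ⟨s', hs'⟩ := key y (by simp)
    exact S.not_single_orbit hk hs hs'
  simp only [Set.mem_insert_iff, Set.mem_singleton_iff]
  omega

end Sys

/-! ### Return times -/

namespace Sys

variable {d N : ℕ} {L M : S1 → S1 → Prop} {a b x y : S1}

/-- If `σ^N` fixes all vertices and no smaller power of `σ` permutes a cluster, the cluster is a
single quadrilateral. -/
theorem verts_eq_of_isReturnTime (S : Sys d L M a b x y) (hN : 0 < N) (hP : Fixed d N a b x y)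
    {i j : ℕ} (hmin : ∀ m, 0 < m → m < N →
      (sigma d)^[m] '' cluster d a b x y i ≠ cluster d a b x y i)
    (hj : Relation.ReflTransGen (Meet d a b x y) i j) :
    verts d a b x y j = verts d a b x y i := by
  have hle : i ≤ i * N := Nat.le_mul_of_pos_right i hN
  set m := (j + (i * N - i)) % N with hm
  set q := (j + (i * N - i)) / N with hq
  have e : j + i * N = i + m + q * N := by
    have := Nat.mod_add_div (j + (i * N - i)) N
    rw [← hm, ← hq, mul_comm N] at this
    omega
  have hv : verts d a b x y j = verts d a b x y (i + m) := by
    rw [← verts_add_mul hP j i, e, verts_add_mul hP]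
  rcases Nat.eq_zero_or_pos m with h0 | h0
  · rw [hv, h0, add_zero]
  · exact absurd (S.image_cluster hN hP (hj.tail (meet_of_verts_eq hv)))
      (hmin m h0 (Nat.mod_lt _ hN))

/-- If the first return map of a cluster is the identity, the cluster is a single quadrilateral. -/
theorem verts_eq_of_return (S : Sys d L M a b x y) (hN : 0 < N) (hP : Fixed d N a b x y)
    {i n : ℕ} {Q : Set ℂ} (hQ : basis Q = cluster d a b x y i) (hn : IsReturnTime d Q n)
    (hid : ∀ t ∈ basis Q, (sigma d)^[n] t = t) {j : ℕ}
    (hj : Relation.ReflTransGen (Meet d a b x y) i j) :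
    verts d a b x y j = verts d a b x y i := by
  have hmem : ∀ t ∈ verts d a b x y i, it d n t = t := fun t ht => hid t (by
    rw [hQ]; exact Set.mem_biUnion (show i ∈ _ from Relation.ReflTransGen.refl) ht)
  have hle : i ≤ i * N := Nat.le_mul_of_pos_right i hN
  -- the vertices at time `0` are images of those at time `i`
  have back : ∀ t, it d N t = t → it d (i * N - i) (it d i t) = t := fun t ht => by
    rw [it_it, Nat.add_sub_cancel' hle, it_mul_of_fixed ht]
  have hPn : Fixed d n a b x y := by
    refine ⟨?_, ?_, ?_, ?_⟩
    · rw [← back a hP.1]; exact it_fixed (hmem _ (by simp [verts])) _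
    · rw [← back b hP.2.1]; exact it_fixed (hmem _ (by simp [verts])) _
    · rw [← back x hP.2.2.1]; exact it_fixed (hmem _ (by simp [verts])) _
    · rw [← back y hP.2.2.2]; exact it_fixed (hmem _ (by simp [verts])) _
  refine S.verts_eq_of_isReturnTime hn.1.1 hPn (fun m h0 hm h => ?_) hj
  rw [← hQ] at h
  exact absurd (hn.2 ⟨h0, h⟩) (by omega)

end Sys

theorem vertices_mk (d : ℕ) (a b x y : S1) (i : ℕ) :
    vertices d s(a, b) s(x, y) i = verts d a b x y i := by
  ext t
  simp only [vertices, ends_mk, Set.mem_image, verts, Set.mem_ofPred_eq, it]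
  constructor
  · rintro ⟨s, (rfl | rfl) | (rfl | rfl), rfl⟩ <;> tauto
  · rintro (rfl | rfl | rfl | rfl)
    · exact ⟨a, by simp, rfl⟩
    · exact ⟨b, by simp, rfl⟩
    · exact ⟨x, by simp, rfl⟩
    · exact ⟨y, by simp, rfl⟩

theorem verts_shift (d : ℕ) (a b x y : S1) (r k : ℕ) :
    verts d (it d r a) (it d r b) (it d r x) (it d r y) k = verts d a b x y (r + k) := by
  simp only [verts, it_it]

theorem orbitUnion_mk (d : ℕ) (a b x y : S1) (r : ℕ) :
    orbitUnion d s(a, b) s(x, y) r =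
      ⋃ k, ch (verts d (it d r a) (it d r b) (it d r x) (it d r y) k) := by
  ext z
  simp only [orbitUnion, Set.mem_iUnion, polygon, vertices_mk, verts_shift]
  constructor
  · rintro ⟨i, hi, hz⟩
    exact ⟨i - r, by rwa [Nat.add_sub_cancel' hi]⟩
  · rintro ⟨k, hz⟩
    exact ⟨r + k, by omega, hz⟩

end CircleLam

end

theorem theorem3 (d : ℕ) (hd : 2 ≤ d)
    (L₁ L₂ : Set CircleLam.Chord)
    (hL₁ : CircleLam.IsInvariantGeolamination d L₁)
    (hL₂ : CircleLam.IsInvariantGeolamination d L₂)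
    (la lx : CircleLam.Chord) (hla : la ∈ L₁) (hlx : lx ∈ L₂)
    (hlinked : CircleLam.Chord.Linked la lx)
    (hop : CircleLam.MutuallyOrderPreservingAccordions d la lx) :
    -- (1) all forward images of `B` are pairwise disjoint, or
    (∀ i j : ℕ, i ≠ j →
      Disjoint (CircleLam.polygon d la lx i) (CircleLam.polygon d la lx j)) ∨
    -- (2)
    (∃ r : ℕ,
      -- (a)
      (∀ i < r, ∀ j : ℕ, j ≠ i →
        Disjoint (interior (CircleLam.polygon d la lx i)) (CircleLam.polygon d la lx j)) ∧
      -- (b)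
      (∀ Q : Set ℂ, CircleLam.IsComponent Q (CircleLam.orbitUnion d la lx r) →
        (CircleLam.basis Q).Finite ∧
        CircleLam.OrderPreservingOn d (CircleLam.basis Q) ∧
        ∃ n : ℕ, CircleLam.IsReturnTime d Q n ∧
          ((∀ t ∈ CircleLam.basis Q, (CircleLam.sigma d)^[n] t = t) →
            (∃ i : ℕ, r ≤ i ∧ Q = CircleLam.polygon d la lx i) ∧
            (CircleLam.polygon d la lx r ⊆ Q → Q = CircleLam.polygon d la lx r) ∧
            (CircleLam.basis Q).ncard = 4)) ∧
      (∃ N : ℕ, 0 < N ∧ ∀ t ∈ CircleLam.vertices d la lx r,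
        Function.minimalPeriod (CircleLam.sigma d) t = N) ∧
      (CircleLam.orbit d '' CircleLam.vertices d la lx r).ncard ∈ ({2, 3, 4} : Set ℕ) ∧
      -- (c)
      (∃ N : ℕ, ∀ t ∈ CircleLam.Chord.ends la ∪ CircleLam.Chord.ends lx,
        CircleLam.HasEventualPeriod d N t)) := by
  induction la using Sym2.ind with | _ a b
  induction lx using Sym2.ind with | _ x y
  have S := CircleLam.Sys.of_mutuallyOrderPreserving hd hL₁ hL₂ hla hlx hlinked hop
  refine or_iff_not_imp_left.2 fun hnd => ?_
  have hex : ∃ r n, 0 < n ∧ CircleLam.Fixed d n (CircleLam.it d r a) (CircleLam.it d r b)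
      (CircleLam.it d r x) (CircleLam.it d r y) := by
    push Not at hnd
    obtain ⟨i, j, hij, h⟩ := hnd
    rw [Set.not_disjoint_iff_nonempty_inter, CircleLam.polygon, CircleLam.polygon,
      CircleLam.vertices_mk, CircleLam.vertices_mk, ← S.meet_iff] at h
    exact S.exists_fixed_of_meet hij h
  -- the first time at which the vertices are periodic
  obtain ⟨r, ⟨N, hN, hP⟩, hr⟩ : ∃ r, (∃ n, 0 < n ∧ CircleLam.Fixed d n (CircleLam.it d r a)
      (CircleLam.it d r b) (CircleLam.it d r x) (CircleLam.it d r y)) ∧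
      ∀ i < r, ¬ ∃ n, 0 < n ∧ CircleLam.Fixed d n (CircleLam.it d i a)
        (CircleLam.it d i b) (CircleLam.it d i x) (CircleLam.it d i y) := by
    classical
    exact ⟨Nat.find hex, Nat.find_spec hex, fun i hi => Nat.find_min hex hi⟩
  have S' := S.shift r
  have hpol : ∀ k, CircleLam.polygon d s(a, b) s(x, y) (r + k) = CircleLam.ch
      (CircleLam.verts d (CircleLam.it d r a) (CircleLam.it d r b) (CircleLam.it d r x)
        (CircleLam.it d r y) k) := fun k => by
    rw [CircleLam.verts_shift, CircleLam.polygon, CircleLam.vertices_mk]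
  have hper : ∀ t ∈ CircleLam.vertices d s(a, b) s(x, y) r,
      Function.minimalPeriod (CircleLam.sigma d) t =
        Function.minimalPeriod (CircleLam.sigma d) (CircleLam.it d r a) := fun t ht => by
    rw [CircleLam.vertices_mk] at ht
    exact S'.minimalPeriod_eq hN hP ht
  have hpos : 0 < Function.minimalPeriod (CircleLam.sigma d) (CircleLam.it d r a) :=
    Function.minimalPeriod_pos_of_mem_periodicPts ⟨N, hN, hP.1⟩
  refine ⟨r, fun i hi j hj => ?_, ?_, ⟨_, hpos, hper⟩, ?_, _,
    fun t ht => ⟨hpos, r, hper _ ⟨t, ht, rfl⟩⟩⟩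
  · rw [CircleLam.polygon, CircleLam.polygon, CircleLam.vertices_mk, CircleLam.vertices_mk]
    have hc : ¬ (CircleLam.Cross (CircleLam.it d i a) (CircleLam.it d i b) (CircleLam.it d j x)
        (CircleLam.it d j y) ∨ CircleLam.Cross (CircleLam.it d j a) (CircleLam.it d j b)
        (CircleLam.it d i x) (CircleLam.it d i y)) := fun hc => by
      rcases lt_or_gt_of_ne hj with h | h
      · exact hr j (h.trans hi) (S.fixed_of_cross_later h hc.symm)
      · exact hr i hi (S.fixed_of_cross_later h hc)
    exact S.disjoint_interior (fun h => hc (Or.inl h)) fun h => hc (Or.inr h)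
  · rintro Q ⟨z, hz, hQ⟩
    rw [CircleLam.orbitUnion_mk] at hz hQ
    obtain ⟨i, hi⟩ := Set.mem_iUnion.1 hz
    rw [S'.component_eq hN hP hi] at hQ
    have hb : CircleLam.basis Q = CircleLam.cluster d (CircleLam.it d r a) (CircleLam.it d r b)
        (CircleLam.it d r x) (CircleLam.it d r y) i := by
      rw [hQ, CircleLam.basis_biUnion]; rfl
    obtain ⟨n, hn⟩ := S'.exists_isReturnTime hN hP hb
    refine ⟨by rw [hb]; exact CircleLam.finite_cluster hN hP i,
      by rw [hb]; exact S'.orderPreservingOn_of_reach hN hP i, n, hn, fun hid => ?_⟩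
    have hv := fun j => S'.verts_eq_of_return hN hP hb hn hid (j := j)
    have hQi : Q = CircleLam.polygon d s(a, b) s(x, y) (r + i) := by
      rw [hQ, hpol]
      refine Set.Subset.antisymm (Set.iUnion₂_subset fun j hj => (hv j hj) ▸ subset_rfl) ?_
      exact Set.subset_biUnion_of_mem (u := fun j => CircleLam.ch (CircleLam.verts d _ _ _ _ j))
        (show i ∈ _ from Relation.ReflTransGen.refl)
    refine ⟨⟨r + i, by omega, hQi⟩, fun hsub => ?_, ?_⟩
    · have h0 : CircleLam.Meet d (CircleLam.it d r a) (CircleLam.it d r b) (CircleLam.it d r x)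
          (CircleLam.it d r y) i 0 := by
        rw [S'.meet_iff, ← hpol, ← hpol, ← hQi, add_zero, Set.inter_eq_self_of_subset_right hsub]
        rw [← add_zero r, hpol]
        exact ⟨_, CircleLam.toPlane_mem_ch.2 (Or.inl rfl)⟩
      rw [hQi, hpol, ← hv 0 (.single h0), ← hpol, add_zero]
    · rw [hQi, hpol, CircleLam.basis_ch]
      exact S'.ncard_verts i
  · rw [CircleLam.vertices_mk]
    have e : CircleLam.verts d a b x y r = {CircleLam.it d r a, CircleLam.it d r b,
        CircleLam.it d r x, CircleLam.it d r y} := rfl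
    rw [e]
    exact S'.ncard_orbit
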